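/- Let $n\ge 1$, let $M$ be a smooth compact $(n+1)$-dimensional manifold with (possibly empty) boundary $\partial M$, and let $g$ be a smooth Riemannian metric on $M$. An almost properly embedded hypersurface in $M$ is given by a smooth embedding $\varphi:\Sigma\to M$ of a smooth $n$-dimensional manifold $\Sigma$ with (possibly empty) boundary such that $\varphi(\partial\Sigma)\subset\partial M$ (the interior of $\Sigma$ may touch $\partial M$); here an embedding is a topological embedding that is smooth with injective differential at every point. It is properly embedded if moreover its touching set $(\varphi(\Sigma)\cap\partial M)\setminus\varphi(\partial\Sigma)$ is empty. It is a free boundary minimal hypersurface (FBMH) in $(M,\partial M;g)$ if its mean curvature with respect to $g$ vanishes and it meets $\partial M$ orthogonally along $\varphi(\partial\Sigma)$. Let $\Sigma$ be compact and let $\varphi:\Sigma\to M$ be an almost properly embedded FBMH in $(M,\partial M;g)$. Then there exist a sequence of smooth Riemannian metrics $g_i$ on $M$ and a sequence of maps $\varphi_i:\Sigma\to M$, with images the hypersurfaces $\Sigma_i=\varphi_i(\Sigma)$, such that 1. $g_i$ converges to $g$ in the smooth ($C^\infty$) topology; 2. $\Sigma_i$ converges smoothly to $\varphi(\Sigma)$,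 that is, $\varphi_i\to\varphi$ in the $C^\infty$ topology; 3. for every $i$, $\varphi_i$ is a properly embedded FBMH in $(M,\partial M;g_i)$. -/

import Mathlib

open Set Filter Topology
open scoped Manifold ContDiff

noncomputable section

namespace FreeBoundary

/-- Smooth Riemannian metrics on a smooth `m`-dimensional manifold with (possibly empty)
boundary. -/
abbrev Metric (m : ℕ) [NeZero m] (M : Type*) [TopologicalSpace M]
    [ChartedSpace (EuclideanHalfSpace m) M] [IsManifold (𝓡∂ m) ∞ M] :=
  Bundle.ContMDiffRiemannianMetric (𝓡∂ m) ∞ (EuclideanSpace ℝ (Fin m))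
    (fun x : M => TangentSpace (𝓡∂ m) x)

section Ambient

variable {m : ℕ} [NeZero m] {M : Type*} [TopologicalSpace M]
  [ChartedSpace (EuclideanHalfSpace m) M] [IsManifold (𝓡∂ m) ∞ M]

/-- The tangent vector at the point with coordinates `y` (in the chart around `x`) whose coordinate
vector is `v`. -/
def coordVector (x : M) (y v : EuclideanSpace ℝ (Fin m)) :
    TangentSpace (𝓡∂ m) ((extChartAt (𝓡∂ m) x).symm y) :=
  mfderivWithin 𝓘(ℝ, EuclideanSpace ℝ (Fin m)) (𝓡∂ m) (extChartAt (𝓡∂ m) x).symm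
    (range (𝓡∂ m)) y v

/-- The coordinate expression `y ↦ g_y(v, w)` of the metric `g` in the chart around `x`, for
coordinate vectors `v` and `w`. -/
def metricInChart (g : Metric m M) (x : M) (y v w : EuclideanSpace ℝ (Fin m)) : ℝ :=
  g.inner ((extChartAt (𝓡∂ m) x).symm y) (coordVector x y v) (coordVector x y w)

/-- The derivative at `x`, in the direction `u`, of `y ↦ g_y(v, w)` in the chart around `x`. -/
def metricDeriv (g : Metric m M) (x : M) (u v w : EuclideanSpace ℝ (Fin m)) : ℝ :=
  fderivWithin ℝ (fun y => metricInChart g x y v w) (range (𝓡∂ m)) (extChartAt (𝓡∂ m) x x) u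

/-- The Christoffel symbols of the first kind at `x` in the chart around `x`:
`christoffel g x u v w = g(∇_u v, w)` for the Levi-Civita connection `∇` of `g`, the coordinate
vectors `u`, `v`, `w` being extended to constant coordinate fields. -/
def christoffel (g : Metric m M) (x : M) (u v w : EuclideanSpace ℝ (Fin m)) : ℝ :=
  (metricDeriv g x u v w + metricDeriv g x v u w - metricDeriv g x w u v) / 2

/-- `v` is tangent to the boundary of `M` (used for `x ∈ ∂M` only). Recall that the fibre of
`TangentSpace` at `x` is identified with the model space through the preferred chart at `x`, in
which `∂M` is the zero set of the coordinate `0`. -/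
def IsTangentToBoundary (x : M) (v : TangentSpace (𝓡∂ m) x) : Prop :=
  (show EuclideanSpace ℝ (Fin m) from v) 0 = 0

/-- Smooth convergence `g_i → g`: in every chart, all the partial derivatives of all the components
converge uniformly on compact sets. -/
def MetricsConvergeSmoothly (gs : ℕ → Metric m M) (g : Metric m M) : Prop :=
  ∀ (x : M) (K : Set (EuclideanSpace ℝ (Fin m))), IsCompact K → K ⊆ (extChartAt (𝓡∂ m) x).target →
    ∀ (k : ℕ) (v w : EuclideanSpace ℝ (Fin m)),
      TendstoUniformlyOn
        (fun i y => iteratedFDerivWithin ℝ k (fun z => metricInChart (gs i) x z v w)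
          (range (𝓡∂ m)) y)
        (fun y => iteratedFDerivWithin ℝ k (fun z => metricInChart g x z v w) (range (𝓡∂ m)) y)
        atTop K

end Ambient

section Hypersurface

variable {n m : ℕ} [NeZero n] [NeZero m]
  {S : Type*} [TopologicalSpace S] [ChartedSpace (EuclideanHalfSpace n) S]
  {M : Type*} [TopologicalSpace M] [ChartedSpace (EuclideanHalfSpace m) M]

/-- A smooth embedding `φ : S → M` which maps `∂S` into `∂M`. The interior of `S` may touch `∂M`;
so smoothness and injectivity of the differential are required as for maps into an extension of `M`
across its boundary, and no slice charts of `M` are asked for. -/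
structure IsAlmostProperlyEmbedded (φ : S → M) : Prop where
  smooth : ContMDiff (𝓡∂ n) (𝓡∂ m) ∞ φ
  embedding : IsEmbedding φ
  immersion : ∀ p, Function.Injective (mfderiv (𝓡∂ n) (𝓡∂ m) φ p)
  boundary : ∀ p ∈ (𝓡∂ n).boundary S, φ p ∈ (𝓡∂ m).boundary M

/-- An almost properly embedded `φ : S → M` is properly embedded when its touching set
`(φ(S) ∩ ∂M) \ φ(∂S)` is empty. -/
structure IsProperlyEmbedded (φ : S → M) : Prop extends
    IsAlmostProperlyEmbedded (n := n) (m := m) φ where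
  touching_empty : (range φ ∩ (𝓡∂ m).boundary M) \ (φ '' (𝓡∂ n).boundary S) = ∅

/-- The differential of `φ` at `p`, as a map between tangent spaces. -/
abbrev differential (φ : S → M) (p : S) :
    TangentSpace (𝓡∂ n) p →L[ℝ] TangentSpace (𝓡∂ m) (φ p) :=
  mfderiv (𝓡∂ n) (𝓡∂ m) φ p

/-- Second derivative at `p` of `φ` written in the charts around `p` and `φ p`. -/
def coordHessian (φ : S → M) (p : S) (v w : EuclideanSpace ℝ (Fin n)) :
    EuclideanSpace ℝ (Fin m) :=
  fderivWithin ℝ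
    (fderivWithin ℝ (writtenInExtChartAt (𝓡∂ n) (𝓡∂ m) p φ) (range (𝓡∂ n)))
    (range (𝓡∂ n)) (extChartAt (𝓡∂ n) p p) v w

/-- Smooth convergence `φ_i → φ`: on compact sets `K` which `φ` maps into the domain of one chart,
the `φ_i` eventually do so too, and all their partial derivatives in the charts converge
uniformly on `K`. -/
def MapsConvergeSmoothly (φs : ℕ → S → M) (φ : S → M) : Prop :=
  ∀ (p : S) (q : M) (K : Set S), IsCompact K → K ⊆ (extChartAt (𝓡∂ n) p).source →
    φ '' K ⊆ (extChartAt (𝓡∂ m) q).source →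
      (∀ᶠ i in atTop, φs i '' K ⊆ (extChartAt (𝓡∂ m) q).source) ∧
      ∀ k : ℕ, TendstoUniformlyOn
        (fun i y => iteratedFDerivWithin ℝ k
          (extChartAt (𝓡∂ m) q ∘ φs i ∘ (extChartAt (𝓡∂ n) p).symm) (range (𝓡∂ n)) y)
        (fun y => iteratedFDerivWithin ℝ k
          (extChartAt (𝓡∂ m) q ∘ φ ∘ (extChartAt (𝓡∂ n) p).symm) (range (𝓡∂ n)) y)
        atTop (extChartAt (𝓡∂ n) p '' K)

variable [IsManifold (𝓡∂ m) ∞ M]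

/-- `ν ∈ T_{φ(p)} M` is normal to the hypersurface `φ` at `p`. -/
def IsNormal (g : Metric m M) (φ : S → M) (p : S) (ν : TangentSpace (𝓡∂ m) (φ p)) : Prop :=
  ∀ v : TangentSpace (𝓡∂ n) p, g.inner (φ p) (differential φ p v) ν = 0

/-- The second fundamental form of `φ` at `p` in the direction of a normal vector `ν`:
`g(∇_{dφ v} dφ w, ν)`, where in coordinates
`∇_{dφ v} dφ w = D²φ(v, w) + Γ(dφ v, dφ w)`. -/
def secondFundamentalForm (g : Metric m M) (φ : S → M) (p : S) (ν : TangentSpace (𝓡∂ m) (φ p))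
    (v w : TangentSpace (𝓡∂ n) p) : ℝ :=
  g.inner (φ p) (show TangentSpace (𝓡∂ m) (φ p) from coordHessian (n := n) (m := m) φ p v w) ν
    + christoffel g (φ p) (differential φ p v) (differential φ p w) ν

/-- The `a`-th coordinate vector at `p` in the chart around `p`. -/
def basisVector (p : S) (a : Fin n) : TangentSpace (𝓡∂ n) p :=
  (EuclideanSpace.single a (1 : ℝ) : EuclideanSpace ℝ (Fin n))

/-- The matrix of the first fundamental form (the induced metric) of `φ` at `p`. -/
def firstFundamentalForm (g : Metric m M) (φ : S → M) (p : S) : Matrix (Fin n) (Fin n) ℝ :=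
  Matrix.of fun a b =>
    g.inner (φ p) (differential φ p (basisVector p a)) (differential φ p (basisVector p b))

/-- The mean curvature of `φ` at `p` with respect to a normal vector `ν`: the trace of the second
fundamental form with respect to the induced metric. -/
def meanCurvature (g : Metric m M) (φ : S → M) (p : S) (ν : TangentSpace (𝓡∂ m) (φ p)) : ℝ :=
  ∑ a, ∑ b, (firstFundamentalForm (n := n) g φ p)⁻¹ a b *
    secondFundamentalForm g φ p ν (basisVector p a) (basisVector p b)

/-- `φ` has vanishing mean curvature, and it meets `∂M` orthogonally along its boundary: at boundary
points the normal vectors of the hypersurface are orthogonal to those of `∂M`. -/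
structure IsFreeBoundaryMinimal (g : Metric m M) (φ : S → M) : Prop where
  minimal : ∀ (p : S) (ν : TangentSpace (𝓡∂ m) (φ p)),
    IsNormal (n := n) g φ p ν → meanCurvature (n := n) g φ p ν = 0
  orthogonal : ∀ p ∈ (𝓡∂ n).boundary S, ∀ ν N : TangentSpace (𝓡∂ m) (φ p),
    IsNormal (n := n) g φ p ν →
    (∀ w : TangentSpace (𝓡∂ m) (φ p), IsTangentToBoundary (φ p) w → g.inner (φ p) w N = 0) →
    g.inner (φ p) ν N = 0

end Hypersurface

end FreeBoundary

end

set_option linter.unusedSectionVars false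


/-! The touching set is removed by pushing the hypersurface inwards, and the minimality lost in the
push is restored by a conformal change of the metric that becomes trivial as the push does.

The push. Along `φ(∂Σ)` the free boundary condition makes `φ` transversal to `∂M`: otherwise the two
tangent spaces would agree, and a nonzero normal vector would be orthogonal to itself. Hence
touching points cannot accumulate at `∂Σ`; they form a compact set (`isCompact_touching`), whose
image is disjoint from `φ(∂Σ)` because `φ` is injective. Composing finitely many cut-off chart
shifts in the direction of the coordinate `0` gives a smooth family `Ψ_s` of injective immersions of
`M`, with `Ψ_0 = id`, which is fixed near `φ(∂Σ)`, moves the touching set off `∂M` for `s ≠ 0`, and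
brings no new point onto `∂M` (`exists_isInwardPush`). So `F(s, ·) = Ψ_s ∘ φ` is properly embedded
for `s ≠ 0` and agrees with `φ` near `∂Σ`.

The conformal correction. For a normal vector `ν` that is not renormalized, the mean curvature for
`e^u g` is `H(ν) - (n/2) du(ν)` (`meanCurvature_conformal`), so `u` must satisfy `du(ν) = (2/n)
H(ν)` along the hypersurface. Locally this is solved by an explicit formula: if `f(s, ·)`
parametrizes the hypersurface, `π(s, ·)` is a smooth left inverse of it, and `κ` is the mean
curvature covector extended by zero to tangent vectors, then `κ(x - f(s, π(s, x)))` vanishes on the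
hypersurface and has derivative `κ` there (`exists_factor_along_family`). The covector requires no
choice of a unit normal and no orientability. At `s = 0` the hypersurface is minimal, so `κ` and `u`
vanish. A cutoff and a partition of unity give a global `u` (`exists_conformalFactor`). Near `∂Σ`
the hypersurface has not moved, and conformal changes preserve orthogonality, so the free boundary
condition persists.

All constructions are jointly smooth in `s` and the point, so convergence in `C^∞` follows from
compactness by letting `s` tend to zero. -/

namespace FreeBoundary

/-! ### Joint smoothness in a parameter implies smooth convergence. -/

section JointSmoothness

/-- Joint continuity at the points of a compact slice gives uniform convergence on the slice. -/
lemma tendstoUniformlyOn_of_continuousWithinAt {Y X : Type*} [TopologicalSpace Y] [UniformSpace X]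
    {Q : ℝ → Y → X} {R K : Set Y} (hK : IsCompact K) (hKR : K ⊆ R)
    (h : ∀ y ∈ K, ContinuousWithinAt (Function.uncurry Q) (univ ×ˢ R) (0, y))
    {s : ℕ → ℝ} (hs : Tendsto s atTop (𝓝 0)) :
    TendstoUniformlyOn (fun i => Q (s i)) (Q 0) atTop K := by
  rw [← tendstoLocallyUniformlyOn_iff_tendstoUniformlyOn_of_compact hK]
  intro u hu x hx
  obtain ⟨v, hv, hsymm, hvu⟩ := comp_symm_mem_uniformity_sets hu
  -- The value `Q 0 x` is the common reference: near `x` both `Q (s i) y` and `Q 0 y` are close to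
  -- it, the latter because the neighbourhood `A` of parameters contains `0`.
  have h1 : ∀ᶠ z : ℝ × Y in 𝓝 (0 : ℝ) ×ˢ 𝓝[R] x, (Q 0 x, Q z.1 z.2) ∈ v := by
    have h2 := h x hx
    rw [ContinuousWithinAt, nhdsWithin_prod_eq, nhdsWithin_univ] at h2
    exact h2 (mem_nhds_left _ hv)
  obtain ⟨A, hA, B, hB, hAB⟩ := mem_prod_iff.1 h1
  refine ⟨B ∩ K, inter_mem (nhdsWithin_mono _ hKR hB) self_mem_nhdsWithin, ?_⟩
  filter_upwards [hs hA] with i hi y hy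
  refine hvu ⟨Q 0 x, ?_, hAB (mk_mem_prod hi hy.1)⟩
  exact hsymm.symm _ _ (hAB (mk_mem_prod (mem_of_mem_nhds hA) hy.1))

variable {E G : Type*} [NormedAddCommGroup E] [NormedSpace ℝ E] [NormedAddCommGroup G]
  [NormedSpace ℝ G]

/-- The iterated derivatives in the second variable of a jointly smooth function are jointly
smooth. -/
lemma contDiffWithinAt_iteratedFDerivWithin_snd {f : ℝ → E → G} {R : Set E}
    (hR : UniqueDiffOn ℝ R) {z : ℝ × E} (hz : z.2 ∈ R)
    (hf : ContDiffWithinAt ℝ ∞ (Function.uncurry f) (univ ×ˢ R) z) (k : ℕ) :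
    ContDiffWithinAt ℝ ∞ (fun z : ℝ × E => iteratedFDerivWithin ℝ k (f z.1) R z.2)
      (univ ×ˢ R) z := by
  induction k with
  | zero =>
    have : (fun z : ℝ × E => iteratedFDerivWithin ℝ 0 (f z.1) R z.2) =
        (continuousMultilinearCurryFin0 ℝ E G).symm ∘ Function.uncurry f := by
      ext z; simp [Function.uncurry]
    rw [this]
    exact (LinearIsometryEquiv.contDiff _).contDiffAt.comp_contDiffWithinAt z hf
  | succ k ih =>
    have : (fun z : ℝ × E => iteratedFDerivWithin ℝ (k + 1) (f z.1) R z.2) =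
        (continuousMultilinearCurryLeftEquiv ℝ (fun _ : Fin (k + 1) => E) G).symm ∘
          (fun z : ℝ × E => fderivWithin ℝ (iteratedFDerivWithin ℝ k (f z.1) R) R z.2) := by
      rfl
    rw [this]
    have hL : ContDiff ℝ ∞ (continuousMultilinearCurryLeftEquiv ℝ
        (fun _ : Fin (k + 1) => E) G).symm := LinearIsometryEquiv.contDiff _
    refine hL.contDiffAt.comp_contDiffWithinAt z ?_
    -- The `k`-th derivative is regarded as a family of functions of `y` indexed by all of `z`,
    -- although only `z.1` enters, and differentiated at the moving point `z.2`.
    refine ContDiffWithinAt.fderivWithin (n := ∞)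
      (f := fun (z : ℝ × E) y => iteratedFDerivWithin ℝ k (f z.1) R y) (g := Prod.snd)
      (t := R) ?_ contDiffWithinAt_snd hR (by simp) (by simpa using hz) (fun _ h => h.2)
    have h2 : ContDiffWithinAt ℝ ∞ (fun w : (ℝ × E) × E => (w.1.1, w.2))
        ((univ ×ˢ R) ×ˢ R) (z, z.2) := by fun_prop
    exact ContDiffWithinAt.comp (t := univ ×ˢ R) (z, z.2) ih h2 (fun w hw => ⟨mem_univ _, hw.2⟩)

end JointSmoothness

/-! ### Jointly smooth families of maps between manifolds. -/

section Charts

variable {n m : ℕ} [NeZero n] [NeZero m]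
  {S : Type*} [TopologicalSpace S] [ChartedSpace (EuclideanHalfSpace n) S] [IsManifold (𝓡∂ n) ∞ S]
  {M : Type*} [TopologicalSpace M] [ChartedSpace (EuclideanHalfSpace m) M] [IsManifold (𝓡∂ m) ∞ M]

/-- The coordinate expression, in fixed charts, of a jointly smooth family of maps. -/
lemma contDiffWithinAt_chart_family {F : ℝ × S → M} {p p' : S} {q : M} {s : ℝ}
    (hF : ContMDiffAt (𝓘(ℝ, ℝ).prod (𝓡∂ n)) (𝓡∂ m) ∞ F (s, p'))
    (hp : p' ∈ (extChartAt (𝓡∂ n) p).source) (hq : F (s, p') ∈ (extChartAt (𝓡∂ m) q).source) :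
    ContDiffWithinAt ℝ ∞ (fun z : ℝ × EuclideanSpace ℝ (Fin n) =>
      extChartAt (𝓡∂ m) q (F (z.1, (extChartAt (𝓡∂ n) p).symm z.2))) (univ ×ˢ range (𝓡∂ n))
      (s, extChartAt (𝓡∂ n) p p') := by
  rw [← contMDiffWithinAt_iff_contDiffWithinAt]
  have h1 : ContMDiffAt (𝓡∂ m) 𝓘(ℝ, EuclideanSpace ℝ (Fin m)) ∞ (extChartAt (𝓡∂ m) q)
      (F (s, p')) := contMDiffAt_extChartAt' (by simpa using hq)
  have h2 : ContMDiffWithinAt 𝓘(ℝ, EuclideanSpace ℝ (Fin n)) (𝓡∂ n) ∞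
      (extChartAt (𝓡∂ n) p).symm (range (𝓡∂ n)) (extChartAt (𝓡∂ n) p p') :=
    contMDiffWithinAt_extChartAt_symm_range p ((extChartAt (𝓡∂ n) p).map_source hp)
  have h3 : ContMDiffWithinAt 𝓘(ℝ, ℝ × EuclideanSpace ℝ (Fin n)) (𝓘(ℝ, ℝ).prod (𝓡∂ n)) ∞
      (fun z : ℝ × EuclideanSpace ℝ (Fin n) => (z.1, (extChartAt (𝓡∂ n) p).symm z.2))
      (univ ×ˢ range (𝓡∂ n)) (s, extChartAt (𝓡∂ n) p p') := by
    refine (contDiff_fst.contMDiff _).contMDiffWithinAt.prodMk ?_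
    exact ContMDiffWithinAt.comp (t := range (𝓡∂ n)) (s, extChartAt (𝓡∂ n) p p') h2
      (contDiff_snd.contMDiff _).contMDiffWithinAt (fun z hz => hz.2)
  have h4 : ContMDiffAt (𝓘(ℝ, ℝ).prod (𝓡∂ n)) 𝓘(ℝ, EuclideanSpace ℝ (Fin m)) ∞
      (extChartAt (𝓡∂ m) q ∘ F) (s, (extChartAt (𝓡∂ n) p).symm (extChartAt (𝓡∂ n) p p')) := by
    rw [(extChartAt (𝓡∂ n) p).left_inv hp]
    exact h1.comp _ hF
  exact ContMDiffAt.comp_contMDiffWithinAt (g := extChartAt (𝓡∂ m) q ∘ F)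
    (f := fun z : ℝ × EuclideanSpace ℝ (Fin n) => (z.1, (extChartAt (𝓡∂ n) p).symm z.2))
    (s, extChartAt (𝓡∂ n) p p') h4 h3

/-- A jointly smooth family of maps converges smoothly along every null sequence of parameters. -/
theorem mapsConvergeSmoothly_of_contMDiff {F : ℝ × S → M}
    (hF : ContMDiff (𝓘(ℝ, ℝ).prod (𝓡∂ n)) (𝓡∂ m) ∞ F) {s : ℕ → ℝ} (hs : Tendsto s atTop (𝓝 0)) :
    MapsConvergeSmoothly (n := n) (m := m) (fun i p => F (s i, p)) (fun p => F (0, p)) := by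
  intro p q K hK hKp hKq
  have hKF : ∀ p' ∈ K, F (0, p') ∈ (extChartAt (𝓡∂ m) q).source :=
    fun p' hp' => hKq (mem_image_of_mem _ hp')
  refine ⟨?_, fun k => ?_⟩
  · have h1 : ∀ᶠ t in 𝓝 (0 : ℝ), ∀ p' ∈ K, F (t, p') ∈ (extChartAt (𝓡∂ m) q).source := by
      refine hK.eventually_forall_of_forall_eventually fun p' hp' => ?_
      exact hF.continuous.continuousAt.preimage_mem_nhds
        ((isOpen_extChartAt_source q).mem_nhds (hKF p' hp'))
    filter_upwards [hs h1] with i hi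
    rintro _ ⟨p', hp', rfl⟩
    exact hi p' hp'
  · have hK' : IsCompact (extChartAt (𝓡∂ n) p '' K) :=
      hK.image_of_continuousOn ((continuousOn_extChartAt p).mono hKp)
    refine tendstoUniformlyOn_of_continuousWithinAt (Q := fun t y => iteratedFDerivWithin ℝ k
      (extChartAt (𝓡∂ m) q ∘ (fun p' => F (t, p')) ∘ (extChartAt (𝓡∂ n) p).symm)
        (range (𝓡∂ n)) y) (R := range (𝓡∂ n)) hK' ?_ ?_ hs
    · rintro _ ⟨p', hp', rfl⟩
      exact extChartAt_target_subset_range p ((extChartAt (𝓡∂ n) p).map_source (hKp hp'))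
    · rintro _ ⟨p', hp', rfl⟩
      have h1 := contDiffWithinAt_chart_family (hF.contMDiffAt (x := (0, p'))) (hKp hp')
        (hKF p' hp')
      exact (contDiffWithinAt_iteratedFDerivWithin_snd (f := fun t y => (extChartAt (𝓡∂ m) q ∘
        (fun p' => F (t, p')) ∘ (extChartAt (𝓡∂ n) p).symm) y) (𝓡∂ n).uniqueDiffOn
        (extChartAt_target_subset_range p ((extChartAt (𝓡∂ n) p).map_source (hKp hp')))
        h1 k).continuousWithinAt

end Charts

end FreeBoundary

namespace FreeBoundary

/-! ### The boundary as the zero set of the coordinate `0` in any chart. -/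

section BoundaryCoordinate

variable {m : ℕ} [NeZero m] {M : Type*} [TopologicalSpace M]
  [ChartedSpace (EuclideanHalfSpace m) M]

lemma coord_zero_nonneg {q x : M} (hx : x ∈ (extChartAt (𝓡∂ m) q).source) :
    0 ≤ extChartAt (𝓡∂ m) q x 0 := by
  have := extChartAt_target_subset_range q ((extChartAt (𝓡∂ m) q).map_source hx)
  rwa [range_modelWithCornersEuclideanHalfSpace] at this

lemma mem_boundary_iff_not_mem_interior {x : M} :
    x ∈ (𝓡∂ m).boundary M ↔ x ∉ (𝓡∂ m).interior M := by
  rw [← (𝓡∂ m).compl_interior, mem_compl_iff]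

variable [IsManifold (𝓡∂ m) ∞ M]

/-- A point is interior iff its coordinate `0` in any given chart is positive. -/
lemma mem_interior_iff_coord_pos {q x : M} (hx : x ∈ (extChartAt (𝓡∂ m) q).source) :
    x ∈ (𝓡∂ m).interior M ↔ 0 < extChartAt (𝓡∂ m) q x 0 := by
  have hx' : x ∈ (chartAt (EuclideanHalfSpace m) q).source := by simpa using hx
  change (𝓡∂ m).IsInteriorPoint x ↔ _
  rw [(𝓡∂ m).isInteriorPoint_iff_of_mem_atlas (n := ∞) (by simp) (chart_mem_atlas _ q) hx']
  have h : ∀ y : EuclideanSpace ℝ (Fin m), y ∈ interior (range (𝓡∂ m)) ↔ 0 < y 0 := fun y => by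
    rw [interior_range_modelWithCornersEuclideanHalfSpace]; rfl
  rw [← h]
  constructor
  · intro hi
    exact interior_mono (extChartAt_target_subset_range q) hi
  · intro hi
    exact OpenPartialHomeomorph.mem_interior_extend_target _
      ((chartAt (EuclideanHalfSpace m) q).map_source hx') hi

/-- A point is a boundary point iff its coordinate `0` in any given chart vanishes. -/
lemma mem_boundary_iff_coord_eq_zero {q x : M} (hx : x ∈ (extChartAt (𝓡∂ m) q).source) :
    x ∈ (𝓡∂ m).boundary M ↔ extChartAt (𝓡∂ m) q x 0 = 0 := by
  rw [← (𝓡∂ m).compl_interior, mem_compl_iff, mem_interior_iff_coord_pos hx, not_lt]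
  exact ⟨fun h => le_antisymm h (coord_zero_nonneg hx), fun h => h.le⟩

end BoundaryCoordinate

/-! ### Tangent data on the fixed model spaces, where base points can be rewritten freely. -/

section FlatNotation

/-- The differential of `φ` at `p` in the preferred coordinates, as a linear map between the model
spaces. -/
noncomputable def flatDifferential {n m : ℕ} [NeZero n] [NeZero m] {S : Type*} [TopologicalSpace S]
    [ChartedSpace (EuclideanHalfSpace n) S] {M : Type*} [TopologicalSpace M]
    [ChartedSpace (EuclideanHalfSpace m) M] (φ : S → M) (p : S) :
    EuclideanSpace ℝ (Fin n) →L[ℝ] EuclideanSpace ℝ (Fin m) :=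
  differential φ p

/-- The metric at `x` in the preferred coordinates, as a bilinear form on the model space. -/
noncomputable def flatMetric {m : ℕ} [NeZero m] {M : Type*} [TopologicalSpace M]
    [ChartedSpace (EuclideanHalfSpace m) M] [IsManifold (𝓡∂ m) ∞ M] (g : Metric m M) (x : M) :
    EuclideanSpace ℝ (Fin m) →L[ℝ] EuclideanSpace ℝ (Fin m) →L[ℝ] ℝ :=
  g.inner x

variable {n m : ℕ} [NeZero n] [NeZero m] {M : Type*} [TopologicalSpace M]
  [ChartedSpace (EuclideanHalfSpace m) M] [IsManifold (𝓡∂ m) ∞ M]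

lemma flatMetric_symm (g : Metric m M) (x : M) (v w : EuclideanSpace ℝ (Fin m)) :
    flatMetric g x v w = flatMetric g x w v :=
  g.symm x v w

lemma flatMetric_pos (g : Metric m M) (x : M) {v : EuclideanSpace ℝ (Fin m)} (hv : v ≠ 0) :
    0 < flatMetric g x v v :=
  g.pos x v hv

lemma isNormal_iff {S : Type*} [TopologicalSpace S] [ChartedSpace (EuclideanHalfSpace n) S]
    (g : Metric m M) (φ : S → M) (p : S) (ν : EuclideanSpace ℝ (Fin m)) :
    IsNormal (n := n) g φ p ν ↔
      ∀ v : EuclideanSpace ℝ (Fin n), flatMetric g (φ p) (flatDifferential φ p v) ν = 0 :=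
  Iff.rfl

end FlatNotation

/-! ### Transversality at the boundary and compactness of the touching set. -/

section Touching

variable {n : ℕ} [NeZero n]
  {M : Type*} [TopologicalSpace M] [ChartedSpace (EuclideanHalfSpace (n + 1)) M]
  [IsManifold (𝓡∂ (n + 1)) ∞ M]
  {S : Type*} [TopologicalSpace S] [ChartedSpace (EuclideanHalfSpace n) S]

/-- A hypersurface has a nonzero normal vector at every point. -/
lemma exists_isNormal_ne_zero (g : Metric (n + 1) M) (φ : S → M) (p : S) :
    ∃ ν : EuclideanSpace ℝ (Fin (n + 1)), ν ≠ 0 ∧ IsNormal (n := n) g φ p ν := by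
  let A : EuclideanSpace ℝ (Fin (n + 1)) →ₗ[ℝ] Module.Dual ℝ (EuclideanSpace ℝ (Fin n)) :=
    LinearMap.mk₂ ℝ (fun ν v => flatMetric g (φ p) (flatDifferential φ p v) ν)
      (by simp) (by simp) (by simp) (by simp)
  have : LinearMap.ker A ≠ ⊥ := LinearMap.ker_ne_bot_of_finrank_lt (by simp)
  obtain ⟨ν, hν, hν0⟩ := (Submodule.ne_bot_iff _).1 this
  exact ⟨ν, hν0, fun v => DFunLike.congr_fun (LinearMap.mem_ker.1 hν) v⟩

/-- A free boundary hypersurface is transversal to `∂M` along its boundary. -/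
lemma exists_differential_coord_ne_zero (g : Metric (n + 1) M) {φ : S → M} {p : S}
    (hinj : Function.Injective (mfderiv (𝓡∂ n) (𝓡∂ (n + 1)) φ p))
    (horth : ∀ ν N : TangentSpace (𝓡∂ (n + 1)) (φ p), IsNormal (n := n) g φ p ν →
      (∀ w : TangentSpace (𝓡∂ (n + 1)) (φ p), IsTangentToBoundary (φ p) w → g.inner (φ p) w N = 0) →
      g.inner (φ p) ν N = 0) :
    ∃ v : EuclideanSpace ℝ (Fin n), (flatDifferential (m := n + 1) φ p v) 0 ≠ 0 := by
  by_contra! hcon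
  obtain ⟨ν, hν0, hν⟩ := exists_isNormal_ne_zero (n := n) g φ p
  -- If `dφ` took values in `T ∂M`, it would fill it by dimension, so the normal `ν` of the
  -- hypersurface would also be normal to `∂M`. The orthogonality condition with `N = ν` then gives
  -- `g(ν, ν) = 0`.
  refine (g.pos (φ p) ν hν0).ne' (horth ν ν hν fun w hw => ?_)
  let D : EuclideanSpace ℝ (Fin n) →ₗ[ℝ] EuclideanSpace ℝ (Fin (n + 1)) :=
    (flatDifferential (n := n) (m := n + 1) φ p).toLinearMap
  let c : EuclideanSpace ℝ (Fin (n + 1)) →ₗ[ℝ] ℝ :=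
    (EuclideanSpace.proj (0 : Fin (n + 1)) : EuclideanSpace ℝ (Fin (n + 1)) →L[ℝ] ℝ)
  have hle : LinearMap.range D ≤ LinearMap.ker c := by
    rintro _ ⟨v, rfl⟩
    exact hcon v
  have hc : c ≠ 0 := fun h => by
    have := congrArg (fun f => f (EuclideanSpace.single 0 1)) h
    simp [c] at this
  have hr : Module.finrank ℝ (LinearMap.range D) = n := by
    rw [LinearMap.finrank_range_of_inj (f := D) hinj]; simp
  have hk := Module.Dual.finrank_ker_add_one_of_ne_zero (f := c) hc
  have heq : LinearMap.range D = LinearMap.ker c :=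
    Submodule.eq_of_le_of_finrank_le hle (by rw [finrank_euclideanSpace_fin] at hk; omega)
  have hw' : (w : EuclideanSpace ℝ (Fin (n + 1))) ∈ LinearMap.range D := by
    rw [heq]; exact hw
  obtain ⟨v, hv⟩ := hw'
  have := (isNormal_iff g φ p ν).1 hν v
  rw [show flatDifferential φ p v = w from hv] at this
  exact this

lemma halfSpace_range_eq (n : ℕ) [NeZero n] : range (𝓡∂ n) = {y | 0 ≤ y 0} :=
  range_modelWithCornersEuclideanHalfSpace n

/-- A function on the half-space which vanishes on the boundary, with nonzero differential at a
boundary point, has no other zeros near this point. -/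
lemma eventually_coord_eq_zero_of_fderivWithin_ne_zero {h : EuclideanSpace ℝ (Fin n) → ℝ}
    {y₀ : EuclideanSpace ℝ (Fin n)} (hy₀ : y₀ 0 = 0)
    (hh : ContDiffWithinAt ℝ ∞ h (range (𝓡∂ n)) y₀)
    (hbd : ∀ᶠ y in 𝓝[range (𝓡∂ n)] y₀, y 0 = 0 → h y = 0)
    (hne : ∃ v, fderivWithin ℝ h (range (𝓡∂ n)) y₀ v ≠ 0) :
    ∀ᶠ y in 𝓝[range (𝓡∂ n)] y₀, h y = 0 → y 0 = 0 := by
  have hmem : ∀ y : EuclideanSpace ℝ (Fin n), y ∈ range (𝓡∂ n) ↔ 0 ≤ y 0 := fun y => by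
    rw [halfSpace_range_eq]; rfl
  set R := range (𝓡∂ n) with hRdef
  have hy₀R : y₀ ∈ R := (hmem _).2 hy₀.ge
  have hU : UniqueDiffOn ℝ R := (𝓡∂ n).uniqueDiffOn
  set e₀ : EuclideanSpace ℝ (Fin n) := EuclideanSpace.single 0 1 with he₀
  have hdecomp : ∀ v : EuclideanSpace ℝ (Fin n), (v - v 0 • e₀) 0 = 0 := by simp [he₀]
  -- The differential vanishes on the directions tangent to the boundary.
  have htan : ∀ w : EuclideanSpace ℝ (Fin n), w 0 = 0 → fderivWithin ℝ h R y₀ w = 0 := by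
    intro w hw
    have hl : HasDerivAt (fun t : ℝ => y₀ + t • w) w 0 := by
      simpa using ((hasDerivAt_id (0 : ℝ)).smul_const w).const_add y₀
    have hmaps : ∀ t : ℝ, y₀ + t • w ∈ R := fun t => (hmem _).2 (by simp [hw, hy₀])
    have hd : HasFDerivWithinAt h (fderivWithin ℝ h R y₀) R (y₀ + (0 : ℝ) • w) := by
      simpa using (hh.differentiableWithinAt (by simp)).hasFDerivWithinAt
    have h1 : HasDerivAt (fun t : ℝ => h (y₀ + t • w)) (fderivWithin ℝ h R y₀ w) 0 := by
      rw [← hasDerivWithinAt_univ]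
      exact hd.comp_hasDerivWithinAt (0 : ℝ) hl.hasDerivWithinAt (fun t _ => hmaps t)
    have h2 : (fun t : ℝ => h (y₀ + t • w)) =ᶠ[𝓝 0] fun _ => 0 := by
      have ht : Tendsto (fun t : ℝ => y₀ + t • w) (𝓝 0) (𝓝[R] y₀) := by
        refine tendsto_nhdsWithin_iff.2 ⟨?_, Eventually.of_forall hmaps⟩
        simpa using hl.continuousAt.tendsto
      filter_upwards [ht.eventually hbd] with t ht
      exact ht (by simp [hw, hy₀])
    exact h1.unique ((hasDerivAt_const (0 : ℝ) (0 : ℝ)).congr_of_eventuallyEq h2)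
  -- Since tangential derivatives vanish, the nonzero differential must be seen in the direction
  -- `e₀` transversal to the boundary.
  have hc : fderivWithin ℝ h R y₀ e₀ ≠ 0 := by
    obtain ⟨v, hv⟩ := hne
    intro h0
    apply hv
    rw [show v = (v - v 0 • e₀) + v 0 • e₀ by abel, map_add, htan _ (hdecomp v), map_smul, h0]
    simp
  have hcont : ContinuousWithinAt (fun y => fderivWithin ℝ h R y e₀) R y₀ :=
    ((hh.fderivWithin_right (m := ∞) hU (by simp) hy₀R).continuousWithinAt).clm_apply
      continuousWithinAt_const
  have hdiff : ∀ᶠ y in 𝓝[R] y₀, DifferentiableWithinAt ℝ h R y := by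
    have := (hh.of_le (m := 1) (by simp)).eventually (by simp)
    rw [insert_eq_of_mem hy₀R] at this
    exact this.mono fun y hy => hy.differentiableWithinAt one_ne_zero
  obtain ⟨ε, hε, hball⟩ := Metric.mem_nhdsWithin_iff.1
    ((hcont.eventually_ne hc).and (hdiff.and hbd))
  -- Half the radius: the segment descending from `y` to the boundary has length `y 0 < ε / 2`, so
  -- it stays in the ball of radius `ε`.
  filter_upwards [inter_mem_nhdsWithin R (Metric.ball_mem_nhds y₀ (half_pos hε))]
    with y hy hy0
  by_contra hne0
  have hpos : 0 < y 0 := lt_of_le_of_ne ((hmem y).1 hy.1) (Ne.symm hne0)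
  have hn1 : ‖y - y₀‖ < ε / 2 := by simpa [dist_eq_norm] using hy.2
  have hn2 : y 0 < ε / 2 := by
    have := PiLp.norm_apply_le (y - y₀) 0
    simp only [PiLp.sub_apply, hy₀, sub_zero, Real.norm_eq_abs, abs_of_pos hpos] at this
    linarith
  -- Rolle's theorem on this segment: `h` vanishes at its foot on the boundary and, by assumption,
  -- at `y`, but its derivative along `e₀` vanishes nowhere in the ball.
  set γ : ℝ → EuclideanSpace ℝ (Fin n) := fun t => y + (t - y 0) • e₀ with hγ
  have hγ0 : ∀ t, γ t 0 = t := fun t => by simp [hγ, he₀]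
  have hγball : ∀ t ∈ Icc 0 (y 0), γ t ∈ Metric.ball y₀ ε ∩ R := by
    intro t ht
    refine ⟨?_, (hmem _).2 (by rw [hγ0]; exact ht.1)⟩
    rw [Metric.mem_ball, dist_eq_norm, show γ t - y₀ = (y - y₀) + (t - y 0) • e₀ by
      simp only [hγ]; abel]
    have h1 : ‖(t - y 0) • e₀‖ ≤ y 0 := by
      have h2 : ‖e₀‖ = 1 := by simp [he₀]
      rw [norm_smul, h2, mul_one, Real.norm_eq_abs, abs_le]; constructor <;> linarith [ht.1, ht.2]
    linarith [norm_add_le (y - y₀) ((t - y 0) • e₀)]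
  have hγd : ∀ t, HasDerivAt γ e₀ t := fun t => by
    simpa [hγ] using (((hasDerivAt_id t).sub_const (y 0)).smul_const e₀).const_add y
  have hderiv : ∀ t ∈ Icc 0 (y 0), HasDerivWithinAt (fun t => h (γ t))
      (fderivWithin ℝ h R (γ t) e₀) (Icc 0 (y 0)) t := fun t ht =>
    ((hball (hγball t ht)).2.1.hasFDerivWithinAt).comp_hasDerivWithinAt t
      (hγd t).hasDerivWithinAt (fun u hu => (hγball u hu).2)
  obtain ⟨t, ht, ht0⟩ := exists_hasDerivAt_eq_zero (f := fun t => h (γ t)) hpos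
    (fun t ht => (hderiv t ht).continuousWithinAt)
    (by
      have hb := (hball (hγball 0 ⟨le_rfl, hpos.le⟩)).2.2 (hγ0 0)
      have he : γ (y 0) = y := by simp [hγ]
      simp [hb, he, hy0])
    (fun t ht => (hderiv t (Ioo_subset_Icc_self ht)).hasDerivAt (Icc_mem_nhds ht.1 ht.2))
  exact (hball (hγball t (Ioo_subset_Icc_self ht))).1 ht0

variable [IsManifold (𝓡∂ n) ∞ S]

/-- Near a boundary point, a free boundary hypersurface meets `∂M` along its boundary only. -/
lemma eventually_mem_boundary_of_isFreeBoundaryMinimal {g : Metric (n + 1) M} {φ : S → M}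
    (hφ : IsAlmostProperlyEmbedded (n := n) (m := n + 1) φ)
    (hmin : IsFreeBoundaryMinimal (n := n) g φ) {p : S} (hp : p ∈ (𝓡∂ n).boundary S) :
    ∀ᶠ p' in 𝓝 p, φ p' ∈ (𝓡∂ (n + 1)).boundary M → p' ∈ (𝓡∂ n).boundary S := by
  obtain ⟨v, hv⟩ := exists_differential_coord_ne_zero g (hφ.immersion p) (hmin.orthogonal p hp)
  set f := writtenInExtChartAt (𝓡∂ n) (𝓡∂ (n + 1)) p φ with hf
  have hps : p ∈ (extChartAt (𝓡∂ n) p).source := mem_extChartAt_source p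
  have hfs : ContDiffWithinAt ℝ ∞ f (range (𝓡∂ n)) (extChartAt (𝓡∂ n) p p) :=
    (contMDiffAt_iff.1 (hφ.smooth p)).2
  have hD : flatDifferential (n := n) (m := n + 1) φ p =
      fderivWithin ℝ f (range (𝓡∂ n)) (extChartAt (𝓡∂ n) p p) :=
    ((hφ.smooth p).mdifferentiableAt (by simp)).mfderiv
  -- The preceding lemma is applied to the coordinate `0` of `M` pulled back by `φ`: its zeros are
  -- the points sent to `∂M`.
  have hh : ContDiffWithinAt ℝ ∞ (fun y => f y 0) (range (𝓡∂ n)) (extChartAt (𝓡∂ n) p p) :=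
    (EuclideanSpace.proj (0 : Fin (n + 1)) :
      EuclideanSpace ℝ (Fin (n + 1)) →L[ℝ] ℝ).contDiff.contDiffAt.comp_contDiffWithinAt _ hfs
  have hsrc : ∀ᶠ p' in 𝓝 p, p' ∈ (extChartAt (𝓡∂ n) p).source ∧
      φ p' ∈ (extChartAt (𝓡∂ (n + 1)) (φ p)).source :=
    Eventually.and (extChartAt_source_mem_nhds p)
      (hφ.smooth.continuous.continuousAt.preimage_mem_nhds (extChartAt_source_mem_nhds (φ p)))
  have hkey := eventually_coord_eq_zero_of_fderivWithin_ne_zero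
    ((mem_boundary_iff_coord_eq_zero hps).1 hp) hh ?_ ⟨v, ?_⟩
  · have h1 : Tendsto (extChartAt (𝓡∂ n) p) (𝓝 p) (𝓝[range (𝓡∂ n)] (extChartAt (𝓡∂ n) p p)) := by
      rw [← map_extChartAt_nhds p]; exact tendsto_map
    filter_upwards [h1.eventually hkey, hsrc] with p' h2 h3 h4
    rw [mem_boundary_iff_coord_eq_zero h3.1]
    refine h2 ?_
    rw [hf, writtenInExtChartAt, Function.comp_apply, Function.comp_apply,
      (extChartAt (𝓡∂ n) p).left_inv h3.1]
    exact (mem_boundary_iff_coord_eq_zero h3.2).1 h4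
  · rw [← map_extChartAt_nhds p, eventually_map]
    filter_upwards [hsrc] with p' h3 h4
    rw [hf, writtenInExtChartAt, Function.comp_apply, Function.comp_apply,
      (extChartAt (𝓡∂ n) p).left_inv h3.1]
    exact (mem_boundary_iff_coord_eq_zero h3.2).1
      (hφ.boundary p' ((mem_boundary_iff_coord_eq_zero h3.1).2 h4))
  · have h1 := ((EuclideanSpace.proj (0 : Fin (n + 1)) :
      EuclideanSpace ℝ (Fin (n + 1)) →L[ℝ] ℝ).hasFDerivAt.comp_hasFDerivWithinAt _
      (hfs.differentiableWithinAt (by simp)).hasFDerivWithinAt).fderivWithin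
      ((𝓡∂ n).uniqueDiffOn _ (mem_range_self _))
    rw [hD] at hv
    erw [h1]
    exact hv

/-- The touching set of a compact free boundary hypersurface is compact. -/
lemma isCompact_touching [CompactSpace S] {g : Metric (n + 1) M} {φ : S → M}
    (hφ : IsAlmostProperlyEmbedded (n := n) (m := n + 1) φ)
    (hmin : IsFreeBoundaryMinimal (n := n) g φ) :
    IsCompact {p : S | φ p ∈ (𝓡∂ (n + 1)).boundary M ∧ p ∉ (𝓡∂ n).boundary S} := by
  refine IsClosed.isCompact ?_
  have hB : IsClosed ((𝓡∂ (n + 1)).boundary M) := (𝓡∂ (n + 1)).isClosed_boundary (n := ∞) (by simp)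
  rw [← isOpen_compl_iff, isOpen_iff_mem_nhds]
  intro p hp
  -- At a point of `∂S`, transversality keeps interior contacts from accumulating; at any other
  -- point outside the touching set, closedness of `∂M` is enough.
  by_cases hpS : p ∈ (𝓡∂ n).boundary S
  · filter_upwards [eventually_mem_boundary_of_isFreeBoundaryMinimal hφ hmin hpS] with p' h1 h2
    exact h2.2 (h1 h2.1)
  · have : φ p ∉ (𝓡∂ (n + 1)).boundary M := fun h => hp ⟨h, hpS⟩
    filter_upwards [hφ.smooth.continuous.continuousAt.preimage_mem_nhds
      (hB.isOpen_compl.mem_nhds this)] with p' h1 h2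
    exact h1 h2.1

end Touching
end FreeBoundary

namespace FreeBoundary

/-! ### Pushing a compact set off the boundary. -/

section Push

variable {m : ℕ} [NeZero m] {M : Type*} [TopologicalSpace M]
  [ChartedSpace (EuclideanHalfSpace m) M]

/-- A smooth family `Ψ` of injective immersions of `M` into itself, starting at the identity, which
fixes a neighbourhood of `C` and moves `A` off the boundary. -/
structure IsInwardPush (C A : Set M) (Ψ : ℝ × M → M) : Prop where
  smooth : ContMDiff (𝓘(ℝ, ℝ).prod (𝓡∂ m)) (𝓡∂ m) ∞ Ψ
  zero : ∀ x, Ψ (0, x) = x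
  fixed : ∃ U : Set M, IsOpen U ∧ C ⊆ U ∧ ∀ s, ∀ x ∈ U, Ψ (s, x) = x
  boundary : ∀ s x, Ψ (s, x) ∈ (𝓡∂ m).boundary M → Ψ (s, x) = x
  inward : ∀ s ≠ 0, ∀ x ∈ A, Ψ (s, x) ∈ (𝓡∂ m).interior M
  injective : ∀ s, Function.Injective fun x => Ψ (s, x)
  immersion : ∀ s x, Function.Injective (mfderiv (𝓡∂ m) (𝓡∂ m) (fun x => Ψ (s, x)) x)

lemma IsInwardPush.smooth_slice {C A : Set M} {Ψ : ℝ × M → M}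
    (h : IsInwardPush (m := m) C A Ψ) (s : ℝ) :
    ContMDiff (𝓡∂ m) (𝓡∂ m) ∞ (fun x => Ψ (s, x)) :=
  h.smooth.comp (contMDiff_const.prodMk contMDiff_id)

lemma isInwardPush_empty (C : Set M) : IsInwardPush (m := m) C ∅ Prod.snd where
  smooth := contMDiff_snd
  zero _ := rfl
  fixed := ⟨univ, isOpen_univ, subset_univ _, fun _ _ _ => rfl⟩
  boundary _ _ _ := rfl
  inward _ _ _ hx := hx.elim
  injective _ := Function.injective_id
  immersion s x := by
    change Function.Injective (mfderiv (𝓡∂ m) (𝓡∂ m) id x)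
    rw [mfderiv_id]
    exact Function.injective_id

lemma IsInwardPush.mono {C A A' : Set M} {Ψ : ℝ × M → M} (h : IsInwardPush (m := m) C A' Ψ)
    (hA : A ⊆ A') : IsInwardPush (m := m) C A Ψ :=
  { h with inward := fun s hs x hx => h.inward s hs x (hA hx) }

/-- The field `boundary` is what makes pushes composable: if the composite lands in `∂M`, then both
maps have fixed the point, so a point that either map moves off the boundary stays off it. -/
lemma IsInwardPush.comp {C A A' : Set M} {Ψ Ψ' : ℝ × M → M} (h : IsInwardPush (m := m) C A Ψ)
    (h' : IsInwardPush (m := m) C A' Ψ') :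
    IsInwardPush (m := m) C (A ∪ A') (fun z => Ψ' (z.1, Ψ (z.1, z.2))) where
  smooth := h'.smooth.comp (contMDiff_fst.prodMk h.smooth)
  zero x := by simp [h.zero, h'.zero]
  fixed := by
    obtain ⟨U, hU, hCU, hf⟩ := h.fixed
    obtain ⟨U', hU', hCU', hf'⟩ := h'.fixed
    refine ⟨U ∩ U', hU.inter hU', subset_inter hCU hCU', fun s x hx => ?_⟩
    simp [hf s x hx.1, hf' s x hx.2]
  boundary s x hx := by
    have h1 := h'.boundary s _ hx
    have h2 := h.boundary s x (by simpa only [h1] using hx)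
    simp only at h1 ⊢
    rw [h1, h2]
  inward s hs x hx := by
    by_contra hcon
    have hb : Ψ' (s, Ψ (s, x)) ∈ (𝓡∂ m).boundary M := mem_boundary_iff_not_mem_interior.2 hcon
    have h1 := h'.boundary s _ hb
    have hb1 := hb
    rw [h1] at hb1
    have h2 := h.boundary s x hb1
    rcases hx with hx | hx
    · exact mem_boundary_iff_not_mem_interior.1 hb1 (h.inward s hs x hx)
    · rw [h2] at hb
      exact mem_boundary_iff_not_mem_interior.1 hb (h'.inward s hs x hx)
  injective s := (h'.injective s).comp (h.injective s)
  immersion s x := by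
    have h1 := mfderiv_comp x ((h'.smooth_slice s).mdifferentiableAt (by simp) (x := Ψ (s, x)))
      ((h.smooth_slice s).mdifferentiableAt (by simp) (x := x))
    change Function.Injective (mfderiv (𝓡∂ m) (𝓡∂ m)
      ((fun x => Ψ' (s, x)) ∘ (fun x => Ψ (s, x))) x)
    rw [h1]
    exact (h'.immersion s _).comp (h.immersion s x)

variable [IsManifold (𝓡∂ m) ∞ M]

/-- The inward shift of the half-space in the direction of the coordinate `0`, by `c β`. -/
noncomputable def shift (β : EuclideanSpace ℝ (Fin m) → ℝ) (c : ℝ) (y : EuclideanSpace ℝ (Fin m)) :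
    EuclideanSpace ℝ (Fin m) :=
  y + (c * β y) • EuclideanSpace.single 0 1

lemma shift_zero_coord (β : EuclideanSpace ℝ (Fin m) → ℝ) (c : ℝ) (y : EuclideanSpace ℝ (Fin m)) :
    shift β c y 0 = y 0 + c * β y := by
  simp [shift]

lemma shift_eq_self {β : EuclideanSpace ℝ (Fin m) → ℝ} {c : ℝ} {y : EuclideanSpace ℝ (Fin m)}
    (h : c * β y = 0) : shift β c y = y := by
  simp [shift, h]

/-- The displacement `c β` is a contraction because `c K < 1`, and a perturbation of the identity by
a contraction is injective. -/
lemma shift_injective {β : EuclideanSpace ℝ (Fin m) → ℝ} {K : NNReal} (hβ : LipschitzWith K β)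
    {c : ℝ} (hc : 0 ≤ c) (hcK : c * K < 1) : Function.Injective (shift β c) := by
  intro y y' h
  by_contra hne
  have h1 : y - y' = -((c * (β y - β y')) • (EuclideanSpace.single 0 1 :
      EuclideanSpace ℝ (Fin m))) := by
    have : y + (c * β y) • (EuclideanSpace.single 0 1 : EuclideanSpace ℝ (Fin m)) =
      y' + (c * β y') • EuclideanSpace.single 0 1 := h
    rw [mul_sub, sub_smul, neg_sub, sub_eq_sub_iff_add_eq_add, this, add_comm]
  have h2 : ‖y - y'‖ ≤ c * (K * ‖y - y'‖) := by
    conv_lhs => rw [h1]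
    have h3 : ‖(EuclideanSpace.single 0 1 : EuclideanSpace ℝ (Fin m))‖ = 1 := by simp
    rw [norm_neg, norm_smul, h3, mul_one, norm_mul, Real.norm_eq_abs, abs_of_nonneg hc]
    gcongr
    simpa [dist_eq_norm] using hβ.dist_le_mul y y'
  have h4 : 0 < ‖y - y'‖ := norm_pos_iff.2 (sub_ne_zero.2 hne)
  nlinarith

/-- The infinitesimal form of the same estimate, with the Lipschitz constant bounding the derivative
of `β`. -/
lemma fderiv_shift_injective {β : EuclideanSpace ℝ (Fin m) → ℝ} {K : NNReal}
    (hβ : LipschitzWith K β) (hd : Differentiable ℝ β)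
    {c : ℝ} (hc : 0 ≤ c) (hcK : c * K < 1) (y : EuclideanSpace ℝ (Fin m)) :
    Function.Injective (fderiv ℝ (shift β c) y) := by
  have h0 : HasFDerivAt (shift β c) (ContinuousLinearMap.id ℝ _ +
      (c • fderiv ℝ β y).smulRight (EuclideanSpace.single 0 1 : EuclideanSpace ℝ (Fin m))) y :=
    (hasFDerivAt_id y).add (((hd y).hasFDerivAt.const_mul c).smul_const _)
  rw [h0.fderiv, injective_iff_map_eq_zero]
  intro v hv
  have h1 : v = -((c * fderiv ℝ β y v) • (EuclideanSpace.single 0 1 :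
      EuclideanSpace ℝ (Fin m))) := by
    have : v + (c * fderiv ℝ β y v) • (EuclideanSpace.single 0 1 : EuclideanSpace ℝ (Fin m)) = 0 := by
      simpa using hv
    exact eq_neg_of_add_eq_zero_left this
  have h2 : ‖v‖ ≤ c * (K * ‖v‖) := by
    conv_lhs => rw [h1]
    have h3 : ‖(EuclideanSpace.single 0 1 : EuclideanSpace ℝ (Fin m))‖ = 1 := by simp
    rw [norm_neg, norm_smul, h3, mul_one, norm_mul, Real.norm_eq_abs, abs_of_nonneg hc]
    gcongr
    exact ContinuousLinearMap.le_of_opNorm_le _ (norm_fderiv_le_of_lipschitz ℝ hβ) v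
  by_contra hne
  have h4 : 0 < ‖v‖ := norm_pos_iff.2 hne
  nlinarith

lemma mfderiv_extChartAt_injective {q x : M} (hx : x ∈ (extChartAt (𝓡∂ m) q).source) :
    Function.Injective (mfderiv (𝓡∂ m) 𝓘(ℝ, EuclideanSpace ℝ (Fin m)) (extChartAt (𝓡∂ m) q) x) :=
  (isInvertible_mfderiv_extChartAt hx).injective

/-- Every point away from `C` has a neighbourhood which can be pushed off the boundary. -/
lemma exists_isInwardPush_nhds [T2Space M] {C : Set M} (hC : IsClosed C) {q : M} (hq : q ∉ C) :
    ∃ A ∈ 𝓝 q, ∃ Ψ, IsInwardPush (m := m) C A Ψ := by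
  classical
  set e := extChartAt (𝓡∂ m) q with he
  have hmem : ∀ y : EuclideanSpace ℝ (Fin m), y ∈ range (𝓡∂ m) ↔ 0 ≤ y 0 := fun y => by
    rw [range_modelWithCornersEuclideanHalfSpace]; rfl
  have hW : e.target ∩ e.symm ⁻¹' Cᶜ ∈ 𝓝[range (𝓡∂ m)] (e q) := by
    refine inter_mem (extChartAt_target_mem_nhdsWithin q) ?_
    refine (continuousAt_extChartAt_symm q).continuousWithinAt ?_
    rw [extChartAt_to_inv]
    exact hC.isOpen_compl.mem_nhds hq
  obtain ⟨R, hR, hRW⟩ := Metric.mem_nhdsWithin_iff.1 hW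
  -- The bump lives in radius `R / 2` and the displacement will be at most `ε ≤ R / 2`, so shifted
  -- points stay in the ball of radius `R`, inside the chart. The condition `ε * K < 1` provides
  -- injectivity and the immersion property.
  let β : ContDiffBump (e q) := ⟨R / 4, R / 2, by positivity, by linarith⟩
  have hβs : ContDiff ℝ ∞ β := β.contDiff
  obtain ⟨K, hK⟩ := (β.contDiff (n := 1)).lipschitzWith_of_hasCompactSupport β.hasCompactSupport
    one_ne_zero
  obtain ⟨ε, hε, hεR, hεK⟩ : ∃ ε : ℝ, 0 < ε ∧ ε ≤ R / 2 ∧ ε * K < 1 := by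
    refine ⟨min (R / 2) (1 / (K + 1)), by positivity, min_le_left _ _, ?_⟩
    calc min (R / 2) (1 / (K + 1)) * (K : ℝ) ≤ 1 / (K + 1) * K := by gcongr; exact min_le_right _ _
      _ < 1 := by rw [one_div, inv_mul_lt_iff₀ (by positivity)]; linarith
  -- This amplitude is smooth, vanishes only at `s = 0`, is nonnegative for either sign of `s` and
  -- never exceeds `ε`, so every real parameter is allowed.
  let c : ℝ → ℝ := fun s => ε * (s ^ 2 / (1 + s ^ 2))
  have hc0 : ∀ s, 0 ≤ c s := fun s => by positivity
  have hcε : ∀ s, c s ≤ ε := fun s => by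
    have : s ^ 2 / (1 + s ^ 2) ≤ 1 := by rw [div_le_one (by positivity)]; linarith
    nlinarith
  have hcK : ∀ s, c s * K < 1 := fun s =>
    lt_of_le_of_lt (mul_le_mul_of_nonneg_right (hcε s) K.2) hεK
  have hcs : ContDiff ℝ ∞ c := by
    refine contDiff_const.mul (ContDiff.div (by fun_prop) (by fun_prop) fun s => by positivity)
  have hcne : ∀ s ≠ 0, 0 < c s := fun s hs => by positivity
  let θ : ℝ → EuclideanSpace ℝ (Fin m) → EuclideanSpace ℝ (Fin m) := fun s => shift β (c s)
  have hβ0 : ∀ y, y ∉ Metric.ball (e q) (R / 2) → β y = 0 := fun y hy => by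
    have := β.support_eq
    by_contra h
    exact hy (this ▸ (Function.mem_support.2 h))
  have hθt : ∀ s, ∀ y ∈ e.target, θ s y ∈ e.target := by
    intro s y hy
    by_cases hyb : y ∈ Metric.ball (e q) (R / 2)
    · refine (hRW ⟨?_, (hmem _).2 ?_⟩).1
      · rw [Metric.mem_ball, dist_eq_norm]
        have h1 : θ s y - e q = (y - e q) +
          (c s * β y) • (EuclideanSpace.single 0 1 : EuclideanSpace ℝ (Fin m)) := by
          simp only [θ, shift]; abel
        have h2 : ‖(c s * β y) • (EuclideanSpace.single 0 1 : EuclideanSpace ℝ (Fin m))‖ ≤ R / 2 := by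
          have h3 : ‖(EuclideanSpace.single 0 1 : EuclideanSpace ℝ (Fin m))‖ = 1 := by simp
          rw [norm_smul, h3, mul_one, Real.norm_eq_abs, abs_of_nonneg
            (mul_nonneg (hc0 s) β.nonneg)]
          nlinarith [hc0 s, hcε s, β.nonneg (x := y), β.le_one (x := y)]
        rw [Metric.mem_ball, dist_eq_norm] at hyb
        rw [h1]
        linarith [norm_add_le (y - e q)
          ((c s * β y) • (EuclideanSpace.single 0 1 : EuclideanSpace ℝ (Fin m)))]
      · rw [shift_zero_coord]
        have := (hmem y).1 (extChartAt_target_subset_range q hy)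
        have := mul_nonneg (hc0 s) (β.nonneg (x := y))
        linarith
    · rwa [show θ s y = y from shift_eq_self (by rw [hβ0 y hyb, mul_zero])]
  let Ψ : ℝ × M → M := fun z => if z.2 ∈ e.source then e.symm (θ z.1 (e z.2)) else z.2
  have hΨin : ∀ s, ∀ x ∈ e.source, Ψ (s, x) = e.symm (θ s (e x)) := fun s x hx => if_pos hx
  have hΨout : ∀ s, ∀ x ∉ e.source, Ψ (s, x) = x := fun s x hx => if_neg hx
  have hΨsrc : ∀ s, ∀ x ∈ e.source, Ψ (s, x) ∈ e.source := fun s x hx => by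
    rw [hΨin s x hx]; exact e.map_target (hθt s _ (e.map_source hx))
  have hΨe : ∀ s, ∀ x ∈ e.source, e (Ψ (s, x)) = θ s (e x) := fun s x hx => by
    rw [hΨin s x hx, e.right_inv (hθt s _ (e.map_source hx))]
  have hΨself : ∀ s, ∀ x ∈ e.source, c s * β (e x) = 0 → Ψ (s, x) = x := fun s x hx h => by
    rw [hΨin s x hx, show θ s (e x) = e x from shift_eq_self h, e.left_inv hx]
  -- Outside a compact set nothing moves.
  let Q : Set M := e.symm '' (Metric.closedBall (e q) (R / 2) ∩ range (𝓡∂ m))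
  have hQsub : Metric.closedBall (e q) (R / 2) ∩ range (𝓡∂ m) ⊆ e.target ∩ e.symm ⁻¹' Cᶜ :=
    (inter_subset_inter_left _ (Metric.closedBall_subset_ball (by linarith))).trans hRW
  have hQ : IsClosed Q := by
    refine IsCompact.isClosed (IsCompact.image_of_continuousOn ?_
      ((continuousOn_extChartAt_symm q).mono fun y hy => (hQsub hy).1))
    exact (isCompact_closedBall _ _).inter_right (𝓡∂ m).isClosed_range
  have hΨQ : ∀ s, ∀ x ∈ Qᶜ, Ψ (s, x) = x := by
    intro s x hx
    by_cases hxs : x ∈ e.source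
    · refine hΨself s x hxs ?_
      rw [hβ0 (e x) fun h => hx ⟨e x, ⟨Metric.ball_subset_closedBall h,
        extChartAt_target_subset_range q (e.map_source hxs)⟩, e.left_inv hxs⟩, mul_zero]
    · exact hΨout s x hxs
  have hQs : Q ⊆ e.source := by
    rintro _ ⟨y, hy, rfl⟩
    exact e.map_target (hQsub hy).1
  have hsmooth : ContMDiff (𝓘(ℝ, ℝ).prod (𝓡∂ m)) (𝓡∂ m) ∞ Ψ := by
    intro z
    by_cases hz : z.2 ∈ e.source
    · have h1 : Ψ =ᶠ[𝓝 z] fun z => e.symm (θ z.1 (e z.2)) := by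
        filter_upwards [continuous_snd.continuousAt.preimage_mem_nhds
          ((isOpen_extChartAt_source q).mem_nhds hz)] with w hw
        exact hΨin w.1 w.2 hw
      refine ContMDiffAt.congr_of_eventuallyEq ?_ h1
      have h2 : ContMDiffAt (𝓘(ℝ, ℝ).prod (𝓡∂ m)) 𝓘(ℝ, EuclideanSpace ℝ (Fin m)) ∞
          (fun z : ℝ × M => e z.2) z :=
        (contMDiffAt_extChartAt' (by simpa [he] using hz)).comp z contMDiffAt_snd
      have h3 : ContMDiffAt (𝓘(ℝ, ℝ).prod (𝓡∂ m)) 𝓘(ℝ, EuclideanSpace ℝ (Fin m)) ∞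
          (fun z : ℝ × M => θ z.1 (e z.2)) z := by
        have h4 : ContDiff ℝ ∞ (fun w : ℝ × EuclideanSpace ℝ (Fin m) => θ w.1 w.2) := by
          have : ContDiff ℝ ∞ (fun w : ℝ × EuclideanSpace ℝ (Fin m) => c w.1 * β w.2) :=
            (hcs.comp contDiff_fst).mul (hβs.comp contDiff_snd)
          exact contDiff_snd.add (this.smul contDiff_const)
        exact ContMDiffAt.comp (I' := 𝓘(ℝ, ℝ × EuclideanSpace ℝ (Fin m)))
          (g := fun w : ℝ × EuclideanSpace ℝ (Fin m) => θ w.1 w.2)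
          (f := fun z : ℝ × M => (z.1, e z.2)) z (h4.contMDiff _)
          (contMDiffAt_fst.prodMk_space h2)
      have h5 : ContMDiffWithinAt 𝓘(ℝ, EuclideanSpace ℝ (Fin m)) (𝓡∂ m) ∞ e.symm (range (𝓡∂ m))
          (θ z.1 (e z.2)) :=
        contMDiffWithinAt_extChartAt_symm_range q (hθt _ _ (e.map_source hz))
      refine (ContMDiffWithinAt.comp (t := range (𝓡∂ m)) (f := fun z : ℝ × M => θ z.1 (e z.2))
        (s := (fun z : ℝ × M => θ z.1 (e z.2)) ⁻¹' range (𝓡∂ m)) z h5 h3.contMDiffWithinAt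
        (fun _ h => h)).contMDiffAt ?_
      filter_upwards [continuous_snd.continuousAt.preimage_mem_nhds
          ((isOpen_extChartAt_source q).mem_nhds hz)] with w hw
      exact extChartAt_target_subset_range q (hθt _ _ (e.map_source hw))
    · refine ContMDiffAt.congr_of_eventuallyEq contMDiffAt_snd ?_
      filter_upwards [continuous_snd.continuousAt.preimage_mem_nhds
        (hQ.isOpen_compl.mem_nhds fun h => hz (hQs h))] with w hw
      exact hΨQ w.1 w.2 hw
  refine ⟨e.source ∩ e ⁻¹' Metric.ball (e q) (R / 4), ?_, Ψ, hsmooth, ?_, ?_, ?_, ?_, ?_, ?_⟩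
  · exact inter_mem (extChartAt_source_mem_nhds q) ((continuousAt_extChartAt q).preimage_mem_nhds
      (Metric.ball_mem_nhds _ (by positivity)))
  · intro x
    by_cases hx : x ∈ e.source
    · exact hΨself 0 x hx (by simp [c])
    · exact hΨout 0 x hx
  · refine ⟨Qᶜ, hQ.isOpen_compl, ?_, hΨQ⟩
    rintro x hx ⟨y, hy, rfl⟩
    exact (hQsub hy).2 hx
  · intro s x hb
    by_cases hx : x ∈ e.source
    · rw [mem_boundary_iff_coord_eq_zero (hΨsrc s x hx), ← he, hΨe s x hx, shift_zero_coord] at hb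
      have h1 := coord_zero_nonneg hx
      have h2 := mul_nonneg (hc0 s) (β.nonneg (x := e x))
      exact hΨself s x hx (by rw [← he] at h1; linarith)
    · exact hΨout s x hx
  · rintro s hs x ⟨hx, hxb⟩
    rw [mem_interior_iff_coord_pos (hΨsrc s x hx), ← he, hΨe s x hx, shift_zero_coord,
      β.one_of_mem_closedBall (Metric.ball_subset_closedBall hxb)]
    have h1 := coord_zero_nonneg hx
    have h2 := hcne s hs
    rw [← he] at h1; linarith
  · intro s x x' hxx
    simp only at hxx
    by_cases hx : x ∈ e.source <;> by_cases hx' : x' ∈ e.source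
    · refine e.injOn hx hx' (shift_injective hK (hc0 s) (hcK s) ?_)
      have := congrArg e hxx
      rwa [hΨe s x hx, hΨe s x' hx'] at this
    · have := hΨsrc s x hx
      rw [hxx, hΨout s x' hx'] at this
      exact (hx' this).elim
    · have := hΨsrc s x' hx'
      rw [← hxx, hΨout s x hx] at this
      exact (hx this).elim
    · rwa [hΨout s x hx, hΨout s x' hx'] at hxx
  · intro s x
    by_cases hx : x ∈ e.source
    · have hs : MDifferentiableAt (𝓡∂ m) (𝓡∂ m) (fun x => Ψ (s, x)) x :=
        (hsmooth.comp (contMDiff_const.prodMk contMDiff_id)).mdifferentiableAt (by simp)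
      have hθd : DifferentiableAt ℝ (θ s) (e x) :=
        differentiableAt_id.add ((((hβs.differentiable (by simp)) _).const_mul _).smul_const _)
      have hex : MDifferentiableAt (𝓡∂ m) 𝓘(ℝ, EuclideanSpace ℝ (Fin m)) e x :=
        mdifferentiableAt_extChartAt (by simpa [he] using hx)
      have heΨ : MDifferentiableAt (𝓡∂ m) 𝓘(ℝ, EuclideanSpace ℝ (Fin m)) e (Ψ (s, x)) :=
        mdifferentiableAt_extChartAt (by simpa [he] using hΨsrc s x hx)
      -- Differentiating `e ∘ Ψ_s = θ_s ∘ e` reduces injectivity of the differential of `Ψ_s` to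
      -- that of `θ_s`.
      have h1 : e ∘ (fun x => Ψ (s, x)) =ᶠ[𝓝 x] θ s ∘ e := by
        filter_upwards [(isOpen_extChartAt_source q).mem_nhds hx] with w hw
        exact hΨe s w hw
      have h2 := h1.mfderiv_eq (I := 𝓡∂ m) (I' := 𝓘(ℝ, EuclideanSpace ℝ (Fin m)))
      rw [mfderiv_comp x heΨ hs, mfderiv_comp x hθd.mdifferentiableAt hex] at h2
      have h3 : ∀ v, fderiv ℝ (θ s) (e x) (mfderiv (𝓡∂ m) 𝓘(ℝ, EuclideanSpace ℝ (Fin m)) e x v) =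
          mfderiv (𝓡∂ m) 𝓘(ℝ, EuclideanSpace ℝ (Fin m)) e (Ψ (s, x))
            (mfderiv (𝓡∂ m) (𝓡∂ m) (fun x => Ψ (s, x)) x v) := fun v => by
        rw [← mfderiv_eq_fderiv]
        exact (DFunLike.congr_fun h2 v).symm
      intro v w hvw
      refine mfderiv_extChartAt_injective hx
        (fderiv_shift_injective hK (hβs.differentiable (by simp)) (hc0 s) (hcK s) (e x) ?_)
      exact (h3 v).trans ((congrArg _ hvw).trans (h3 w).symm)
    · have h1 : (fun x => Ψ (s, x)) =ᶠ[𝓝 x] id := by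
        filter_upwards [hQ.isOpen_compl.mem_nhds fun h => hx (hQs h)] with w hw
        exact hΨQ s w hw
      rw [h1.mfderiv_eq, mfderiv_id]
      exact Function.injective_id

/-- A compact set disjoint from a closed set `C` can be pushed off the boundary, fixing a
neighbourhood of `C`. -/
theorem exists_isInwardPush [T2Space M] {C A : Set M} (hC : IsClosed C) (hA : IsCompact A)
    (hAC : Disjoint A C) : ∃ Ψ, IsInwardPush (m := m) C A Ψ := by
  -- Pushable sets are stable under subsets and, by composition, under unions, so compactness
  -- reduces the claim to neighbourhoods of points.
  refine hA.induction_on (p := fun A => ∃ Ψ, IsInwardPush (m := m) C A Ψ)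
    ⟨_, isInwardPush_empty C⟩ ?_ ?_ ?_
  · rintro A A' hAA ⟨Ψ, h⟩
    exact ⟨Ψ, h.mono hAA⟩
  · rintro A A' ⟨Ψ, h⟩ ⟨Ψ', h'⟩
    exact ⟨_, h.comp h'⟩
  · intro q hq
    obtain ⟨B, hB, h⟩ := exists_isInwardPush_nhds (m := m) hC (disjoint_left.1 hAC hq)
    exact ⟨B, mem_nhdsWithin_of_mem_nhds hB, h⟩

end Push
end FreeBoundary

namespace FreeBoundary

/-! ### First and second order chain rules with derivatives within a set. -/

section Calculus

variable {E F H : Type*} [NormedAddCommGroup E] [NormedSpace ℝ E] [NormedAddCommGroup F]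
  [NormedSpace ℝ F] [NormedAddCommGroup H] [NormedSpace ℝ H]

lemma ContDiffWithinAt.eventually_differentiableWithinAt {τ : F → H} {R : Set F} {x : F}
    (hx : x ∈ R) (hτ : ContDiffWithinAt ℝ ∞ τ R x) :
    ∀ᶠ z in 𝓝[R] x, DifferentiableWithinAt ℝ τ R z := by
  have := (hτ.of_le (m := 1) (by simp)).eventually (by simp)
  rw [insert_eq_of_mem hx] at this
  exact this.mono fun x hx => hx.differentiableWithinAt one_ne_zero

/-- At an interior touching point the ambient derivatives are one-sided, while those along the
hypersurface are not. Since `f` stays in `R`, derivatives of `τ` within `R` suffice to differentiate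
`τ ∘ f` in all directions. -/
lemma eventually_fderiv_comp_fderivWithin {f : E → F} {τ : F → H} {R : Set F} {y : E}
    (hf : ContDiffAt ℝ ∞ f y) (hfR : ∀ᶠ z in 𝓝 y, f z ∈ R)
    (hτ : ContDiffWithinAt ℝ ∞ τ R (f y)) :
    ∀ᶠ z in 𝓝 y, fderiv ℝ (τ ∘ f) z = (fderivWithin ℝ τ R (f z)).comp (fderiv ℝ f z) := by
  have hfR' : Tendsto f (𝓝 y) (𝓝[R] (f y)) :=
    tendsto_nhdsWithin_iff.2 ⟨hf.continuousAt.tendsto, hfR⟩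
  have hfn : ∀ᶠ z in 𝓝 y, DifferentiableAt ℝ f z :=
    ((hf.of_le (m := 1) (by simp)).eventually (by simp)).mono fun z hz =>
      hz.differentiableAt one_ne_zero
  filter_upwards [hfn, hfR'.eventually (ContDiffWithinAt.eventually_differentiableWithinAt
    hfR.self_of_nhds hτ), hfR.eventually_nhds] with z h1 h2 h3
  have h4 : HasFDerivWithinAt (τ ∘ f) ((fderivWithin ℝ τ R (f z)).comp (fderiv ℝ f z))
      (f ⁻¹' R) z :=
    h2.hasFDerivWithinAt.comp z h1.hasFDerivAt.hasFDerivWithinAt (fun _ h => h)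
  exact (h4.hasFDerivAt h3).fderiv

/-- The term containing the second derivative of `τ` is the non-tensorial part of the Hessian;
`localSecondForm_comp_left` matches it with the change of the Christoffel symbols. -/
lemma fderiv_fderiv_comp_fderivWithin {f : E → F} {τ : F → H} {R : Set F} (hR : UniqueDiffOn ℝ R)
    {y : E} (hf : ContDiffAt ℝ ∞ f y) (hfR : ∀ᶠ z in 𝓝 y, f z ∈ R)
    (hτ : ContDiffWithinAt ℝ ∞ τ R (f y)) (v w : E) :
    fderiv ℝ (fderiv ℝ (τ ∘ f)) y v w =
      fderivWithin ℝ (fderivWithin ℝ τ R) R (f y) (fderiv ℝ f y v) (fderiv ℝ f y w) +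
        fderivWithin ℝ τ R (f y) (fderiv ℝ (fderiv ℝ f) y v w) := by
  have hτ'd : DifferentiableWithinAt ℝ (fderivWithin ℝ τ R) R (f y) :=
    (hτ.fderivWithin_right (m := ∞) hR (by simp) hfR.self_of_nhds).differentiableWithinAt (by simp)
  have h1 : HasFDerivAt (fun z => fderivWithin ℝ τ R (f z))
      ((fderivWithin ℝ (fderivWithin ℝ τ R) R (f y)).comp (fderiv ℝ f y)) y := by
    have h4 : HasFDerivWithinAt (fderivWithin ℝ τ R ∘ f)
        ((fderivWithin ℝ (fderivWithin ℝ τ R) R (f y)).comp (fderiv ℝ f y)) (f ⁻¹' R) y :=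
      hτ'd.hasFDerivWithinAt.comp y
        (hf.differentiableAt (by simp)).hasFDerivAt.hasFDerivWithinAt (fun _ h => h)
    exact h4.hasFDerivAt hfR
  have h2 : HasFDerivAt (fderiv ℝ f) (fderiv ℝ (fderiv ℝ f) y) y :=
    ((hf.fderiv_right (m := ∞) (by simp)).differentiableAt (by simp)).hasFDerivAt
  rw [Filter.EventuallyEq.fderiv_eq (eventually_fderiv_comp_fderivWithin hf hfR hτ),
    (h1.clm_comp h2).fderiv]
  simp [add_comm]

/-- The derivative of the pullback of a coordinate metric. -/
lemma fderivWithin_metric_pullback {G₀ G : F → F →L[ℝ] F →L[ℝ] ℝ} {R : Set F}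
    (hR : UniqueDiffOn ℝ R) {x : F} (hx : x ∈ R) {τ : F → F} {τ' : F → F →L[ℝ] F}
    (hτ : HasFDerivWithinAt τ (τ' x) R x) (hτR : ∀ᶠ z in 𝓝[R] x, τ z ∈ R)
    (hτ' : DifferentiableWithinAt ℝ τ' R x) (hG : DifferentiableWithinAt ℝ G R (τ x))
    (hGG : ∀ᶠ z in 𝓝[R] x, ∀ v w, G₀ z v w = G (τ z) (τ' z v) (τ' z w))
    (hG₀ : DifferentiableWithinAt ℝ G₀ R x) (u a b : F) :
    fderivWithin ℝ G₀ R x u a b =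
      fderivWithin ℝ G R (τ x) (τ' x u) (τ' x a) (τ' x b) +
      G (τ x) (fderivWithin ℝ τ' R x u a) (τ' x b) +
      G (τ x) (τ' x a) (fderivWithin ℝ τ' R x u b) := by
  have h1 : HasFDerivWithinAt (fun z => G (τ z)) ((fderivWithin ℝ G R (τ x)).comp (τ' x)) R x := by
    have h4 : HasFDerivWithinAt (G ∘ τ) ((fderivWithin ℝ G R (τ x)).comp (τ' x))
        (R ∩ τ ⁻¹' R) x :=
      HasFDerivWithinAt.comp (t := R) (g := G) (f := τ) x hG.hasFDerivWithinAt
        (hτ.mono inter_subset_left) (fun z (hz : z ∈ R ∩ τ ⁻¹' R) => hz.2)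
    exact h4.mono_of_mem_nhdsWithin (inter_mem self_mem_nhdsWithin hτR)
  have hc : ∀ c, HasFDerivWithinAt (fun z => τ' z c) ((fderivWithin ℝ τ' R x).flip c) R x := by
    intro c
    convert hτ'.hasFDerivWithinAt.clm_apply (hasFDerivWithinAt_const c x R) using 1
    ext; simp
  have h2 : HasFDerivWithinAt (fun z => G (τ z) (τ' z a) (τ' z b)) _ R x :=
    (h1.clm_apply (hc a)).clm_apply (hc b)
  have h3 : HasFDerivWithinAt (fun z => G₀ z a b) _ R x :=
    h2.congr_of_eventuallyEq (hGG.mono fun x hx => hx a b) (hGG.self_of_nhdsWithin hx a b)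
  have h5 : HasFDerivWithinAt (fun z => G₀ z a b) _ R x :=
    (hG₀.hasFDerivWithinAt.clm_apply (hasFDerivWithinAt_const a _ _)).clm_apply
      (hasFDerivWithinAt_const b _ _)
  have h6 := DFunLike.congr_fun ((hR _ hx).eq h5 h3) u
  simp only [ContinuousLinearMap.comp_zero, zero_add, ContinuousLinearMap.flip_apply,
    add_apply, ContinuousLinearMap.comp_apply] at h6
  rw [h6]; ring

end Calculus

/-! ### Curvature of parametrized hypersurfaces and ambient coordinate changes. -/

section LocalCurvature

variable {n m : ℕ}

/-- Christoffel symbols of the first kind of a coordinate metric `G`, with derivatives within `R`. -/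
noncomputable def localChristoffel
    (G : EuclideanSpace ℝ (Fin m) → EuclideanSpace ℝ (Fin m) →L[ℝ] EuclideanSpace ℝ (Fin m) →L[ℝ] ℝ)
    (R : Set (EuclideanSpace ℝ (Fin m))) (x u v w : EuclideanSpace ℝ (Fin m)) : ℝ :=
  (fderivWithin ℝ G R x u v w + fderivWithin ℝ G R x v u w - fderivWithin ℝ G R x w u v) / 2

/-- The second fundamental form of a parametrized hypersurface `f` in coordinates. -/
noncomputable def localSecondForm
    (G : EuclideanSpace ℝ (Fin m) → EuclideanSpace ℝ (Fin m) →L[ℝ] EuclideanSpace ℝ (Fin m) →L[ℝ] ℝ)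
    (R : Set (EuclideanSpace ℝ (Fin m))) (f : EuclideanSpace ℝ (Fin n) → EuclideanSpace ℝ (Fin m))
    (y : EuclideanSpace ℝ (Fin n)) (ν : EuclideanSpace ℝ (Fin m))
    (v w : EuclideanSpace ℝ (Fin n)) : ℝ :=
  G (f y) (fderiv ℝ (fderiv ℝ f) y v w) ν + localChristoffel G R (f y) (fderiv ℝ f y v)
    (fderiv ℝ f y w) ν

/-- The first fundamental form of a parametrized hypersurface `f` in coordinates. -/
noncomputable def localFirstForm
    (G : EuclideanSpace ℝ (Fin m) → EuclideanSpace ℝ (Fin m) →L[ℝ] EuclideanSpace ℝ (Fin m) →L[ℝ] ℝ)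
    (f : EuclideanSpace ℝ (Fin n) → EuclideanSpace ℝ (Fin m))
    (y : EuclideanSpace ℝ (Fin n)) (v w : EuclideanSpace ℝ (Fin n)) : ℝ :=
  G (f y) (fderiv ℝ f y v) (fderiv ℝ f y w)

/-- The Gram matrix of a bilinear function in the standard basis. -/
noncomputable def gram (B : EuclideanSpace ℝ (Fin n) → EuclideanSpace ℝ (Fin n) → ℝ) :
    Matrix (Fin n) (Fin n) ℝ :=
  Matrix.of fun a b => B (EuclideanSpace.single a 1) (EuclideanSpace.single b 1)

/-- The trace of the bilinear function `B` with respect to `A`. -/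
noncomputable def relTrace (A B : EuclideanSpace ℝ (Fin n) → EuclideanSpace ℝ (Fin n) → ℝ) : ℝ :=
  ∑ a, ∑ b, (gram A)⁻¹ a b * B (EuclideanSpace.single a 1) (EuclideanSpace.single b 1)

lemma relTrace_eq_trace (A B : EuclideanSpace ℝ (Fin n) → EuclideanSpace ℝ (Fin n) → ℝ) :
    relTrace A B = ((gram A)⁻¹ * (gram B).transpose).trace := by
  simp [relTrace, Matrix.trace, Matrix.mul_apply, gram]

/-- Bilinearity of a function of two vectors. -/
def IsBilin (B : EuclideanSpace ℝ (Fin n) → EuclideanSpace ℝ (Fin n) → ℝ) : Prop :=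
  ∃ b : EuclideanSpace ℝ (Fin n) →ₗ[ℝ] EuclideanSpace ℝ (Fin n) →ₗ[ℝ] ℝ, ∀ v w, B v w = b v w

lemma gram_comp {B : EuclideanSpace ℝ (Fin n) → EuclideanSpace ℝ (Fin n) → ℝ} (hB : IsBilin B)
    (L : EuclideanSpace ℝ (Fin n) →ₗ[ℝ] EuclideanSpace ℝ (Fin n)) :
    gram (fun v w => B (L v) (L w)) =
      (LinearMap.toMatrix (EuclideanSpace.basisFun (Fin n) ℝ).toBasis
        (EuclideanSpace.basisFun (Fin n) ℝ).toBasis L).transpose * gram B *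
      LinearMap.toMatrix (EuclideanSpace.basisFun (Fin n) ℝ).toBasis
        (EuclideanSpace.basisFun (Fin n) ℝ).toBasis L := by
  obtain ⟨b, hb⟩ := hB
  have h1 : gram B = LinearMap.toMatrix₂ (EuclideanSpace.basisFun (Fin n) ℝ).toBasis
      (EuclideanSpace.basisFun (Fin n) ℝ).toBasis b := by
    ext i j; simp [gram, hb, LinearMap.toMatrix₂_apply]
  rw [h1, ← LinearMap.toMatrix₂_compl₁₂]
  ext i j
  simp [gram, hb, LinearMap.toMatrix₂_apply]

/-- Both Gram matrices change by congruence with the same invertible `P`, so the product of the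
inverse of one with the transpose of the other is conjugated by `P`, which preserves the trace. -/
lemma relTrace_comp {A B : EuclideanSpace ℝ (Fin n) → EuclideanSpace ℝ (Fin n) → ℝ}
    (hA : IsBilin A) (hB : IsBilin B)
    {L L' : EuclideanSpace ℝ (Fin n) →ₗ[ℝ] EuclideanSpace ℝ (Fin n)} (hL : L ∘ₗ L' = LinearMap.id) :
    relTrace (fun v w => A (L v) (L w)) (fun v w => B (L v) (L w)) = relTrace A B := by
  rw [relTrace_eq_trace, relTrace_eq_trace, gram_comp hA, gram_comp hB]
  set P := LinearMap.toMatrix (EuclideanSpace.basisFun (Fin n) ℝ).toBasis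
        (EuclideanSpace.basisFun (Fin n) ℝ).toBasis L with hP
  have hP' : IsUnit P.det := by
    refine (Matrix.isUnit_iff_isUnit_det _).1 (IsUnit.of_mul_eq_one (LinearMap.toMatrix
      (EuclideanSpace.basisFun (Fin n) ℝ).toBasis
        (EuclideanSpace.basisFun (Fin n) ℝ).toBasis L') ?_)
    rw [hP, ← LinearMap.toMatrix_comp, hL, LinearMap.toMatrix_id]
  have hPt : IsUnit P.transpose.det := by rwa [Matrix.det_transpose]
  rw [Matrix.mul_inv_rev, Matrix.mul_inv_rev, Matrix.transpose_mul, Matrix.transpose_mul,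
    Matrix.transpose_transpose]
  calc (P⁻¹ * ((gram A)⁻¹ * P.transpose⁻¹) * (P.transpose * ((gram B).transpose * P))).trace
      = (P⁻¹ * ((gram A)⁻¹ * (P.transpose⁻¹ * P.transpose) * (gram B).transpose * P)).trace := by
        simp only [Matrix.mul_assoc]
    _ = _ := by
        rw [Matrix.nonsing_inv_mul _ hPt, Matrix.mul_one, Matrix.trace_mul_comm, Matrix.mul_assoc,
          Matrix.mul_nonsing_inv _ hP', Matrix.mul_one]

lemma isBilin_localFirstForm
    (G : EuclideanSpace ℝ (Fin m) → EuclideanSpace ℝ (Fin m) →L[ℝ] EuclideanSpace ℝ (Fin m) →L[ℝ] ℝ)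
    (f : EuclideanSpace ℝ (Fin n) → EuclideanSpace ℝ (Fin m)) (y : EuclideanSpace ℝ (Fin n)) :
    IsBilin (localFirstForm G f y) :=
  ⟨LinearMap.mk₂ ℝ (localFirstForm G f y) (by simp [localFirstForm]) (by simp [localFirstForm])
    (by simp [localFirstForm]) (by simp [localFirstForm]), fun _ _ => rfl⟩

lemma isBilin_localSecondForm
    (G : EuclideanSpace ℝ (Fin m) → EuclideanSpace ℝ (Fin m) →L[ℝ] EuclideanSpace ℝ (Fin m) →L[ℝ] ℝ)
    (R : Set (EuclideanSpace ℝ (Fin m))) (f : EuclideanSpace ℝ (Fin n) → EuclideanSpace ℝ (Fin m))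
    (y : EuclideanSpace ℝ (Fin n)) (ν : EuclideanSpace ℝ (Fin m)) :
    IsBilin (localSecondForm G R f y ν) := by
  refine ⟨LinearMap.mk₂ ℝ (localSecondForm G R f y ν) ?_ ?_ ?_ ?_, fun _ _ => rfl⟩ <;> intros <;>
    simp [localSecondForm, localChristoffel] <;> ring

/-- The mean curvature of a parametrized hypersurface in coordinates. -/
noncomputable def localMeanCurvature
    (G : EuclideanSpace ℝ (Fin m) → EuclideanSpace ℝ (Fin m) →L[ℝ] EuclideanSpace ℝ (Fin m) →L[ℝ] ℝ)
    (R : Set (EuclideanSpace ℝ (Fin m))) (f : EuclideanSpace ℝ (Fin n) → EuclideanSpace ℝ (Fin m))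
    (y : EuclideanSpace ℝ (Fin n)) (ν : EuclideanSpace ℝ (Fin m)) : ℝ :=
  relTrace (localFirstForm G f y) (localSecondForm G R f y ν)

/-- The second fundamental form is invariant under coordinate changes of the ambient space. -/
lemma localSecondForm_comp_left
    {G₀ G : EuclideanSpace ℝ (Fin m) →
      EuclideanSpace ℝ (Fin m) →L[ℝ] EuclideanSpace ℝ (Fin m) →L[ℝ] ℝ}
    {R : Set (EuclideanSpace ℝ (Fin m))} (hR : UniqueDiffOn ℝ R) (hR' : R ⊆ closure (interior R))
    {f : EuclideanSpace ℝ (Fin n) → EuclideanSpace ℝ (Fin m)} {y : EuclideanSpace ℝ (Fin n)}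
    (hf : ContDiffAt ℝ ∞ f y) (hfR : ∀ᶠ z in 𝓝 y, f z ∈ R)
    {τ : EuclideanSpace ℝ (Fin m) → EuclideanSpace ℝ (Fin m)}
    (hτ : ContDiffWithinAt ℝ ∞ τ R (f y)) (hτR : ∀ᶠ x in 𝓝[R] (f y), τ x ∈ R)
    (hG : DifferentiableWithinAt ℝ G R (τ (f y)))
    (hsymm : ∀ v w, G (τ (f y)) v w = G (τ (f y)) w v)
    (hGG : ∀ᶠ x in 𝓝[R] (f y), ∀ v w,
      G₀ x v w = G (τ x) (fderivWithin ℝ τ R x v) (fderivWithin ℝ τ R x w))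
    (hG₀ : DifferentiableWithinAt ℝ G₀ R (f y))
    (ν : EuclideanSpace ℝ (Fin m)) (v w : EuclideanSpace ℝ (Fin n)) :
    localSecondForm G R (τ ∘ f) y (fderivWithin ℝ τ R (f y) ν) v w =
      localSecondForm G₀ R f y ν v w := by
  have hfy : f y ∈ R := hfR.self_of_nhds
  have hsnd := fderiv_fderiv_comp_fderivWithin hR hf hfR hτ v w
  have hcomp := (eventually_fderiv_comp_fderivWithin hf hfR hτ).self_of_nhds
  have hGd := fderivWithin_metric_pullback hR hfy
    (hτ.differentiableWithinAt (by simp)).hasFDerivWithinAt hτR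
    ((hτ.fderivWithin_right (m := ∞) hR (by simp) hfy).differentiableWithinAt (by simp)) hG hGG hG₀
  -- By symmetry of `D²τ` and of `G`, the six second-derivative terms in the Christoffel symbols of
  -- the pulled-back metric collapse to `G(D²τ(a, b), τ' ν)`, the extra term of the chain rule for
  -- `τ ∘ f`.
  have hsym : ∀ a b, fderivWithin ℝ (fderivWithin ℝ τ R) R (f y) a b =
      fderivWithin ℝ (fderivWithin ℝ τ R) R (f y) b a :=
    fun a b => hτ.isSymmSndFDerivWithinAt (by
      rw [minSmoothness_of_isRCLikeNormedField]; exact WithTop.coe_le_coe.2 le_top) hR (hR' hfy) hfy a b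
  have hG0 := hGG.self_of_nhdsWithin hfy
  simp only [localSecondForm, localChristoffel, hsnd, hcomp, Function.comp_apply,
    ContinuousLinearMap.comp_apply, hGd, map_add, add_apply, hG0]
  set τ' := fderivWithin ℝ τ R
  set a := fderiv ℝ f y v
  set b := fderiv ℝ f y w
  rw [hsym b a, hsym ν a, hsym ν b, hsymm (fderivWithin ℝ τ' R (f y) a ν) (τ' (f y) b)]
  ring

end LocalCurvature
end FreeBoundary

namespace FreeBoundary

/-! ### Change of parameters of the hypersurface. -/

section Reparametrization

variable {n m : ℕ}

/-- Reparametrization adds `df(D²σ(v, w))` to the Hessian. This vector is tangent, so pairing with a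
normal `ν` removes it. -/
lemma localSecondForm_comp_right
    {G : EuclideanSpace ℝ (Fin m) → EuclideanSpace ℝ (Fin m) →L[ℝ] EuclideanSpace ℝ (Fin m) →L[ℝ] ℝ}
    {R : Set (EuclideanSpace ℝ (Fin m))} {f : EuclideanSpace ℝ (Fin n) → EuclideanSpace ℝ (Fin m)}
    {σ : EuclideanSpace ℝ (Fin n) → EuclideanSpace ℝ (Fin n)} {y : EuclideanSpace ℝ (Fin n)}
    (hσ : ContDiffAt ℝ ∞ σ y) (hf : ContDiffAt ℝ ∞ f (σ y)) {ν : EuclideanSpace ℝ (Fin m)}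
    (hν : ∀ v, G (f (σ y)) (fderiv ℝ f (σ y) v) ν = 0) (v w : EuclideanSpace ℝ (Fin n)) :
    localSecondForm G R (f ∘ σ) y ν v w =
      localSecondForm G R f (σ y) ν (fderiv ℝ σ y v) (fderiv ℝ σ y w) := by
  have h1 := fderiv_fderiv_comp_fderivWithin uniqueDiffOn_univ hσ
    (Eventually.of_forall fun _ => mem_univ _) hf.contDiffWithinAt v w
  have h2 := (eventually_fderiv_comp_fderivWithin hσ
    (Eventually.of_forall fun _ => mem_univ _) hf.contDiffWithinAt).self_of_nhds
  simp only [fderivWithin_univ] at h1 h2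
  simp only [localSecondForm, h1, h2, Function.comp_apply, ContinuousLinearMap.comp_apply, map_add,
    add_apply, hν]
  ring

/-- The mean curvature is invariant under reparametrization. -/
lemma localMeanCurvature_comp_right
    {G : EuclideanSpace ℝ (Fin m) → EuclideanSpace ℝ (Fin m) →L[ℝ] EuclideanSpace ℝ (Fin m) →L[ℝ] ℝ}
    {R : Set (EuclideanSpace ℝ (Fin m))} {f : EuclideanSpace ℝ (Fin n) → EuclideanSpace ℝ (Fin m)}
    {σ : EuclideanSpace ℝ (Fin n) → EuclideanSpace ℝ (Fin n)} {y : EuclideanSpace ℝ (Fin n)}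
    (hσ : ContDiffAt ℝ ∞ σ y) (hf : ContDiffAt ℝ ∞ f (σ y)) {ν : EuclideanSpace ℝ (Fin m)}
    (hν : ∀ v, G (f (σ y)) (fderiv ℝ f (σ y) v) ν = 0)
    {L : EuclideanSpace ℝ (Fin n) →L[ℝ] EuclideanSpace ℝ (Fin n)}
    (hL : ∀ v, fderiv ℝ σ y (L v) = v) :
    localMeanCurvature G R (f ∘ σ) y ν = localMeanCurvature G R f (σ y) ν := by
  have h1 : localFirstForm G (f ∘ σ) y = fun v w =>
      localFirstForm G f (σ y) (fderiv ℝ σ y v) (fderiv ℝ σ y w) := by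
    funext v w
    simp only [localFirstForm, Function.comp_apply,
      fderiv_comp y (hf.differentiableAt (by simp)) (hσ.differentiableAt (by simp)),
      ContinuousLinearMap.comp_apply]
  have h2 : localSecondForm G R (f ∘ σ) y ν = fun v w =>
      localSecondForm G R f (σ y) ν (fderiv ℝ σ y v) (fderiv ℝ σ y w) := by
    funext v w
    exact localSecondForm_comp_right hσ hf hν v w
  rw [localMeanCurvature, h1, h2]
  exact relTrace_comp (isBilin_localFirstForm G f _) (isBilin_localSecondForm G R f _ ν)
    (L := (fderiv ℝ σ y).toLinearMap) (L' := L.toLinearMap) (LinearMap.ext hL)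

end Reparametrization

/-! ### The metric in a fixed chart. -/

section ChartMetric

variable {m : ℕ} [NeZero m] {M : Type*} [TopologicalSpace M]
  [ChartedSpace (EuclideanHalfSpace m) M] [IsManifold (𝓡∂ m) ∞ M]

/-- The coordinate frame of the chart around `q`, at the point with coordinates `y`. -/
noncomputable def chartFrame (q : M) (y : EuclideanSpace ℝ (Fin m)) :
    EuclideanSpace ℝ (Fin m) →L[ℝ] EuclideanSpace ℝ (Fin m) :=
  mfderivWithin 𝓘(ℝ, EuclideanSpace ℝ (Fin m)) (𝓡∂ m) (extChartAt (𝓡∂ m) q).symm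
    (range (𝓡∂ m)) y

/-- The metric in the chart around `q`, as a bilinear form on the model space. -/
noncomputable def chartMetric (g : Metric m M) (q : M) (y : EuclideanSpace ℝ (Fin m)) :
    EuclideanSpace ℝ (Fin m) →L[ℝ] EuclideanSpace ℝ (Fin m) →L[ℝ] ℝ :=
  (flatMetric g ((extChartAt (𝓡∂ m) q).symm y)).bilinearComp (chartFrame q y) (chartFrame q y)

/-- The coordinates of tangent vectors at `x` in the chart around `q`. -/
noncomputable def chartDiff (q x : M) : EuclideanSpace ℝ (Fin m) →L[ℝ] EuclideanSpace ℝ (Fin m) :=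
  mfderiv (𝓡∂ m) 𝓘(ℝ, EuclideanSpace ℝ (Fin m)) (extChartAt (𝓡∂ m) q) x

lemma metricInChart_eq (g : Metric m M) (q : M) (y v w : EuclideanSpace ℝ (Fin m)) :
    metricInChart g q y v w = chartMetric g q y v w :=
  rfl

lemma chartMetric_symm (g : Metric m M) (q : M) (y v w : EuclideanSpace ℝ (Fin m)) :
    chartMetric g q y v w = chartMetric g q y w v :=
  flatMetric_symm g _ _ _

/-- The tangent space at `q` is read in the chart at `q`, so the frame of this chart is the identity
at its own centre. -/
lemma chartMetric_self (g : Metric m M) (q : M) (v w : EuclideanSpace ℝ (Fin m)) :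
    chartMetric g q (extChartAt (𝓡∂ m) q q) v w = flatMetric g q v w := by
  have h1 : chartFrame q (extChartAt (𝓡∂ m) q q) = ContinuousLinearMap.id ℝ _ :=
    mfderivWithin_range_extChartAt_symm
  rw [chartMetric, h1, extChartAt_to_inv]
  rfl

lemma chartDiff_eq_fderivWithin {q x : M} (hx : x ∈ (extChartAt (𝓡∂ m) q).source) :
    chartDiff q x = fderivWithin ℝ (extChartAt (𝓡∂ m) q ∘ (extChartAt (𝓡∂ m) x).symm)
      (range (𝓡∂ m)) (extChartAt (𝓡∂ m) x x) :=
  (mdifferentiableAt_extChartAt (I := 𝓡∂ m) (by simpa using hx)).mfderiv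

lemma contDiffWithinAt_transition {q q' : M} {y : EuclideanSpace ℝ (Fin m)}
    (hy : y ∈ (extChartAt (𝓡∂ m) q).target)
    (hy' : (extChartAt (𝓡∂ m) q).symm y ∈ (extChartAt (𝓡∂ m) q').source) :
    ContDiffWithinAt ℝ ∞ (extChartAt (𝓡∂ m) q' ∘ (extChartAt (𝓡∂ m) q).symm) (range (𝓡∂ m)) y := by
  rw [← contMDiffWithinAt_iff_contDiffWithinAt]
  exact (contMDiffAt_extChartAt' (by simpa using hy')).comp_contMDiffWithinAt y
    (contMDiffWithinAt_extChartAt_symm_range q hy)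

lemma eventually_mem_chart {q q' : M} {y : EuclideanSpace ℝ (Fin m)}
    (hy : y ∈ (extChartAt (𝓡∂ m) q).target)
    (hy' : (extChartAt (𝓡∂ m) q).symm y ∈ (extChartAt (𝓡∂ m) q').source) :
    ∀ᶠ z in 𝓝[range (𝓡∂ m)] y, z ∈ (extChartAt (𝓡∂ m) q).target ∧
      (extChartAt (𝓡∂ m) q).symm z ∈ (extChartAt (𝓡∂ m) q').source :=
  Eventually.and (extChartAt_target_mem_nhdsWithin_of_mem hy)
    ((continuousAt_extChartAt_symm'' hy).continuousWithinAt.preimage_mem_nhdsWithin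
      ((isOpen_extChartAt_source q').mem_nhds hy'))

/-- The coordinates, in one chart, of the coordinate frame of another chart. -/
lemma chartFrame_change {q q' : M} {y : EuclideanSpace ℝ (Fin m)}
    (hy : y ∈ (extChartAt (𝓡∂ m) q).target)
    (hy' : (extChartAt (𝓡∂ m) q).symm y ∈ (extChartAt (𝓡∂ m) q').source) :
    chartFrame q y = (chartFrame q' (extChartAt (𝓡∂ m) q' ((extChartAt (𝓡∂ m) q).symm y))).comp
      (fderivWithin ℝ (extChartAt (𝓡∂ m) q' ∘ (extChartAt (𝓡∂ m) q).symm) (range (𝓡∂ m)) y) := by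
  set τ := extChartAt (𝓡∂ m) q' ∘ (extChartAt (𝓡∂ m) q).symm with hτ
  have hyR : y ∈ range (𝓡∂ m) := extChartAt_target_subset_range q hy
  have hU : UniqueMDiffWithinAt 𝓘(ℝ, EuclideanSpace ℝ (Fin m)) (range (𝓡∂ m)) y :=
    ((𝓡∂ m).uniqueDiffOn y hyR).uniqueMDiffWithinAt
  have h1 : (extChartAt (𝓡∂ m) q).symm =ᶠ[𝓝[range (𝓡∂ m)] y]
      (extChartAt (𝓡∂ m) q').symm ∘ τ := by
    filter_upwards [eventually_mem_chart hy hy'] with z hz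
    exact ((extChartAt (𝓡∂ m) q').left_inv hz.2).symm
  have hτd : DifferentiableWithinAt ℝ τ (range (𝓡∂ m)) y :=
    (contDiffWithinAt_transition hy hy').differentiableWithinAt (by simp)
  have h2 := mfderivWithin_comp (I := 𝓘(ℝ, EuclideanSpace ℝ (Fin m)))
    (I' := 𝓘(ℝ, EuclideanSpace ℝ (Fin m))) (I'' := 𝓡∂ m) (f := τ)
    (g := (extChartAt (𝓡∂ m) q').symm) (s := range (𝓡∂ m)) (u := range (𝓡∂ m)) y
    (mdifferentiableWithinAt_extChartAt_symm ((extChartAt (𝓡∂ m) q').map_source hy'))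
    hτd.mdifferentiableWithinAt (fun z _ => mem_range_self _) hU
  rw [mfderivWithin_eq_fderivWithin] at h2
  have h3 := h1.mfderivWithin_eq (I := 𝓘(ℝ, EuclideanSpace ℝ (Fin m))) (I' := 𝓡∂ m)
    (h1.self_of_nhdsWithin hyR)
  exact h3.trans h2

lemma chartMetric_change (g : Metric m M) {q q' : M} {y : EuclideanSpace ℝ (Fin m)}
    (hy : y ∈ (extChartAt (𝓡∂ m) q).target)
    (hy' : (extChartAt (𝓡∂ m) q).symm y ∈ (extChartAt (𝓡∂ m) q').source)
    (v w : EuclideanSpace ℝ (Fin m)) :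
    chartMetric g q y v w =
      chartMetric g q' ((extChartAt (𝓡∂ m) q' ∘ (extChartAt (𝓡∂ m) q).symm) y)
        (fderivWithin ℝ (extChartAt (𝓡∂ m) q' ∘ (extChartAt (𝓡∂ m) q).symm) (range (𝓡∂ m)) y v)
        (fderivWithin ℝ (extChartAt (𝓡∂ m) q' ∘ (extChartAt (𝓡∂ m) q).symm) (range (𝓡∂ m)) y w) := by
  simp only [chartMetric, ContinuousLinearMap.bilinearComp_apply, chartFrame_change hy hy',
    ContinuousLinearMap.comp_apply, Function.comp_apply, (extChartAt (𝓡∂ m) q').left_inv hy']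

/-- The coordinate metric is smooth. -/
lemma contDiffWithinAt_chartMetric (g : Metric m M) {q : M} {y : EuclideanSpace ℝ (Fin m)}
    (hy : y ∈ (extChartAt (𝓡∂ m) q).target) :
    ContDiffWithinAt ℝ ∞ (chartMetric g q) (range (𝓡∂ m)) y := by
  suffices h : ContDiffOn ℝ ∞ (chartMetric g q) (extChartAt (𝓡∂ m) q).target from
    (h y hy).mono_of_mem_nhdsWithin (extChartAt_target_mem_nhdsWithin_of_mem hy)
  refine contDiffOn_clm_apply.2 fun v => contDiffOn_clm_apply.2 fun w => ?_
  rw [← contMDiffOn_iff_contDiffOn]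
  -- A coordinate field is the constant vector `u` in the trivialization at `q`, hence a smooth
  -- section.
  have hfr : ∀ u : EuclideanSpace ℝ (Fin m), ContMDiffOn 𝓘(ℝ, EuclideanSpace ℝ (Fin m))
      ((𝓡∂ m).prod 𝓘(ℝ, EuclideanSpace ℝ (Fin m))) ∞
      (fun y => Bundle.TotalSpace.mk' (EuclideanSpace ℝ (Fin m))
        (E := fun x : M => TangentSpace (𝓡∂ m) x) ((extChartAt (𝓡∂ m) q).symm y)
        (coordVector q y u)) (extChartAt (𝓡∂ m) q).target := by
    intro u
    have h1 := (Bundle.Trivialization.contMDiffOn_symm (IB := 𝓡∂ m) (n := ∞)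
      (e := trivializationAt (EuclideanSpace ℝ (Fin m)) (TangentSpace (𝓡∂ m) : M → Type _) q))
    have h2 : ContMDiffOn 𝓘(ℝ, EuclideanSpace ℝ (Fin m))
        ((𝓡∂ m).prod 𝓘(ℝ, EuclideanSpace ℝ (Fin m))) ∞
        (fun y => ((extChartAt (𝓡∂ m) q).symm y, u)) (extChartAt (𝓡∂ m) q).target :=
      (contMDiffOn_extChartAt_symm q).prodMk contMDiffOn_const
    refine (h1.comp h2 fun y hy => ?_).congr fun y hy => ?_
    · have := (extChartAt (𝓡∂ m) q).map_target hy
      simpa [Bundle.Trivialization.mem_target] using this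
    · have hs : (extChartAt (𝓡∂ m) q).symm y ∈ (chartAt (EuclideanHalfSpace m) q).source := by
        simpa using (extChartAt (𝓡∂ m) q).map_target hy
      have h3 := TangentBundle.symmL_trivializationAt (I := 𝓡∂ m) hs
      rw [(extChartAt (𝓡∂ m) q).right_inv hy] at h3
      have h4 : coordVector q y u = (trivializationAt (EuclideanSpace ℝ (Fin m))
          (TangentSpace (𝓡∂ m)) q).symmL ℝ ((extChartAt (𝓡∂ m) q).symm y) u := by
        rw [h3]; rfl
      rw [Function.comp_apply, h4, Bundle.Trivialization.symmL_apply _ hs]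
      exact Bundle.Trivialization.mk_symm (trivializationAt (EuclideanSpace ℝ (Fin m))
        (TangentSpace (𝓡∂ m) : M → Type _) q) hs u
  intro y hy
  have hg : ContMDiffWithinAt 𝓘(ℝ, EuclideanSpace ℝ (Fin m)) ((𝓡∂ m).prod
      𝓘(ℝ, EuclideanSpace ℝ (Fin m) →L[ℝ] EuclideanSpace ℝ (Fin m) →L[ℝ] ℝ)) ∞
      (fun y => Bundle.TotalSpace.mk' (EuclideanSpace ℝ (Fin m) →L[ℝ]
        EuclideanSpace ℝ (Fin m) →L[ℝ] ℝ) (E := fun x : M => TangentSpace (𝓡∂ m) x →L[ℝ]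
          TangentSpace (𝓡∂ m) x →L[ℝ] ℝ)
        ((extChartAt (𝓡∂ m) q).symm y) (g.inner ((extChartAt (𝓡∂ m) q).symm y)))
      (extChartAt (𝓡∂ m) q).target y :=
    g.contMDiff.contMDiffAt.comp_contMDiffWithinAt y (contMDiffOn_extChartAt_symm q y hy)
  have h5 := ContMDiffWithinAt.clm_bundle_apply₂ (F₁ := EuclideanSpace ℝ (Fin m))
    (F₂ := EuclideanSpace ℝ (Fin m)) (E₃ := Bundle.Trivial M ℝ) (F₃ := ℝ) hg (hfr v y hy) (hfr w y hy)
  simp only [Bundle.contMDiffWithinAt_totalSpace] at h5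
  exact h5.2

end ChartMetric

/-! ### Mean curvature computed in arbitrary fixed charts. -/

section Bridge

variable {n m : ℕ} [NeZero n] [NeZero m]
  {S : Type*} [TopologicalSpace S] [ChartedSpace (EuclideanHalfSpace n) S] [IsManifold (𝓡∂ n) ∞ S]
  {M : Type*} [TopologicalSpace M] [ChartedSpace (EuclideanHalfSpace m) M] [IsManifold (𝓡∂ m) ∞ M]

lemma metricDeriv_eq (g : Metric m M) (x : M) (u v w : EuclideanSpace ℝ (Fin m)) :
    metricDeriv g x u v w =
      fderivWithin ℝ (chartMetric g x) (range (𝓡∂ m)) (extChartAt (𝓡∂ m) x x) u v w := by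
  have h := (contDiffWithinAt_chartMetric g (mem_extChartAt_target (I := 𝓡∂ m) x)
    ).differentiableWithinAt (by simp)
  have h1 := (h.hasFDerivWithinAt.clm_apply (hasFDerivWithinAt_const v _ _)).clm_apply
    (hasFDerivWithinAt_const w _ _)
  rw [metricDeriv]
  simp only [metricInChart_eq]
  rw [h1.fderivWithin ((𝓡∂ m).uniqueDiffOn _ (mem_range_self _))]
  simp

lemma christoffel_eq (g : Metric m M) (x : M) (u v w : EuclideanSpace ℝ (Fin m)) :
    christoffel g x u v w =
      localChristoffel (chartMetric g x) (range (𝓡∂ m)) (extChartAt (𝓡∂ m) x x) u v w := by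
  simp only [christoffel, metricDeriv_eq, localChristoffel]

lemma range_mem_nhds_of_mem_interior {p p₀ : S} (hp : p ∈ (𝓡∂ n).interior S)
    (hp₀ : p ∈ (extChartAt (𝓡∂ n) p₀).source) :
    range (𝓡∂ n) ∈ 𝓝 (extChartAt (𝓡∂ n) p₀ p) := by
  rw [← mem_interior_iff_mem_nhds, interior_range_modelWithCornersEuclideanHalfSpace]
  exact (mem_interior_iff_coord_pos hp₀).1 hp

lemma contDiffAt_chart_of_interior {φ : S → M} {p p₀ : S} {q : M} (hp : p ∈ (𝓡∂ n).interior S)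
    (hφ : ContMDiffAt (𝓡∂ n) (𝓡∂ m) ∞ φ p) (hp₀ : p ∈ (extChartAt (𝓡∂ n) p₀).source)
    (hq : φ p ∈ (extChartAt (𝓡∂ m) q).source) :
    ContDiffAt ℝ ∞ (extChartAt (𝓡∂ m) q ∘ φ ∘ (extChartAt (𝓡∂ n) p₀).symm)
      (extChartAt (𝓡∂ n) p₀ p) := by
  have h : ContDiffWithinAt ℝ ∞ (extChartAt (𝓡∂ m) q ∘ φ ∘ (extChartAt (𝓡∂ n) p₀).symm)
      (range (𝓡∂ n)) (extChartAt (𝓡∂ n) p₀ p) := by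
    rw [← contMDiffWithinAt_iff_contDiffWithinAt]
    have h1 : ContMDiffAt (𝓡∂ n) 𝓘(ℝ, EuclideanSpace ℝ (Fin m)) ∞ (extChartAt (𝓡∂ m) q ∘ φ)
        ((extChartAt (𝓡∂ n) p₀).symm (extChartAt (𝓡∂ n) p₀ p)) := by
      rw [(extChartAt (𝓡∂ n) p₀).left_inv hp₀]
      exact (contMDiffAt_extChartAt' (by simpa using hq)).comp p hφ
    exact h1.comp_contMDiffWithinAt _
      (contMDiffWithinAt_extChartAt_symm_range p₀ ((extChartAt (𝓡∂ n) p₀).map_source hp₀))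
  exact h.contDiffAt (range_mem_nhds_of_mem_interior hp hp₀)

lemma flatDifferential_eq_fderiv {φ : S → M} {p : S} (hp : p ∈ (𝓡∂ n).interior S)
    (hφ : ContMDiffAt (𝓡∂ n) (𝓡∂ m) ∞ φ p) :
    flatDifferential φ p =
      fderiv ℝ (writtenInExtChartAt (𝓡∂ n) (𝓡∂ m) p φ) (extChartAt (𝓡∂ n) p p) := by
  rw [← fderivWithin_of_mem_nhds (range_mem_nhds_of_mem_interior hp (mem_extChartAt_source p))]
  exact (hφ.mdifferentiableAt (by simp)).mfderiv

/-- The mean curvature in the preferred charts. -/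
lemma meanCurvature_eq_local_self (g : Metric m M) {φ : S → M} {p : S}
    (hp : p ∈ (𝓡∂ n).interior S) (hφ : ContMDiffAt (𝓡∂ n) (𝓡∂ m) ∞ φ p)
    (ν : EuclideanSpace ℝ (Fin m)) :
    meanCurvature (n := n) g φ p ν = localMeanCurvature (chartMetric g (φ p)) (range (𝓡∂ m))
      (writtenInExtChartAt (𝓡∂ n) (𝓡∂ m) p φ) (extChartAt (𝓡∂ n) p p) ν := by
  set f := writtenInExtChartAt (𝓡∂ n) (𝓡∂ m) p φ with hf
  set y := extChartAt (𝓡∂ n) p p with hy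
  have hfy : f y = extChartAt (𝓡∂ m) (φ p) (φ p) := by
    rw [hf, writtenInExtChartAt, Function.comp_apply, Function.comp_apply, hy, extChartAt_to_inv]
  have hd : flatDifferential φ p = fderiv ℝ f y := flatDifferential_eq_fderiv hp hφ
  have h1 : firstFundamentalForm (n := n) g φ p = gram (localFirstForm (chartMetric g (φ p)) f y) := by
    ext a b
    simp only [gram, Matrix.of_apply, localFirstForm, hfy, chartMetric_self, ← hd]
    rfl
  have h2 : ∀ v w, secondFundamentalForm (n := n) g φ p ν v w =
      localSecondForm (chartMetric g (φ p)) (range (𝓡∂ m)) f y ν v w := by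
    intro v w
    have h3 : coordHessian (n := n) (m := m) φ p v w = fderiv ℝ (fderiv ℝ f) y v w := by
      unfold coordHessian
      rw [fderivWithin_fderivWithin_eq_of_mem_nhds
        (range_mem_nhds_of_mem_interior hp (mem_extChartAt_source p))]
    have h4 := christoffel_eq g (φ p) (flatDifferential φ p v) (flatDifferential φ p w) ν
    unfold localSecondForm
    rw [hfy, chartMetric_self, ← hd, ← h3]
    exact congrArg _ h4
  unfold meanCurvature localMeanCurvature relTrace
  rw [h1]
  refine Finset.sum_congr rfl fun a _ => Finset.sum_congr rfl fun b _ => ?_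
  rw [h2]; rfl

lemma localMeanCurvature_congr
    {G : EuclideanSpace ℝ (Fin m) → EuclideanSpace ℝ (Fin m) →L[ℝ] EuclideanSpace ℝ (Fin m) →L[ℝ] ℝ}
    {R : Set (EuclideanSpace ℝ (Fin m))} {f f' : EuclideanSpace ℝ (Fin n) → EuclideanSpace ℝ (Fin m)}
    {y : EuclideanSpace ℝ (Fin n)} (h : f =ᶠ[𝓝 y] f') (ν : EuclideanSpace ℝ (Fin m)) :
    localMeanCurvature G R f y ν = localMeanCurvature G R f' y ν := by
  have h1 : localFirstForm G f y = localFirstForm G f' y := by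
    funext v w
    simp only [localFirstForm, h.fderiv_eq, h.eq_of_nhds]
  have h2 : localSecondForm G R f y ν = localSecondForm G R f' y ν := by
    funext v w
    simp only [localSecondForm, h.fderiv_eq, h.eq_of_nhds, h.fderiv.fderiv_eq]
  rw [localMeanCurvature, localMeanCurvature, h1, h2]

section ChangeOfCharts

variable {φ : S → M} {p p₀ : S} {q₀ : M} (hp : p ∈ (𝓡∂ n).interior S)
  (hφ : ContMDiffAt (𝓡∂ n) (𝓡∂ m) ∞ φ p)
  (hp₀ : p ∈ (extChartAt (𝓡∂ n) p₀).source) (hq₀ : φ p ∈ (extChartAt (𝓡∂ m) q₀).source)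

include hp hp₀ in
lemma contDiffAt_transition : ContDiffAt ℝ ∞ (extChartAt (𝓡∂ n) p₀ ∘ (extChartAt (𝓡∂ n) p).symm)
    (extChartAt (𝓡∂ n) p p) :=
  (contDiffWithinAt_transition (mem_extChartAt_target p) (by rwa [extChartAt_to_inv])).contDiffAt
    (range_mem_nhds_of_mem_interior hp (mem_extChartAt_source p))

include hp hp₀ in
lemma chartDiff_eq_fderiv : chartDiff p₀ p =
    fderiv ℝ (extChartAt (𝓡∂ n) p₀ ∘ (extChartAt (𝓡∂ n) p).symm) (extChartAt (𝓡∂ n) p p) := by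
  rw [chartDiff_eq_fderivWithin hp₀, fderivWithin_of_mem_nhds
    (range_mem_nhds_of_mem_interior hp (mem_extChartAt_source p))]

lemma exists_chartDiff_inverse {q x : M} (hx : x ∈ (extChartAt (𝓡∂ m) q).source) :
    ∃ L : EuclideanSpace ℝ (Fin m) →L[ℝ] EuclideanSpace ℝ (Fin m),
      (∀ v, chartDiff q x (L v) = v) ∧ ∀ v, L (chartDiff q x v) = v := by
  obtain ⟨L, hL⟩ := isInvertible_mfderiv_extChartAt (I := 𝓡∂ m) hx
  have h : ∀ v, chartDiff q x v = L v := fun v => (DFunLike.congr_fun hL v).symm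
  let L' : EuclideanSpace ℝ (Fin m) →L[ℝ] EuclideanSpace ℝ (Fin m) :=
    L.symm.toContinuousLinearMap
  refine ⟨L', fun v => ?_, fun v => ?_⟩
  · exact (h _).trans (L.apply_symm_apply v)
  · exact (congrArg L' (h v)).trans (L.symm_apply_apply v)

include hp hφ hp₀ hq₀ in
lemma eventuallyEq_change_of_charts :
    (extChartAt (𝓡∂ m) q₀ ∘ (extChartAt (𝓡∂ m) (φ p)).symm) ∘
        writtenInExtChartAt (𝓡∂ n) (𝓡∂ m) p φ =ᶠ[𝓝 (extChartAt (𝓡∂ n) p p)]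
      (extChartAt (𝓡∂ m) q₀ ∘ φ ∘ (extChartAt (𝓡∂ n) p₀).symm) ∘
        (extChartAt (𝓡∂ n) p₀ ∘ (extChartAt (𝓡∂ n) p).symm) := by
  have h1 : ∀ᶠ z in 𝓝 p, z ∈ (extChartAt (𝓡∂ n) p₀).source ∧
      φ z ∈ (extChartAt (𝓡∂ m) (φ p)).source :=
    Eventually.and ((isOpen_extChartAt_source p₀).mem_nhds hp₀)
      (hφ.continuousAt.preimage_mem_nhds (extChartAt_source_mem_nhds (φ p)))
  have h2 : Tendsto (extChartAt (𝓡∂ n) p).symm (𝓝 (extChartAt (𝓡∂ n) p p)) (𝓝 p) := by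
    have := (continuousAt_extChartAt_symm (I := 𝓡∂ n) p).tendsto
    rwa [extChartAt_to_inv] at this
  filter_upwards [h2.eventually h1] with z hz
  simp only [Function.comp_apply, writtenInExtChartAt, (extChartAt (𝓡∂ m) (φ p)).left_inv hz.2,
    (extChartAt (𝓡∂ n) p₀).left_inv hz.1]

include hp hφ hp₀ hq₀ in
/-- The differential in an arbitrary pair of charts. -/
lemma fderiv_chart_chartDiff (v : EuclideanSpace ℝ (Fin n)) :
    fderiv ℝ (extChartAt (𝓡∂ m) q₀ ∘ φ ∘ (extChartAt (𝓡∂ n) p₀).symm) (extChartAt (𝓡∂ n) p₀ p)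
      (chartDiff p₀ p v) = chartDiff q₀ (φ p) (flatDifferential φ p v) := by
  have h := (eventuallyEq_change_of_charts hp hφ hp₀ hq₀).fderiv_eq (𝕜 := ℝ)
  have hyy : (extChartAt (𝓡∂ n) p₀ ∘ (extChartAt (𝓡∂ n) p).symm) (extChartAt (𝓡∂ n) p p) =
      extChartAt (𝓡∂ n) p₀ p := by
    rw [Function.comp_apply, extChartAt_to_inv]
  have hfy : writtenInExtChartAt (𝓡∂ n) (𝓡∂ m) p φ (extChartAt (𝓡∂ n) p p) =
      extChartAt (𝓡∂ m) (φ p) (φ p) := by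
    rw [writtenInExtChartAt, Function.comp_apply, Function.comp_apply, extChartAt_to_inv]
  have hf : ContDiffAt ℝ ∞ (writtenInExtChartAt (𝓡∂ n) (𝓡∂ m) p φ) (extChartAt (𝓡∂ n) p p) :=
    contDiffAt_chart_of_interior hp hφ (mem_extChartAt_source p) (mem_extChartAt_source (φ p))
  have hfR : ∀ᶠ z in 𝓝 (extChartAt (𝓡∂ n) p p),
      writtenInExtChartAt (𝓡∂ n) (𝓡∂ m) p φ z ∈ range (𝓡∂ m) :=
    Eventually.of_forall fun z => mem_range_self _
  have hτ : ContDiffWithinAt ℝ ∞ (extChartAt (𝓡∂ m) q₀ ∘ (extChartAt (𝓡∂ m) (φ p)).symm)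
      (range (𝓡∂ m)) (writtenInExtChartAt (𝓡∂ n) (𝓡∂ m) p φ (extChartAt (𝓡∂ n) p p)) := by
    rw [hfy]
    exact contDiffWithinAt_transition (mem_extChartAt_target _) (by rwa [extChartAt_to_inv])
  rw [(eventually_fderiv_comp_fderivWithin hf hfR hτ).self_of_nhds, hfy,
    ← chartDiff_eq_fderivWithin hq₀, ← flatDifferential_eq_fderiv hp hφ,
    fderiv_comp _ (by
      rw [hyy]
      exact (contDiffAt_chart_of_interior hp hφ hp₀ hq₀).differentiableAt (by simp))
      ((contDiffAt_transition hp hp₀).differentiableAt (by simp)), hyy,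
    ← chartDiff_eq_fderiv hp hp₀] at h
  exact (DFunLike.congr_fun h v).symm

lemma chartMetric_chartDiff (g : Metric m M) {q x : M} (hx : x ∈ (extChartAt (𝓡∂ m) q).source)
    (v w : EuclideanSpace ℝ (Fin m)) :
    chartMetric g q (extChartAt (𝓡∂ m) q x) (chartDiff q x v) (chartDiff q x w) =
      flatMetric g x v w := by
  have h := chartMetric_change g (q := x) (q' := q) (mem_extChartAt_target x)
    (by rwa [extChartAt_to_inv]) v w
  rw [chartMetric_self, Function.comp_apply, extChartAt_to_inv, ← chartDiff_eq_fderivWithin hx] at h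
  exact h.symm

include hp hφ hp₀ hq₀ in
lemma chartMetric_fderiv_eq_zero_of_isNormal (g : Metric m M) {ν : EuclideanSpace ℝ (Fin m)}
    (hν : IsNormal (n := n) g φ p ν) (v : EuclideanSpace ℝ (Fin n)) :
    chartMetric g q₀ (extChartAt (𝓡∂ m) q₀ (φ p))
      (fderiv ℝ (extChartAt (𝓡∂ m) q₀ ∘ φ ∘ (extChartAt (𝓡∂ n) p₀).symm) (extChartAt (𝓡∂ n) p₀ p) v)
      (chartDiff q₀ (φ p) ν) = 0 := by
  obtain ⟨L, hL, -⟩ := exists_chartDiff_inverse (m := n) hp₀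
  rw [← hL v, fderiv_chart_chartDiff hp hφ hp₀ hq₀, chartMetric_chartDiff g hq₀]
  exact (isNormal_iff g φ p ν).1 hν (L v)

include hp hφ hp₀ hq₀ in
/-- The mean curvature in the direction of a normal vector can be computed in any charts. -/
theorem meanCurvature_eq_local (g : Metric m M) {ν : EuclideanSpace ℝ (Fin m)}
    (hν : IsNormal (n := n) g φ p ν) :
    meanCurvature (n := n) g φ p ν = localMeanCurvature (chartMetric g q₀) (range (𝓡∂ m))
      (extChartAt (𝓡∂ m) q₀ ∘ φ ∘ (extChartAt (𝓡∂ n) p₀).symm) (extChartAt (𝓡∂ n) p₀ p)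
      (chartDiff q₀ (φ p) ν) := by
  have hyy : (extChartAt (𝓡∂ n) p₀ ∘ (extChartAt (𝓡∂ n) p).symm) (extChartAt (𝓡∂ n) p p) =
      extChartAt (𝓡∂ n) p₀ p := by
    rw [Function.comp_apply, extChartAt_to_inv]
  have hfp : (extChartAt (𝓡∂ m) q₀ ∘ φ ∘ (extChartAt (𝓡∂ n) p₀).symm) (extChartAt (𝓡∂ n) p₀ p) =
      extChartAt (𝓡∂ m) q₀ (φ p) := by
    simp only [Function.comp_apply, (extChartAt (𝓡∂ n) p₀).left_inv hp₀]
  have hnorm := chartMetric_fderiv_eq_zero_of_isNormal hp hφ hp₀ hq₀ g hν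
  have hcomp := localMeanCurvature_comp_right (G := chartMetric g q₀) (R := range (𝓡∂ m))
    (contDiffAt_transition hp hp₀) (by
      rw [hyy]; exact contDiffAt_chart_of_interior hp hφ hp₀ hq₀) (ν := chartDiff q₀ (φ p) ν)
    (by rw [hyy, hfp]; exact hnorm)
    (L := (exists_chartDiff_inverse (m := n) hp₀).choose)
    (by
      rw [← chartDiff_eq_fderiv hp hp₀]
      exact (exists_chartDiff_inverse (m := n) hp₀).choose_spec.1)
  rw [hyy] at hcomp
  -- The change of parameters is absorbed by `hcomp`; both sides are now expressed through the
  -- preferred parametrization, and only invariance under the ambient transition map remains.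
  rw [meanCurvature_eq_local_self g hp hφ, ← hcomp,
    ← localMeanCurvature_congr (eventuallyEq_change_of_charts hp hφ hp₀ hq₀)]
  set f := writtenInExtChartAt (𝓡∂ n) (𝓡∂ m) p φ with hf
  set y := extChartAt (𝓡∂ n) p p with hy
  set τ := extChartAt (𝓡∂ m) q₀ ∘ (extChartAt (𝓡∂ m) (φ p)).symm with hτd
  have hfy : f y = extChartAt (𝓡∂ m) (φ p) (φ p) := by
    rw [hf, writtenInExtChartAt, Function.comp_apply, Function.comp_apply, hy, extChartAt_to_inv]
  have hft : f y ∈ (extChartAt (𝓡∂ m) (φ p)).target := hfy ▸ mem_extChartAt_target (φ p)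
  have hfs : (extChartAt (𝓡∂ m) (φ p)).symm (f y) ∈ (extChartAt (𝓡∂ m) q₀).source := by
    rwa [hfy, extChartAt_to_inv]
  have hτy : τ (f y) = extChartAt (𝓡∂ m) q₀ (φ p) := by
    rw [hfy, hτd, Function.comp_apply, extChartAt_to_inv]
  have hfc : ContDiffAt ℝ ∞ f y :=
    contDiffAt_chart_of_interior hp hφ (mem_extChartAt_source p) (mem_extChartAt_source (φ p))
  have hfR : ∀ᶠ z in 𝓝 y, f z ∈ range (𝓡∂ m) := Eventually.of_forall fun z => mem_range_self _
  have hτ : ContDiffWithinAt ℝ ∞ τ (range (𝓡∂ m)) (f y) := contDiffWithinAt_transition hft hfs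
  have hGG : ∀ᶠ x in 𝓝[range (𝓡∂ m)] (f y), ∀ v w, chartMetric g (φ p) x v w =
      chartMetric g q₀ (τ x) (fderivWithin ℝ τ (range (𝓡∂ m)) x v)
        (fderivWithin ℝ τ (range (𝓡∂ m)) x w) := by
    filter_upwards [eventually_mem_chart hft hfs] with z hz v w
    exact chartMetric_change g hz.1 hz.2 v w
  have hνd : chartDiff q₀ (φ p) ν = fderivWithin ℝ τ (range (𝓡∂ m)) (f y) ν := by
    rw [hfy, chartDiff_eq_fderivWithin hq₀]
  have h1 : localFirstForm (chartMetric g q₀) (τ ∘ f) y =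
      localFirstForm (chartMetric g (φ p)) f y := by
    funext v w
    rw [localFirstForm, localFirstForm,
      (eventually_fderiv_comp_fderivWithin hfc hfR hτ).self_of_nhds,
      hGG.self_of_nhdsWithin (mem_range_self _)]
    rfl
  have h2 : localSecondForm (chartMetric g q₀) (range (𝓡∂ m)) (τ ∘ f) y (chartDiff q₀ (φ p) ν) =
      localSecondForm (chartMetric g (φ p)) (range (𝓡∂ m)) f y ν := by
    funext v w
    rw [hνd]
    exact localSecondForm_comp_left (𝓡∂ m).uniqueDiffOn (𝓡∂ m).range_subset_closure_interior
      hfc hfR hτ (Eventually.of_forall fun z => mem_range_self _)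
      ((contDiffWithinAt_chartMetric g (by
        rw [hτy]; exact (extChartAt (𝓡∂ m) q₀).map_source hq₀)).differentiableWithinAt (by simp))
      (fun v w => chartMetric_symm g _ _ _ _) hGG
      ((contDiffWithinAt_chartMetric g hft).differentiableWithinAt (by simp)) ν v w
  rw [localMeanCurvature, localMeanCurvature, h1, h2]

end ChangeOfCharts

end Bridge
end FreeBoundary

namespace FreeBoundary

/-! ### Traces relative to a positive definite form. -/

section GramMatrix

variable {n : ℕ}

lemma det_gram_ne_zero {B : EuclideanSpace ℝ (Fin n) → EuclideanSpace ℝ (Fin n) → ℝ}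
    (hB : IsBilin B) (hpos : ∀ v ≠ 0, 0 < B v v) : (gram B).det ≠ 0 := by
  obtain ⟨b, hb⟩ := hB
  have h1 : gram B = LinearMap.toMatrix₂ (EuclideanSpace.basisFun (Fin n) ℝ).toBasis
      (EuclideanSpace.basisFun (Fin n) ℝ).toBasis b := by
    ext i j; simp [gram, hb, LinearMap.toMatrix₂_apply]
  rw [h1, ← LinearMap.separatingLeft_iff_det_ne_zero]
  intro v hv
  by_contra hne
  have h2 := hpos v hne
  rw [hb, hv v] at h2
  exact lt_irrefl _ h2

/-- This is the source of the dimension `n` in the conformal formula for the mean curvature. -/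
lemma relTrace_self {A : EuclideanSpace ℝ (Fin n) → EuclideanSpace ℝ (Fin n) → ℝ}
    (hA : IsBilin A) (hpos : ∀ v ≠ 0, 0 < A v v) (hsymm : ∀ v w, A v w = A w v) :
    relTrace A A = n := by
  have h1 : (gram A).transpose = gram A := by
    ext a b; exact hsymm _ _
  rw [relTrace_eq_trace, h1, Matrix.nonsing_inv_mul _ (det_gram_ne_zero hA hpos).isUnit,
    Matrix.trace_one, Fintype.card_fin]

/-- A conformal factor scales the induced metric and the second form alike. It cancels in the mean
curvature because the normal vector is not renormalized. -/
lemma relTrace_smul_smul {A B : EuclideanSpace ℝ (Fin n) → EuclideanSpace ℝ (Fin n) → ℝ}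
    (hA : (gram A).det ≠ 0) {c : ℝ} (hc : c ≠ 0) :
    relTrace (fun v w => c * A v w) (fun v w => c * B v w) = relTrace A B := by
  have h1 : gram (fun v w => c * A v w) = c • gram A := rfl
  have h2 : (c • gram A)⁻¹ = c⁻¹ • (gram A)⁻¹ := by
    let _ := invertibleOfNonzero hc
    rw [Matrix.inv_smul _ c hA.isUnit, invOf_eq_inv]
  simp only [relTrace, h1, h2, Matrix.smul_apply, smul_eq_mul]
  refine Finset.sum_congr rfl fun a _ => Finset.sum_congr rfl fun b _ => ?_
  field_simp

lemma relTrace_sub_mul (A B B' : EuclideanSpace ℝ (Fin n) → EuclideanSpace ℝ (Fin n) → ℝ) (c : ℝ) :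
    relTrace A (fun v w => B v w - c * B' v w) = relTrace A B - c * relTrace A B' := by
  simp only [relTrace, Finset.mul_sum, ← Finset.sum_sub_distrib]
  refine Finset.sum_congr rfl fun a _ => Finset.sum_congr rfl fun b _ => ?_
  ring

end GramMatrix

/-! ### Conformal change of the metric and of the mean curvature. -/

section Conformal

variable {m : ℕ} [NeZero m] {M : Type*} [TopologicalSpace M]
  [ChartedSpace (EuclideanHalfSpace m) M] [IsManifold (𝓡∂ m) ∞ M]

/-- The conformal metric `e^u g`. -/
noncomputable def conformalMetric (g : Metric m M) (u : M → ℝ)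
    (hu : ContMDiff (𝓡∂ m) 𝓘(ℝ, ℝ) ∞ u) : Metric m M where
  inner x := Real.exp (u x) • g.inner x
  symm x v w := congrArg (Real.exp (u x) * ·) (g.symm x v w)
  pos x v hv := mul_pos (Real.exp_pos _) (g.pos x v hv)
  isVonNBounded x := by
    -- The unit ball of `e^u g` is the unit ball of `g` scaled by `e^(-u/2)`.
    have h : Bornology.IsVonNBounded ℝ ((fun v : TangentSpace (𝓡∂ m) x =>
        Real.exp (-(u x) / 2) • v) '' {v | g.inner x v v < 1}) := (g.isVonNBounded x).image
      (Real.exp (-(u x) / 2) • ContinuousLinearMap.id ℝ (TangentSpace (𝓡∂ m) x))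
    refine h.subset ?_
    intro v hv
    refine ⟨Real.exp (u x / 2) • v, ?_, ?_⟩
    · have h1 : Real.exp (u x / 2) * Real.exp (u x / 2) = Real.exp (u x) := by
        rw [← Real.exp_add]; ring_nf
      have h2 : g.inner x (Real.exp (u x / 2) • v) (Real.exp (u x / 2) • v) =
          Real.exp (u x) * g.inner x v v := by
        rw [← h1]; simp; ring
      exact lt_of_eq_of_lt h2 hv
    · change Real.exp (-(u x) / 2) • Real.exp (u x / 2) • v = v
      rw [smul_smul, ← Real.exp_add]
      ring_nf
      simp
  contMDiff := by
    have h : ContMDiff (𝓡∂ m) 𝓘(ℝ, ℝ) ∞ (fun x => Real.exp (u x)) :=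
      Real.contDiff_exp.contMDiff.comp hu
    exact h.smul_section g.contMDiff

lemma flatMetric_conformal (g : Metric m M) {u : M → ℝ} (hu : ContMDiff (𝓡∂ m) 𝓘(ℝ, ℝ) ∞ u)
    (x : M) (v w : EuclideanSpace ℝ (Fin m)) :
    flatMetric (conformalMetric g u hu) x v w = Real.exp (u x) * flatMetric g x v w :=
  rfl

lemma metricInChart_conformal (g : Metric m M) {u : M → ℝ} (hu : ContMDiff (𝓡∂ m) 𝓘(ℝ, ℝ) ∞ u)
    (x : M) (y v w : EuclideanSpace ℝ (Fin m)) :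
    metricInChart (conformalMetric g u hu) x y v w =
      Real.exp (u ((extChartAt (𝓡∂ m) x).symm y)) * metricInChart g x y v w :=
  rfl

/-- The differential of a function, in preferred coordinates. -/
noncomputable def flatGradient (u : M → ℝ) (x : M) : EuclideanSpace ℝ (Fin m) →L[ℝ] ℝ :=
  mfderiv (𝓡∂ m) 𝓘(ℝ, ℝ) u x

lemma flatGradient_hasFDerivWithinAt {u : M → ℝ} (hu : ContMDiff (𝓡∂ m) 𝓘(ℝ, ℝ) ∞ u) (x : M) :
    HasFDerivWithinAt (u ∘ (extChartAt (𝓡∂ m) x).symm) (flatGradient u x) (range (𝓡∂ m))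
      (extChartAt (𝓡∂ m) x x) :=
  ((hu x).mdifferentiableAt (by simp)).hasMFDerivAt.2

lemma metricDeriv_conformal (g : Metric m M) {u : M → ℝ} (hu : ContMDiff (𝓡∂ m) 𝓘(ℝ, ℝ) ∞ u)
    (x : M) (a b c : EuclideanSpace ℝ (Fin m)) :
    metricDeriv (conformalMetric g u hu) x a b c =
      Real.exp (u x) * (metricDeriv g x a b c + flatGradient u x a * flatMetric g x b c) := by
  have h := (contDiffWithinAt_chartMetric g (mem_extChartAt_target (I := 𝓡∂ m) x)
    ).differentiableWithinAt (by simp)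
  have h1 : HasFDerivWithinAt (fun y => metricInChart g x y b c)
      (fderivWithin ℝ (fun y => metricInChart g x y b c) (range (𝓡∂ m)) (extChartAt (𝓡∂ m) x x))
      (range (𝓡∂ m)) (extChartAt (𝓡∂ m) x x) :=
    ((h.clm_apply (differentiableWithinAt_const b)).clm_apply
      (differentiableWithinAt_const c)).hasFDerivWithinAt
  have h2 := ((flatGradient_hasFDerivWithinAt hu x).exp).mul h1
  rw [metricDeriv, metricDeriv]
  have h3 : (fun y => metricInChart (conformalMetric g u hu) x y b c) = fun y =>
      Real.exp ((u ∘ (extChartAt (𝓡∂ m) x).symm) y) * metricInChart g x y b c := by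
    funext y; exact metricInChart_conformal g hu x y b c
  have h4 : metricInChart g x (extChartAt (𝓡∂ m) x x) b c = flatMetric g x b c :=
    chartMetric_self g x b c
  rw [h3]
  erw [HasFDerivWithinAt.fderivWithin h2 ((𝓡∂ m).uniqueDiffOn _ (mem_range_self _))]
  simp only [add_apply, smul_apply, smul_eq_mul, Function.comp_apply,
    extChartAt_to_inv, h4]
  ring

lemma christoffel_conformal (g : Metric m M) {u : M → ℝ} (hu : ContMDiff (𝓡∂ m) 𝓘(ℝ, ℝ) ∞ u)
    (x : M) (a b c : EuclideanSpace ℝ (Fin m)) :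
    christoffel (conformalMetric g u hu) x a b c =
      Real.exp (u x) * (christoffel g x a b c + (flatGradient u x a * flatMetric g x b c +
        flatGradient u x b * flatMetric g x a c - flatGradient u x c * flatMetric g x a b) / 2) := by
  simp only [christoffel, metricDeriv_conformal]
  ring

variable {n : ℕ} [NeZero n] {S : Type*} [TopologicalSpace S]
  [ChartedSpace (EuclideanHalfSpace n) S]

lemma isNormal_conformal_iff (g : Metric m M) {u : M → ℝ} (hu : ContMDiff (𝓡∂ m) 𝓘(ℝ, ℝ) ∞ u)
    (φ : S → M) (p : S) (ν : EuclideanSpace ℝ (Fin m)) :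
    IsNormal (n := n) (conformalMetric g u hu) φ p ν ↔ IsNormal (n := n) g φ p ν := by
  simp only [isNormal_iff, flatMetric_conformal, mul_eq_zero, (Real.exp_pos _).ne', false_or]

/-- The change of the mean curvature under a conformal change of the metric. -/
theorem meanCurvature_conformal (g : Metric m M) {u : M → ℝ} (hu : ContMDiff (𝓡∂ m) 𝓘(ℝ, ℝ) ∞ u)
    {φ : S → M} {p : S} (hinj : Function.Injective (mfderiv (𝓡∂ n) (𝓡∂ m) φ p))
    {ν : EuclideanSpace ℝ (Fin m)} (hν : IsNormal (n := n) g φ p ν) :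
    meanCurvature (n := n) (conformalMetric g u hu) φ p ν =
      meanCurvature (n := n) g φ p ν - flatGradient u (φ p) ν / 2 * n := by
  set A : EuclideanSpace ℝ (Fin n) → EuclideanSpace ℝ (Fin n) → ℝ := fun v w =>
    flatMetric g (φ p) (flatDifferential φ p v) (flatDifferential φ p w) with hA
  have hAb : IsBilin A := ⟨LinearMap.mk₂ ℝ A (by simp [hA]) (by simp [hA]) (by simp [hA])
    (by simp [hA]), fun _ _ => rfl⟩
  have hApos : ∀ v ≠ 0, 0 < A v v := fun v hv => by
    refine flatMetric_pos g (φ p) fun h => hv (hinj ?_)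
    exact h.trans (map_zero (flatDifferential φ p)).symm
  have hAsymm : ∀ v w, A v w = A w v := fun v w => flatMetric_symm g _ _ _
  have hB : ∀ v w : EuclideanSpace ℝ (Fin n), secondFundamentalForm (n := n) (conformalMetric g u hu) φ p ν v w =
      Real.exp (u (φ p)) * (secondFundamentalForm (n := n) g φ p ν v w -
        flatGradient u (φ p) ν / 2 * A v w) := by
    intro v w
    have h1 : ∀ v : EuclideanSpace ℝ (Fin n),
      flatMetric g (φ p) (flatDifferential φ p v) ν = 0 := (isNormal_iff g φ p ν).1 hν
    have h2 := christoffel_conformal g hu (φ p) (flatDifferential φ p v) (flatDifferential φ p w) ν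
    -- Normality removes the two mixed terms. What survives is `-du(ν)/2` times the induced metric,
    -- whose trace is `n`.
    rw [h1 v, h1 w] at h2
    unfold secondFundamentalForm
    have h3 : ∀ g' : Metric m M, christoffel g' (φ p) (differential φ p v) (differential φ p w) ν =
      christoffel g' (φ p) (flatDifferential φ p v) (flatDifferential φ p w) ν := fun _ => rfl
    rw [h3, h3, h2]
    set a : ℝ := flatMetric g (φ p) (coordHessian (n := n) (m := m) φ p v w) ν
    set b := christoffel g (φ p) (flatDifferential φ p v) (flatDifferential φ p w) ν
    change Real.exp (u (φ p)) * a + _ = Real.exp (u (φ p)) * (a + b - _ / 2 * flatMetric g (φ p)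
      (flatDifferential φ p v) (flatDifferential φ p w))
    ring
  have h1 : ∀ g' : Metric m M, meanCurvature (n := n) g' φ p ν =
      relTrace (fun v w => flatMetric g' (φ p) (flatDifferential φ p v) (flatDifferential φ p w))
        (fun v w => secondFundamentalForm (n := n) g' φ p ν v w) := fun _ => rfl
  rw [h1, h1]
  have h2 : (fun v w : EuclideanSpace ℝ (Fin n) =>
      secondFundamentalForm (n := n) (conformalMetric g u hu) φ p ν v w) = fun v w =>
      Real.exp (u (φ p)) * (secondFundamentalForm (n := n) g φ p ν v w -
        flatGradient u (φ p) ν / 2 * A v w) := funext₂ hB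
  rw [h2]
  simp only [flatMetric_conformal]
  refine (relTrace_smul_smul (A := A) (det_gram_ne_zero hAb hApos) (Real.exp_pos _).ne').trans ?_
  refine (relTrace_sub_mul A (fun v w => secondFundamentalForm (n := n) g φ p ν v w) A _).trans ?_
  rw [relTrace_self hAb hApos hAsymm]

end Conformal

/-! ### Smooth convergence of conformal metrics. -/

section Convergence

variable {m : ℕ} [NeZero m] {M : Type*} [TopologicalSpace M]
  [ChartedSpace (EuclideanHalfSpace m) M] [IsManifold (𝓡∂ m) ∞ M]

lemma ContMDiff.slice {U : ℝ × M → ℝ} (hU : ContMDiff (𝓘(ℝ, ℝ).prod (𝓡∂ m)) 𝓘(ℝ, ℝ) ∞ U) (s : ℝ) :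
    ContMDiff (𝓡∂ m) 𝓘(ℝ, ℝ) ∞ (fun x => U (s, x)) :=
  hU.comp (contMDiff_const.prodMk contMDiff_id)

/-- A jointly smooth family of conformal factors gives a smoothly convergent family of metrics. -/
theorem metricsConvergeSmoothly_conformal (g : Metric m M) {U : ℝ × M → ℝ}
    (hU : ContMDiff (𝓘(ℝ, ℝ).prod (𝓡∂ m)) 𝓘(ℝ, ℝ) ∞ U) (hU0 : ∀ x, U (0, x) = 0)
    {s : ℕ → ℝ} (hs : Tendsto s atTop (𝓝 0)) :
    MetricsConvergeSmoothly
      (fun i => conformalMetric g (fun x => U (s i, x)) (ContMDiff.slice hU (s i))) g := by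
  intro x K hK hKt k v w
  set Q : ℝ → EuclideanSpace ℝ (Fin m) → ℝ := fun t z =>
    Real.exp (U (t, (extChartAt (𝓡∂ m) x).symm z)) * metricInChart g x z v w with hQ
  have hQ0 : Q 0 = fun z => metricInChart g x z v w := by
    funext z; simp [hQ, hU0]
  have h1 : ∀ y ∈ K, ContDiffWithinAt ℝ ∞ (Function.uncurry Q) (univ ×ˢ range (𝓡∂ m)) (0, y) := by
    intro y hy
    have h2 : ContDiffWithinAt ℝ ∞ (fun z : ℝ × EuclideanSpace ℝ (Fin m) =>
        U (z.1, (extChartAt (𝓡∂ m) x).symm z.2)) (univ ×ˢ range (𝓡∂ m)) (0, y) := by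
      rw [← contMDiffWithinAt_iff_contDiffWithinAt]
      have h3 : ContMDiffWithinAt 𝓘(ℝ, ℝ × EuclideanSpace ℝ (Fin m)) (𝓘(ℝ, ℝ).prod (𝓡∂ m)) ∞
          (fun z : ℝ × EuclideanSpace ℝ (Fin m) => (z.1, (extChartAt (𝓡∂ m) x).symm z.2))
          (univ ×ˢ range (𝓡∂ m)) (0, y) := by
        refine (contDiff_fst.contMDiff _).contMDiffWithinAt.prodMk ?_
        exact ContMDiffWithinAt.comp (t := range (𝓡∂ m)) ((0 : ℝ), y)
          (contMDiffWithinAt_extChartAt_symm_range x (hKt hy))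
          (contDiff_snd.contMDiff _).contMDiffWithinAt (fun z hz => hz.2)
      exact (hU _).comp_contMDiffWithinAt _ h3
    have h4 : ContDiffWithinAt ℝ ∞ (fun z : ℝ × EuclideanSpace ℝ (Fin m) =>
        metricInChart g x z.2 v w) (univ ×ˢ range (𝓡∂ m)) (0, y) := by
      have h5 : ContDiffWithinAt ℝ ∞ (fun z => metricInChart g x z v w) (range (𝓡∂ m)) y :=
        ((contDiffWithinAt_chartMetric g (hKt hy)).clm_apply contDiffWithinAt_const).clm_apply
          contDiffWithinAt_const
      refine ContDiffWithinAt.comp (t := range (𝓡∂ m)) ((0 : ℝ), y) h5 contDiffWithinAt_snd ?_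
      exact fun z hz => hz.2
    exact h2.exp.mul h4
  have h2 := tendstoUniformlyOn_of_continuousWithinAt (Q := fun t y => iteratedFDerivWithin ℝ k
    (Q t) (range (𝓡∂ m)) y) (R := range (𝓡∂ m)) hK
    (hKt.trans (extChartAt_target_subset_range x)) (fun y hy =>
      (contDiffWithinAt_iteratedFDerivWithin_snd (𝓡∂ m).uniqueDiffOn
        (extChartAt_target_subset_range x (hKt hy)) (h1 y hy) k).continuousWithinAt) hs
  rw [hQ0] at h2
  exact h2

end Convergence
end FreeBoundary

namespace FreeBoundary

/-! ### Smooth dependence of inverse matrices and relative traces. -/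

section SmoothTrace

variable {n : ℕ} {X : Type*} [NormedAddCommGroup X] [NormedSpace ℝ X]

lemma contDiffAt_det {A : X → Matrix (Fin n) (Fin n) ℝ} {x : X}
    (hA : ∀ i j, ContDiffAt ℝ ∞ (fun x => A x i j) x) : ContDiffAt ℝ ∞ (fun x => (A x).det) x := by
  simp only [Matrix.det_apply]
  refine ContDiffAt.sum fun σ _ => ContDiffAt.const_smul _ ?_
  exact contDiffAt_prod fun i _ => hA _ _

lemma contDiffAt_matrix_inv {A : X → Matrix (Fin n) (Fin n) ℝ} {x : X}
    (hA : ∀ i j, ContDiffAt ℝ ∞ (fun x => A x i j) x) (hdet : (A x).det ≠ 0) (i j : Fin n) :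
    ContDiffAt ℝ ∞ (fun x => (A x)⁻¹ i j) x := by
  simp only [Matrix.inv_def, Ring.inverse_eq_inv', Matrix.smul_apply, smul_eq_mul,
    Matrix.adjugate_apply]
  refine ((contDiffAt_det hA).inv hdet).mul (contDiffAt_det fun k l => ?_)
  by_cases h : k = j
  · subst h
    simpa using contDiffAt_const
  · simpa [Matrix.updateRow_ne h] using hA k l

lemma contDiffAt_relTrace {A B : X → EuclideanSpace ℝ (Fin n) → EuclideanSpace ℝ (Fin n) → ℝ}
    {x : X} (hA : ∀ v w, ContDiffAt ℝ ∞ (fun x => A x v w) x)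
    (hB : ∀ v w, ContDiffAt ℝ ∞ (fun x => B x v w) x) (hdet : (gram (A x)).det ≠ 0) :
    ContDiffAt ℝ ∞ (fun x => relTrace (A x) (B x)) x := by
  simp only [relTrace]
  exact ContDiffAt.sum fun a _ => ContDiffAt.sum fun b _ =>
    (contDiffAt_matrix_inv (A := fun x => gram (A x)) (fun i j => hA _ _) hdet a b).mul (hB _ _)

/-- Contracting a bilinear form with its inverse gives the identity. -/
lemma relTrace_contract {A : EuclideanSpace ℝ (Fin n) → EuclideanSpace ℝ (Fin n) → ℝ}
    (hA : IsBilin A) (hsymm : ∀ v w, A v w = A w v) (hdet : (gram A).det ≠ 0)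
    (k : EuclideanSpace ℝ (Fin n) →ₗ[ℝ] ℝ) (w : EuclideanSpace ℝ (Fin n)) :
    relTrace A (fun a b => A a w * k b) = k w := by
  obtain ⟨b, hb⟩ := hA
  have hw : ∀ l : EuclideanSpace ℝ (Fin n) →ₗ[ℝ] ℝ,
      l w = ∑ c, w c * l (EuclideanSpace.single c 1) := by
    intro l
    conv_lhs => rw [← (EuclideanSpace.basisFun (Fin n) ℝ).sum_repr w]
    simp
  have h1 : (gram A) * (gram A)⁻¹ = 1 := Matrix.mul_nonsing_inv _ hdet.isUnit
  have h2 : ∀ c d, ∑ a, A (EuclideanSpace.single a 1) (EuclideanSpace.single c 1) * (gram A)⁻¹ a d =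
      (1 : Matrix (Fin n) (Fin n) ℝ) c d := by
    intro c d
    rw [← h1, Matrix.mul_apply]
    exact Finset.sum_congr rfl fun a _ => by rw [hsymm]; rfl
  calc relTrace A (fun a b => A a w * k b)
      = ∑ a, ∑ d, (gram A)⁻¹ a d * ((∑ c, w c *
          A (EuclideanSpace.single a 1) (EuclideanSpace.single c 1)) *
            k (EuclideanSpace.single d 1)) := by
        simp only [relTrace]
        refine Finset.sum_congr rfl fun a _ => Finset.sum_congr rfl fun d _ => ?_
        rw [hb, hw (b _)]
        simp only [hb]
    _ = ∑ d, ∑ c, w c * k (EuclideanSpace.single d 1) *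
          ∑ a, A (EuclideanSpace.single a 1) (EuclideanSpace.single c 1) * (gram A)⁻¹ a d := by
        rw [Finset.sum_comm]
        refine Finset.sum_congr rfl fun d _ => ?_
        simp only [Finset.sum_mul, Finset.mul_sum]
        rw [Finset.sum_comm]
        exact Finset.sum_congr rfl fun c _ => Finset.sum_congr rfl fun a _ => by ring
    _ = k w := by
        simp only [h2, Matrix.one_apply, mul_ite, mul_one, mul_zero, Finset.sum_ite_eq',
          Finset.mem_univ, if_true]
        exact (hw k).symm

end SmoothTrace

/-! ### The mean curvature covector and its smooth dependence on the parameter. -/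

section SmoothCurvature

lemma contDiffAt_comp_of_eventually_mem {E F H : Type*} [NormedAddCommGroup E] [NormedSpace ℝ E]
    [NormedAddCommGroup F] [NormedSpace ℝ F] [NormedAddCommGroup H] [NormedSpace ℝ H] {G : F → H}
    {f : E → F} {R : Set F} {z : E} (hG : ContDiffWithinAt ℝ ∞ G R (f z)) (hf : ContDiffAt ℝ ∞ f z)
    (hfR : ∀ᶠ z in 𝓝 z, f z ∈ R) : ContDiffAt ℝ ∞ (fun z => G (f z)) z :=
  (hG.comp z hf.contDiffWithinAt (mapsTo_preimage f R)).contDiffAt hfR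

lemma contDiffAt_fderiv_snd {E F : Type*} [NormedAddCommGroup E] [NormedSpace ℝ E]
    [NormedAddCommGroup F] [NormedSpace ℝ F] {f : ℝ × E → F} {z : ℝ × E}
    (hf : ContDiffAt ℝ ∞ f z) :
    ContDiffAt ℝ ∞ (fun z : ℝ × E => fderiv ℝ (fun y => f (z.1, y)) z.2) z := by
  refine ContDiffAt.fderiv (f := fun (z : ℝ × E) y => f (z.1, y)) (g := fun z => z.2) (n := ∞) ?_
    contDiffAt_snd (by simp)
  refine ContDiffAt.comp (g := f) (f := fun p : (ℝ × E) × E => (p.1.1, p.2)) (z, z.2) hf ?_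
  exact (contDiff_fst.fst.prodMk contDiff_snd).contDiffAt

variable {n m : ℕ}
  {G : EuclideanSpace ℝ (Fin m) → EuclideanSpace ℝ (Fin m) →L[ℝ] EuclideanSpace ℝ (Fin m) →L[ℝ] ℝ}
  {R : Set (EuclideanSpace ℝ (Fin m))}

lemma contDiffAt_localFirstForm {f : ℝ × EuclideanSpace ℝ (Fin n) → EuclideanSpace ℝ (Fin m)}
    {z : ℝ × EuclideanSpace ℝ (Fin n)} (hf : ContDiffAt ℝ ∞ f z) (hfR : ∀ᶠ z in 𝓝 z, f z ∈ R)
    (hG : ContDiffWithinAt ℝ ∞ G R (f z)) (v w : EuclideanSpace ℝ (Fin n)) :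
    ContDiffAt ℝ ∞ (fun z : ℝ × EuclideanSpace ℝ (Fin n) =>
      localFirstForm G (fun y => f (z.1, y)) z.2 v w) z := by
  have h1 := contDiffAt_fderiv_snd hf
  have h2 : ContDiffAt ℝ ∞ (fun z => G (f z)) z := contDiffAt_comp_of_eventually_mem hG hf hfR
  exact (h2.clm_apply (h1.clm_apply contDiffAt_const)).clm_apply (h1.clm_apply contDiffAt_const)

lemma contDiffAt_localMeanCurvature (hR : UniqueDiffOn ℝ R)
    {f : ℝ × EuclideanSpace ℝ (Fin n) → EuclideanSpace ℝ (Fin m)}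
    {z : ℝ × EuclideanSpace ℝ (Fin n)} (hf : ContDiffAt ℝ ∞ f z) (hfR : ∀ᶠ z in 𝓝 z, f z ∈ R)
    (hG : ContDiffWithinAt ℝ ∞ G R (f z))
    (hdet : (gram (localFirstForm G (fun y => f (z.1, y)) z.2)).det ≠ 0)
    {w : ℝ × EuclideanSpace ℝ (Fin n) → EuclideanSpace ℝ (Fin m)} (hw : ContDiffAt ℝ ∞ w z) :
    ContDiffAt ℝ ∞ (fun z : ℝ × EuclideanSpace ℝ (Fin n) =>
      localMeanCurvature G R (fun y => f (z.1, y)) z.2 (w z)) z := by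
  refine contDiffAt_relTrace (fun _ _ => contDiffAt_localFirstForm hf hfR hG _ _)
    (fun a b => ?_) hdet
  have h1 := contDiffAt_fderiv_snd hf
  have h2 : ContDiffAt ℝ ∞ (fun z => G (f z)) z := contDiffAt_comp_of_eventually_mem hG hf hfR
  have h3 := contDiffAt_comp_of_eventually_mem
    (hG.fderivWithin_right (m := ∞) hR (by simp) hfR.self_of_nhds) hf hfR
  have h4 := contDiffAt_fderiv_snd h1
  have ha := h1.clm_apply (contDiffAt_const (c := a))
  have hb := h1.clm_apply (contDiffAt_const (c := b))
  simp only [localSecondForm, localChristoffel]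
  refine ContDiffAt.add ((h2.clm_apply ((h4.clm_apply contDiffAt_const).clm_apply
    contDiffAt_const)).clm_apply hw) (ContDiffAt.div_const (ContDiffAt.sub (ContDiffAt.add ?_ ?_) ?_) _)
  · exact ((h3.clm_apply ha).clm_apply hb).clm_apply hw
  · exact ((h3.clm_apply hb).clm_apply ha).clm_apply hw
  · exact ((h3.clm_apply hw).clm_apply ha).clm_apply hb

variable (G R) in
/-- The mean curvature of a parametrized hypersurface in coordinates is linear in the normal. -/
noncomputable def localMeanCurvatureLinear
    (f : EuclideanSpace ℝ (Fin n) → EuclideanSpace ℝ (Fin m)) (y : EuclideanSpace ℝ (Fin n)) :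
    EuclideanSpace ℝ (Fin m) →ₗ[ℝ] ℝ where
  toFun := localMeanCurvature G R f y
  map_add' a b := by
    simp only [localMeanCurvature, relTrace, ← Finset.sum_add_distrib]
    refine Finset.sum_congr rfl fun i _ => Finset.sum_congr rfl fun j _ => ?_
    simp [localSecondForm, localChristoffel]
    ring
  map_smul' c a := by
    simp only [localMeanCurvature, relTrace, Finset.smul_sum]
    refine Finset.sum_congr rfl fun i _ => Finset.sum_congr rfl fun j _ => ?_
    simp [localSecondForm, localChristoffel]
    ring

variable (G R) in
/-- The mean curvature covector: it is the mean curvature on normal vectors, and it vanishes on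
tangent vectors. -/
noncomputable def meanCurvatureCovector
    (f : EuclideanSpace ℝ (Fin n) → EuclideanSpace ℝ (Fin m)) (y : EuclideanSpace ℝ (Fin n)) :
    EuclideanSpace ℝ (Fin m) →L[ℝ] ℝ :=
  LinearMap.toContinuousLinearMap
    -- The coordinate formula for `H` is linear in every `w`, normal or not. For a nondegenerate
    -- induced metric, the subtracted trace is `H` of the tangential part of `w`.
    { toFun := fun w => localMeanCurvature G R f y w - relTrace (localFirstForm G f y)
        (fun a b => G (f y) (fderiv ℝ f y a) w * localMeanCurvature G R f y (fderiv ℝ f y b))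
      map_add' := fun v w => by
        have h := (localMeanCurvatureLinear G R f y).map_add v w
        change localMeanCurvature G R f y (v + w) =
          localMeanCurvature G R f y v + localMeanCurvature G R f y w at h
        simp only [h, relTrace, map_add, add_mul, mul_add, Finset.sum_add_distrib]
        ring
      map_smul' := fun c w => by
        have h := (localMeanCurvatureLinear G R f y).map_smul c w
        change localMeanCurvature G R f y (c • w) = c • localMeanCurvature G R f y w at h
        simp only [h, relTrace, map_smul, smul_eq_mul, RingHom.id_apply, mul_sub, Finset.mul_sum]
        congr 1
        exact Finset.sum_congr rfl fun i _ => Finset.sum_congr rfl fun j _ => by ring }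

lemma meanCurvatureCovector_apply (f : EuclideanSpace ℝ (Fin n) → EuclideanSpace ℝ (Fin m))
    (y : EuclideanSpace ℝ (Fin n)) (w : EuclideanSpace ℝ (Fin m)) :
    meanCurvatureCovector G R f y w = localMeanCurvature G R f y w -
      relTrace (localFirstForm G f y) (fun a b => G (f y) (fderiv ℝ f y a) w *
        localMeanCurvature G R f y (fderiv ℝ f y b)) :=
  rfl

lemma meanCurvatureCovector_normal {f : EuclideanSpace ℝ (Fin n) → EuclideanSpace ℝ (Fin m)}
    {y : EuclideanSpace ℝ (Fin n)} {w : EuclideanSpace ℝ (Fin m)}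
    (hw : ∀ a, G (f y) (fderiv ℝ f y a) w = 0) :
    meanCurvatureCovector G R f y w = localMeanCurvature G R f y w := by
  rw [meanCurvatureCovector_apply]
  simp [hw, relTrace]

lemma meanCurvatureCovector_tangent {f : EuclideanSpace ℝ (Fin n) → EuclideanSpace ℝ (Fin m)}
    {y : EuclideanSpace ℝ (Fin n)} (hsymm : ∀ v w, G (f y) v w = G (f y) w v)
    (hdet : (gram (localFirstForm G f y)).det ≠ 0) (a : EuclideanSpace ℝ (Fin n)) :
    meanCurvatureCovector G R f y (fderiv ℝ f y a) = 0 := by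
  rw [meanCurvatureCovector_apply, sub_eq_zero]
  exact (relTrace_contract (isBilin_localFirstForm G f y) (fun v w => hsymm _ _) hdet
    ((localMeanCurvatureLinear G R f y).comp (fderiv ℝ f y).toLinearMap) a).symm

/-- If the mean curvature vanishes on normal vectors, then the covector vanishes. -/
lemma meanCurvatureCovector_eq_zero {f : EuclideanSpace ℝ (Fin n) → EuclideanSpace ℝ (Fin m)}
    {y : EuclideanSpace ℝ (Fin n)} (hsymm : ∀ v w, G (f y) v w = G (f y) w v)
    (hpos : ∀ v ≠ 0, 0 < localFirstForm G f y v v)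
    (hH : ∀ w, (∀ a, G (f y) (fderiv ℝ f y a) w = 0) → localMeanCurvature G R f y w = 0) :
    meanCurvatureCovector G R f y = 0 := by
  obtain ⟨b, hb⟩ := isBilin_localFirstForm G f y
  have hinj : Function.Injective b := by
    refine (injective_iff_map_eq_zero b).2 fun v hv => ?_
    by_contra hne
    have := hpos v hne
    rw [hb, hv] at this
    exact lt_irrefl _ this
  have hsurj : Function.Surjective b :=
    (LinearMap.injective_iff_surjective_of_finrank_eq_finrank
      (Subspace.dual_finrank_eq (K := ℝ) (V := EuclideanSpace ℝ (Fin n))).symm).1 hinj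
  ext w
  -- Since the induced metric is nondegenerate, the functional `G(w, df ·)` is represented by some
  -- `u`; then `df u` is the tangential projection of `w`.
  obtain ⟨u, hu⟩ := hsurj ((G (f y) w).toLinearMap.comp (fderiv ℝ f y).toLinearMap)
  have hnorm : ∀ a, G (f y) (fderiv ℝ f y a) (w - fderiv ℝ f y u) = 0 := by
    intro a
    have h1 : localFirstForm G f y u a = G (f y) w (fderiv ℝ f y a) := by
      rw [hb, hu]; rfl
    rw [map_sub, hsymm _ w, ← h1, localFirstForm, hsymm, sub_self]
  have h2 : w = (w - fderiv ℝ f y u) + fderiv ℝ f y u := by abel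
  rw [h2, map_add, meanCurvatureCovector_tangent hsymm
    (det_gram_ne_zero (isBilin_localFirstForm G f y) hpos), meanCurvatureCovector_normal hnorm,
    hH _ hnorm]
  simp

lemma contDiffAt_meanCurvatureCovector (hR : UniqueDiffOn ℝ R)
    {f : ℝ × EuclideanSpace ℝ (Fin n) → EuclideanSpace ℝ (Fin m)}
    {z : ℝ × EuclideanSpace ℝ (Fin n)} (hf : ContDiffAt ℝ ∞ f z) (hfR : ∀ᶠ z in 𝓝 z, f z ∈ R)
    (hG : ContDiffWithinAt ℝ ∞ G R (f z))
    (hdet : (gram (localFirstForm G (fun y => f (z.1, y)) z.2)).det ≠ 0)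
    {w : ℝ × EuclideanSpace ℝ (Fin n) → EuclideanSpace ℝ (Fin m)} (hw : ContDiffAt ℝ ∞ w z) :
    ContDiffAt ℝ ∞ (fun z : ℝ × EuclideanSpace ℝ (Fin n) =>
      meanCurvatureCovector G R (fun y => f (z.1, y)) z.2 (w z)) z := by
  have h1 := contDiffAt_fderiv_snd hf
  have h2 : ContDiffAt ℝ ∞ (fun z => G (f z)) z := contDiffAt_comp_of_eventually_mem hG hf hfR
  simp only [meanCurvatureCovector_apply]
  refine (contDiffAt_localMeanCurvature hR hf hfR hG hdet hw).sub (contDiffAt_relTrace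
    (fun _ _ => contDiffAt_localFirstForm hf hfR hG _ _) (fun a b => ContDiffAt.mul ?_ ?_) hdet)
  · exact (h2.clm_apply (h1.clm_apply contDiffAt_const)).clm_apply hw
  · exact contDiffAt_localMeanCurvature hR hf hfR hG hdet (h1.clm_apply contDiffAt_const)

end SmoothCurvature

/-! ### Smooth left inverses of a family of immersions. -/

section LeftInverse

variable {E F : Type*} [NormedAddCommGroup E] [NormedSpace ℝ E] [FiniteDimensional ℝ E]
  [NormedAddCommGroup F] [NormedSpace ℝ F] [FiniteDimensional ℝ F]

/-- A smooth family of immersions has, locally, a smooth family of left inverses. -/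
theorem exists_smooth_left_inverse {f : ℝ × E → F} {O : Set (ℝ × E)} (hO : IsOpen O)
    (hf : ∀ z ∈ O, ContDiffAt ℝ ∞ f z) {z₀ : ℝ × E} (hz₀ : z₀ ∈ O)
    (hinj : Function.Injective (fderiv ℝ (fun y => f (z₀.1, y)) z₀.2)) :
    ∃ (A : Set (ℝ × E)) (V : Set (ℝ × F)) (π : ℝ × F → E), IsOpen A ∧ z₀ ∈ A ∧ A ⊆ O ∧ IsOpen V ∧
      (∀ x ∈ V, ContDiffAt ℝ ∞ π x ∧ (x.1, π x) ∈ A) ∧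
      ∀ z ∈ A, (z.1, f z) ∈ V ∧ π (z.1, f z) = z.2 := by
  obtain ⟨L', hL'⟩ := (fderiv ℝ (fun y => f (z₀.1, y)) z₀.2).toLinearMap.exists_leftInverse_of_injective
    (LinearMap.ker_eq_bot.2 hinj)
  let L : F →L[ℝ] E := LinearMap.toContinuousLinearMap L'
  have hL : ∀ v, L (fderiv ℝ (fun y => f (z₀.1, y)) z₀.2 v) = v := fun v => DFunLike.congr_fun hL' v
  -- Composing with a linear left inverse `L` of the differential makes the parametrization locally
  -- invertible. The required `π(s, x)` is the second component of the inverse of `Θ` at `(s, L x)`.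
  let Θ : ℝ × E → ℝ × E := fun z => (z.1, L (f z))
  have hΘ : ∀ z ∈ O, ContDiffAt ℝ ∞ Θ z := fun z hz =>
    contDiffAt_fst.prodMk (L.contDiff.contDiffAt.comp z (hf z hz))
  have hΘ' : ∀ z ∈ O, HasFDerivAt Θ
      ((ContinuousLinearMap.fst ℝ ℝ E).prod (L.comp (fderiv ℝ f z))) z := fun z hz =>
    hasFDerivAt_fst.prodMk (L.hasFDerivAt.comp z ((hf z hz).differentiableAt (by simp)).hasFDerivAt)
  have hpart : ∀ v, fderiv ℝ (fun y => f (z₀.1, y)) z₀.2 v = fderiv ℝ f z₀ (0, v) := by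
    intro v
    have h1 : HasFDerivAt (fun y : E => (z₀.1, y)) (ContinuousLinearMap.inr ℝ ℝ E) z₀.2 :=
      hasFDerivAt_prodMk_right _ _
    have h2 : HasFDerivAt (fun y => f (z₀.1, y)) ((fderiv ℝ f z₀).comp
        (ContinuousLinearMap.inr ℝ ℝ E)) z₀.2 :=
      HasFDerivAt.comp (g := f) z₀.2 ((hf z₀ hz₀).differentiableAt (by simp)).hasFDerivAt h1
    rw [h2.fderiv]; rfl
  have hinj' : Function.Injective ((ContinuousLinearMap.fst ℝ ℝ E).prod (L.comp (fderiv ℝ f z₀))) := by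
    refine (injective_iff_map_eq_zero _).2 ?_
    rintro ⟨a, v⟩ h
    have ha : a = 0 := congrArg Prod.fst h
    subst ha
    have hv : L (fderiv ℝ f z₀ (0, v)) = 0 := congrArg Prod.snd h
    rw [← hpart, hL] at hv
    rw [hv]; rfl
  let e₀ : (ℝ × E) ≃L[ℝ] ℝ × E :=
    (LinearEquiv.ofInjectiveEndo _ hinj').toContinuousLinearEquiv
  have he₀ : HasFDerivAt Θ (e₀ : ℝ × E →L[ℝ] ℝ × E) z₀ := by
    convert hΘ' z₀ hz₀ using 1
    exact ContinuousLinearMap.ext fun v => rfl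
  let Φ := (hΘ z₀ hz₀).toOpenPartialHomeomorph Θ he₀ (by simp)
  have hΦ : ∀ z, Φ z = Θ z := fun z => rfl
  have hcont : ContinuousOn (fderiv ℝ Θ) O := fun z hz =>
    ((hΘ z hz).fderiv_right (m := ∞) (by simp)).continuousAt.continuousWithinAt
  -- Smoothness of the inverse is needed at every point, not only at the image of `z₀`, so the
  -- domain is restricted to the open set where the derivative of `Θ` is invertible.
  let A := Φ.source ∩ (O ∩ fderiv ℝ Θ ⁻¹' (range ((↑) : ((ℝ × E) ≃L[ℝ] ℝ × E) → _)))
  have hA : IsOpen A := Φ.open_source.inter (hcont.isOpen_inter_preimage hO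
    (ContinuousLinearEquiv.isOpen))
  have hlin : Continuous (fun x : ℝ × F => (x.1, L x.2)) := by fun_prop
  refine ⟨A, (fun x : ℝ × F => (x.1, L x.2)) ⁻¹' (Φ.target ∩ Φ.symm ⁻¹' A),
    fun x => (Φ.symm (x.1, L x.2)).2, hA, ⟨ContDiffAt.mem_toOpenPartialHomeomorph_source _ _ _, hz₀,
      e₀, he₀.fderiv.symm⟩, fun z hz => hz.2.1, ?_, ?_, ?_⟩
  · exact (Φ.symm.continuousOn.isOpen_inter_preimage Φ.symm.open_source hA).preimage hlin
  · rintro x ⟨hx1, hx2⟩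
    obtain ⟨e, he⟩ := hx2.2.2
    have hd : HasFDerivAt Φ (e : ℝ × E →L[ℝ] ℝ × E) (Φ.symm (x.1, L x.2)) := by
      rw [he]
      exact ((hΘ _ hx2.2.1).differentiableAt (by simp)).hasFDerivAt
    have h1 : ContDiffAt ℝ ∞ Φ.symm (x.1, L x.2) := Φ.contDiffAt_symm hx1 hd (hΘ _ hx2.2.1)
    refine ⟨?_, ?_⟩
    · refine (ContDiffAt.comp x h1 (f := fun x : ℝ × F => (x.1, L x.2)) ?_).snd
      exact (contDiff_fst.prodMk (L.contDiff.comp contDiff_snd)).contDiffAt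
    · have h2 : (Φ.symm (x.1, L x.2)).1 = x.1 := congrArg Prod.fst (Φ.right_inv hx1)
      rw [← h2]
      exact hx2
  · intro z hz
    have h1 : Φ.symm (z.1, L (f z)) = z := Φ.left_inv hz.1
    refine ⟨⟨Φ.map_source hz.1, ?_⟩, congrArg Prod.snd h1⟩
    change Φ.symm (z.1, L (f z)) ∈ A
    rw [h1]
    exact hz

end LeftInverse
end FreeBoundary

namespace FreeBoundary

/-! ### The mean curvature covector of a map between manifolds, in charts. -/

section ChartCurvature

variable {n m : ℕ} [NeZero n] [NeZero m]
  {S : Type*} [TopologicalSpace S] [ChartedSpace (EuclideanHalfSpace n) S] [IsManifold (𝓡∂ n) ∞ S]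
  {M : Type*} [TopologicalSpace M] [ChartedSpace (EuclideanHalfSpace m) M] [IsManifold (𝓡∂ m) ∞ M]

lemma chartMetric_pos (g : Metric m M) {q x : M} (hx : x ∈ (extChartAt (𝓡∂ m) q).source)
    {w : EuclideanSpace ℝ (Fin m)} (hw : w ≠ 0) :
    0 < chartMetric g q (extChartAt (𝓡∂ m) q x) w w := by
  obtain ⟨L, hL, -⟩ := exists_chartDiff_inverse hx
  have h := chartMetric_chartDiff g hx (L w) (L w)
  rw [hL] at h
  rw [h]
  refine flatMetric_pos g x fun h0 => hw ?_
  rw [← hL w, h0, map_zero]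

variable {φ : S → M} {p p₀ : S} {q₀ : M} (hp : p ∈ (𝓡∂ n).interior S)
  (hφ : ContMDiffAt (𝓡∂ n) (𝓡∂ m) ∞ φ p)
  (hp₀ : p ∈ (extChartAt (𝓡∂ n) p₀).source) (hq₀ : φ p ∈ (extChartAt (𝓡∂ m) q₀).source)

include hp hφ hp₀ hq₀ in
lemma fderiv_chart_injective (hinj : Function.Injective (mfderiv (𝓡∂ n) (𝓡∂ m) φ p)) :
    Function.Injective (fderiv ℝ (extChartAt (𝓡∂ m) q₀ ∘ φ ∘ (extChartAt (𝓡∂ n) p₀).symm)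
      (extChartAt (𝓡∂ n) p₀ p)) := by
  refine (injective_iff_map_eq_zero _).2 fun v hv => ?_
  obtain ⟨L, hL, -⟩ := exists_chartDiff_inverse (m := n) hp₀
  obtain ⟨L', -, hL'⟩ := exists_chartDiff_inverse (m := m) hq₀
  rw [← hL v, fderiv_chart_chartDiff hp hφ hp₀ hq₀] at hv
  have h1 := congrArg L' hv
  rw [hL', map_zero] at h1
  have h2 : L v = 0 := hinj (h1.trans (map_zero (flatDifferential φ p)).symm)
  rw [← hL v, h2, map_zero]

include hp hφ hp₀ hq₀ in
lemma localFirstForm_chart_pos (g : Metric m M)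
    (hinj : Function.Injective (mfderiv (𝓡∂ n) (𝓡∂ m) φ p)) {v : EuclideanSpace ℝ (Fin n)}
    (hv : v ≠ 0) : 0 < localFirstForm (chartMetric g q₀)
      (extChartAt (𝓡∂ m) q₀ ∘ φ ∘ (extChartAt (𝓡∂ n) p₀).symm) (extChartAt (𝓡∂ n) p₀ p) v v := by
  simp only [localFirstForm, Function.comp_apply, (extChartAt (𝓡∂ n) p₀).left_inv hp₀]
  refine chartMetric_pos g hq₀ fun h0 => hv ?_
  exact fderiv_chart_injective hp hφ hp₀ hq₀ hinj (h0.trans (map_zero _).symm)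

include hp hφ hp₀ hq₀ in
lemma meanCurvatureCovector_chart (g : Metric m M) {ν : EuclideanSpace ℝ (Fin m)}
    (hν : IsNormal (n := n) g φ p ν) :
    meanCurvatureCovector (chartMetric g q₀) (range (𝓡∂ m))
      (extChartAt (𝓡∂ m) q₀ ∘ φ ∘ (extChartAt (𝓡∂ n) p₀).symm) (extChartAt (𝓡∂ n) p₀ p)
      (chartDiff q₀ (φ p) ν) = meanCurvature (n := n) g φ p ν := by
  rw [meanCurvature_eq_local hp hφ hp₀ hq₀ g hν, meanCurvatureCovector_normal]
  intro a
  have h := chartMetric_fderiv_eq_zero_of_isNormal hp hφ hp₀ hq₀ g hν a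
  simpa only [Function.comp_apply, (extChartAt (𝓡∂ n) p₀).left_inv hp₀] using h

include hp hφ hp₀ hq₀ in
lemma meanCurvatureCovector_chart_eq_zero (g : Metric m M)
    (hinj : Function.Injective (mfderiv (𝓡∂ n) (𝓡∂ m) φ p))
    (hH : ∀ ν : EuclideanSpace ℝ (Fin m), IsNormal (n := n) g φ p ν →
      meanCurvature (n := n) g φ p ν = 0) :
    meanCurvatureCovector (chartMetric g q₀) (range (𝓡∂ m))
      (extChartAt (𝓡∂ m) q₀ ∘ φ ∘ (extChartAt (𝓡∂ n) p₀).symm) (extChartAt (𝓡∂ n) p₀ p) = 0 := by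
  have hfp : (extChartAt (𝓡∂ m) q₀ ∘ φ ∘ (extChartAt (𝓡∂ n) p₀).symm) (extChartAt (𝓡∂ n) p₀ p) =
      extChartAt (𝓡∂ m) q₀ (φ p) := by
    simp only [Function.comp_apply, (extChartAt (𝓡∂ n) p₀).left_inv hp₀]
  refine meanCurvatureCovector_eq_zero (fun v w => chartMetric_symm g _ _ _ _)
    (fun v hv => localFirstForm_chart_pos hp hφ hp₀ hq₀ g hinj hv) fun w hw => ?_
  obtain ⟨L, hL, -⟩ := exists_chartDiff_inverse (m := m) hq₀
  have hν : IsNormal (n := n) g φ p (L w) := by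
    refine (isNormal_iff g φ p (L w)).2 fun v => ?_
    have h := hw (chartDiff p₀ p v)
    rw [fderiv_chart_chartDiff hp hφ hp₀ hq₀, hfp, ← hL w, chartMetric_chartDiff g hq₀] at h
    exact h
  have h := meanCurvature_eq_local hp hφ hp₀ hq₀ g hν
  rw [hL, hH _ hν] at h
  exact h.symm

end ChartCurvature

/-! ### Local construction of the conformal factor. -/

section LocalFactor

lemma contDiffAt_clm_of_apply {m : ℕ} {X : Type*} [NormedAddCommGroup X] [NormedSpace ℝ X]
    {B : X → EuclideanSpace ℝ (Fin m) →L[ℝ] ℝ} {x : X}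
    (hB : ∀ w, ContDiffAt ℝ ∞ (fun x => B x w) x) : ContDiffAt ℝ ∞ B x := by
  have h : B = fun x => ∑ c : Fin m, B x (EuclideanSpace.single c 1) •
      (EuclideanSpace.proj c : EuclideanSpace ℝ (Fin m) →L[ℝ] ℝ) := by
    funext x
    ext w
    conv_lhs => rw [← (EuclideanSpace.basisFun (Fin m) ℝ).sum_repr w]
    simp [mul_comm]
  rw [h]
  exact ContDiffAt.sum fun c _ => (hB _).smul contDiffAt_const

/-- The derivative of `a * B N` at a zero of `N`. -/
lemma hasFDerivAt_mul_clm_apply_of_eq_zero {E F : Type*} [NormedAddCommGroup E] [NormedSpace ℝ E]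
    [NormedAddCommGroup F] [NormedSpace ℝ F] {a : E → ℝ} {B : E → F →L[ℝ] ℝ} {N : E → F}
    {N' : E →L[ℝ] F} {x : E} (ha : DifferentiableAt ℝ a x) (hB : DifferentiableAt ℝ B x)
    (hN : HasFDerivAt N N' x) (h0 : N x = 0) :
    HasFDerivAt (fun x => a x * B x (N x)) (a x • (B x).comp N') x := by
  have h := ha.hasFDerivAt.mul (hB.hasFDerivAt.clm_apply hN)
  refine h.congr_fderiv ?_
  ext w
  simp [h0]

/-- A function with prescribed derivative along a family of parametrized hypersurfaces. -/
theorem exists_factor_along_family {n m : ℕ}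
    {G : EuclideanSpace ℝ (Fin m) → EuclideanSpace ℝ (Fin m) →L[ℝ] EuclideanSpace ℝ (Fin m) →L[ℝ] ℝ}
    {R : Set (EuclideanSpace ℝ (Fin m))} (hR : UniqueDiffOn ℝ R)
    {f : ℝ × EuclideanSpace ℝ (Fin n) → EuclideanSpace ℝ (Fin m)}
    {O : Set (ℝ × EuclideanSpace ℝ (Fin n))} (hO : IsOpen O)
    (hfz : ∀ z ∈ O, ContDiffAt ℝ ∞ f z) (hfR : ∀ z, f z ∈ R)
    (hGf : ∀ z ∈ O, ContDiffWithinAt ℝ ∞ G R (f z)) (hsymm : ∀ x v w, G x v w = G x w v)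
    (hpos : ∀ z ∈ O, ∀ v ≠ 0, 0 < localFirstForm G (fun y => f (z.1, y)) z.2 v v)
    (hzero : ∀ z ∈ O, z.1 = 0 → meanCurvatureCovector G R (fun y => f (z.1, y)) z.2 = 0)
    {z₀ : ℝ × EuclideanSpace ℝ (Fin n)} (hz₀ : z₀ ∈ O)
    (hinj : Function.Injective (fderiv ℝ (fun y => f (z₀.1, y)) z₀.2)) :
    ∃ (A : Set (ℝ × EuclideanSpace ℝ (Fin n))) (V : Set (ℝ × EuclideanSpace ℝ (Fin m))),
      IsOpen A ∧ z₀ ∈ A ∧ A ⊆ O ∧ IsOpen V ∧ (∀ z ∈ A, (z.1, f z) ∈ V) ∧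
      ∀ ζ : EuclideanSpace ℝ (Fin n) → ℝ, (∀ z ∈ O, ContDiffAt ℝ ∞ ζ z.2) →
        ∃ W : ℝ × EuclideanSpace ℝ (Fin m) → ℝ, (∀ x ∈ V, ContDiffAt ℝ ∞ W x) ∧
          (∀ x, (0, x) ∈ V → W (0, x) = 0) ∧
          ∀ z ∈ A, W (z.1, f z) = 0 ∧ HasFDerivAt (fun x => W (z.1, x))
            (ζ z.2 • meanCurvatureCovector G R (fun y => f (z.1, y)) z.2) (f z) := by
  have hdet : ∀ z ∈ O, (gram (localFirstForm G (fun y => f (z.1, y)) z.2)).det ≠ 0 :=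
    fun z hz => det_gram_ne_zero (isBilin_localFirstForm _ _ _) (hpos z hz)
  obtain ⟨A, V, π, hA, hz₀A, hAO, hV, hVπ, hAV⟩ := exists_smooth_left_inverse hO hfz hz₀ hinj
  refine ⟨A, V, hA, hz₀A, hAO, hV, fun z hz => (hAV z hz).1, fun ζ hζ => ?_⟩
  have hcov : ∀ z ∈ O, ContDiffAt ℝ ∞ (fun z : ℝ × EuclideanSpace ℝ (Fin n) =>
      meanCurvatureCovector G R (fun y => f (z.1, y)) z.2) z := fun z hz =>
    contDiffAt_clm_of_apply fun w => contDiffAt_meanCurvatureCovector hR (hfz z hz)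
      (Eventually.of_forall hfR) (hGf z hz) (hdet z hz) contDiffAt_const
  obtain ⟨κ, hκ⟩ : ∃ κ : ℝ × EuclideanSpace ℝ (Fin n) → EuclideanSpace ℝ (Fin m) →L[ℝ] ℝ,
      ∀ z, κ z = meanCurvatureCovector G R (fun y => f (z.1, y)) z.2 := ⟨_, fun _ => rfl⟩
  simp only [← hκ] at hcov hzero ⊢
  have hpair : ∀ x ∈ V, ContDiffAt ℝ ∞ (fun x => (x.1, π x)) x := fun x hx =>
    contDiffAt_fst.prodMk (hVπ x hx).1
  have hVO : ∀ x ∈ V, (x.1, π x) ∈ O := fun x hx => hAO (hVπ x hx).2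
  have hζπ : ∀ x ∈ V, ContDiffAt ℝ ∞ (fun x => ζ (π x)) x := fun x hx =>
    ContDiffAt.comp x (g := ζ) (hζ _ (hVO x hx)) (hVπ x hx).1
  have hcovπ : ∀ x ∈ V, ContDiffAt ℝ ∞ (fun x => κ (x.1, π x)) x := fun x hx =>
    ContDiffAt.comp x (g := κ) (hcov _ (hVO x hx)) (hpair x hx)
  have hfπ : ∀ x ∈ V, ContDiffAt ℝ ∞ (fun x => f (x.1, π x)) x :=
    fun x hx => ContDiffAt.comp x (g := f) (hfz _ (hVO x hx)) (hpair x hx)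
  -- The vector `x.2 - f (x.1, π x)` vanishes on the hypersurface, so only its own derivative
  -- contributes there. At parameter `0` the function vanishes identically because the covector `κ`
  -- does.
  refine ⟨fun x => ζ (π x) * κ (x.1, π x) (x.2 - f (x.1, π x)), fun x hx =>
    (hζπ x hx).mul ((hcovπ x hx).clm_apply (contDiffAt_snd.sub (hfπ x hx))), fun x hx => ?_,
    fun z hz => ?_⟩
  · simp only [hzero _ (hVO _ hx) rfl]
    simp
  obtain ⟨hx, hπz⟩ := hAV z hz
  have hin : ContDiffAt ℝ ∞ (fun x : EuclideanSpace ℝ (Fin m) => (z.1, x)) (f z) :=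
    contDiffAt_const.prodMk contDiffAt_id
  have hπd : DifferentiableAt ℝ (fun x => π (z.1, x)) (f z) :=
    (ContDiffAt.comp (f z) (g := π) (hVπ _ hx).1 hin).differentiableAt (by simp)
  have hfd : DifferentiableAt ℝ (fun y => f (z.1, y)) z.2 :=
    (ContDiffAt.comp z.2 (g := f) (f := fun y => (z.1, y)) (hfz z (hAO hz))
      (contDiffAt_const.prodMk contDiffAt_id)).differentiableAt (by simp)
  have hN : HasFDerivAt (fun x => x - f (z.1, π (z.1, x))) (ContinuousLinearMap.id ℝ _ -
      (fderiv ℝ (fun y => f (z.1, y)) z.2).comp (fderiv ℝ (fun x => π (z.1, x)) (f z))) (f z) := by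
    refine (hasFDerivAt_id _).sub ?_
    refine HasFDerivAt.comp (f z) (g := fun y => f (z.1, y)) (f := fun x => π (z.1, x)) ?_
      hπd.hasFDerivAt
    simp only [hπz]
    exact hfd.hasFDerivAt
  have h0 : f z - f (z.1, π (z.1, f z)) = 0 := by rw [hπz, sub_self]
  refine ⟨by simp only [h0, map_zero, mul_zero], ?_⟩
  have h := hasFDerivAt_mul_clm_apply_of_eq_zero
    (a := fun x => ζ (π (z.1, x))) (B := fun x => κ (z.1, π (z.1, x)))
    ((ContDiffAt.comp (f z) (g := fun x => ζ (π x)) (hζπ _ hx) hin).differentiableAt (by simp))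
    ((ContDiffAt.comp (f z) (g := fun x : ℝ × EuclideanSpace ℝ (Fin m) => κ (x.1, π x))
      (hcovπ _ hx) hin).differentiableAt
      (by simp)) hN h0
  refine h.congr_fderiv ?_
  ext w
  -- The derivative of `x - f(s, π(s, x))` is the identity minus a map into the tangent space; `κ`
  -- kills the latter, leaving `ζ κ`.
  have ht : κ z (fderiv ℝ (fun y => f (z.1, y)) z.2 (fderiv ℝ (fun x => π (z.1, x)) (f z) w)) = 0 := by
    rw [hκ]
    exact meanCurvatureCovector_tangent (fun v w => hsymm _ v w) (hdet z (hAO hz)) _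
  simp only [hπz, smul_apply, ContinuousLinearMap.comp_apply,
    sub_apply, ContinuousLinearMap.id_apply, map_sub]
  rw [ht, sub_zero]

variable {n m : ℕ} [NeZero n] [NeZero m]
  {S : Type*} [TopologicalSpace S] [ChartedSpace (EuclideanHalfSpace n) S] [IsManifold (𝓡∂ n) ∞ S]
  {M : Type*} [TopologicalSpace M] [ChartedSpace (EuclideanHalfSpace m) M] [IsManifold (𝓡∂ m) ∞ M]

/-- The family `F` in charts. -/
noncomputable def chartFamily (F : ℝ × S → M) (p₀ : S) (q₀ : M)
    (z : ℝ × EuclideanSpace ℝ (Fin n)) : EuclideanSpace ℝ (Fin m) :=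
  extChartAt (𝓡∂ m) q₀ (F (z.1, (extChartAt (𝓡∂ n) p₀).symm z.2))

/-- The domain on which `chartFamily F p₀ q₀` is considered. -/
def chartFamilyDomain (F : ℝ × S → M) (p₀ : S) (q₀ : M) : Set (ℝ × EuclideanSpace ℝ (Fin n)) :=
  {z | z.2 ∈ interior (extChartAt (𝓡∂ n) p₀).target ∧
    F (z.1, (extChartAt (𝓡∂ n) p₀).symm z.2) ∈ (extChartAt (𝓡∂ m) q₀).source}

lemma isOpen_chartFamilyDomain {F : ℝ × S → M} (hF : Continuous F) (p₀ : S) (q₀ : M) :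
    IsOpen (chartFamilyDomain (n := n) (m := m) F p₀ q₀) := by
  have h1 : ContinuousOn (fun z : ℝ × EuclideanSpace ℝ (Fin n) =>
      F (z.1, (extChartAt (𝓡∂ n) p₀).symm z.2))
      (Prod.snd ⁻¹' interior (extChartAt (𝓡∂ n) p₀).target) :=
    hF.comp_continuousOn (continuous_fst.continuousOn.prodMk
      ((continuousOn_extChartAt_symm p₀).comp continuous_snd.continuousOn
        fun z hz => interior_subset hz))
  exact h1.isOpen_inter_preimage (isOpen_interior.preimage continuous_snd)
    (isOpen_extChartAt_source q₀)

lemma mem_interior_of_mem_interior_target {p₀ : S} {y : EuclideanSpace ℝ (Fin n)}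
    (hy : y ∈ interior (extChartAt (𝓡∂ n) p₀).target) :
    (extChartAt (𝓡∂ n) p₀).symm y ∈ (𝓡∂ n).interior S := by
  have hy' := interior_subset hy
  rw [mem_interior_iff_coord_pos ((extChartAt (𝓡∂ n) p₀).map_target hy'),
    (extChartAt (𝓡∂ n) p₀).right_inv hy']
  have h := interior_mono (extChartAt_target_subset_range p₀) hy
  rw [interior_range_modelWithCornersEuclideanHalfSpace] at h
  exact h

lemma mem_interior_target {p p₀ : S} (hp : p ∈ (𝓡∂ n).interior S)
    (hp₀ : p ∈ (extChartAt (𝓡∂ n) p₀).source) :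
    extChartAt (𝓡∂ n) p₀ p ∈ interior (extChartAt (𝓡∂ n) p₀).target := by
  rw [mem_interior_iff_mem_nhds]
  have h := extChartAt_target_mem_nhdsWithin_of_mem ((extChartAt (𝓡∂ n) p₀).map_source hp₀)
  rwa [nhdsWithin_eq_nhds.2 (range_mem_nhds_of_mem_interior hp hp₀)] at h

lemma contDiffAt_chartFamily {F : ℝ × S → M}
    (hF : ContMDiff (𝓘(ℝ, ℝ).prod (𝓡∂ n)) (𝓡∂ m) ∞ F) {p₀ : S} {q₀ : M}
    {z : ℝ × EuclideanSpace ℝ (Fin n)} (hz : z ∈ chartFamilyDomain (n := n) (m := m) F p₀ q₀) :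
    ContDiffAt ℝ ∞ (chartFamily (n := n) (m := m) F p₀ q₀) z := by
  have hz1 := interior_subset hz.1
  have h := contDiffWithinAt_chart_family (s := z.1) (hF (z.1, (extChartAt (𝓡∂ n) p₀).symm z.2))
    ((extChartAt (𝓡∂ n) p₀).map_target hz1) hz.2
  rw [(extChartAt (𝓡∂ n) p₀).right_inv hz1] at h
  refine h.contDiffAt (prod_mem_nhds univ_mem ?_)
  exact mem_of_superset (mem_interior_iff_mem_nhds.1 hz.1) (extChartAt_target_subset_range p₀)

/-- The gradient of a product `χ * (W ∘ chart)` at a zero of the second factor. -/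
lemma flatGradient_mul_chart {χ : M → ℝ} {W : EuclideanSpace ℝ (Fin m) → ℝ} {q x : M}
    (hx : x ∈ (extChartAt (𝓡∂ m) q).source) (hχ : ContMDiffAt (𝓡∂ m) 𝓘(ℝ, ℝ) ∞ χ x)
    {W' : EuclideanSpace ℝ (Fin m) →L[ℝ] ℝ} (hW : HasFDerivAt W W' (extChartAt (𝓡∂ m) q x))
    (h0 : W (extChartAt (𝓡∂ m) q x) = 0) (ν : EuclideanSpace ℝ (Fin m)) :
    flatGradient (fun x => χ x * W (extChartAt (𝓡∂ m) q x)) x ν = χ x * W' (chartDiff q x ν) := by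
  have hd1 : HasMFDerivAt (𝓡∂ m) 𝓘(ℝ, ℝ) (fun x => W (extChartAt (𝓡∂ m) q x)) x
      (W'.comp (chartDiff q x)) :=
    HasMFDerivAt.comp x hW.hasMFDerivAt
      ((contMDiffAt_extChartAt' (n := ∞) (by simpa using hx)).mdifferentiableAt
        (by simp)).hasMFDerivAt
  have hd := ((hχ.mdifferentiableAt (by simp)).hasMFDerivAt.mul hd1).mfderiv
  refine (DFunLike.congr_fun hd ν).trans ?_
  change χ x * W' (chartDiff q x ν) + W (extChartAt (𝓡∂ m) q x) * _ = _
  rw [h0, zero_mul, add_zero]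

/-- Locally, a conformal factor whose normal derivative along the family `F` is prescribed by the
mean curvature. -/
theorem exists_local_conformalFactor [T2Space M] [CompactSpace S] (g : Metric m M) {F : ℝ × S → M}
    (hF : ContMDiff (𝓘(ℝ, ℝ).prod (𝓡∂ n)) (𝓡∂ m) ∞ F) (hind : IsInducing fun p => F (0, p))
    (himm : ∀ s p, Function.Injective (mfderiv (𝓡∂ n) (𝓡∂ m) (fun p => F (s, p)) p))
    (hmin : ∀ (p : S) (ν : EuclideanSpace ℝ (Fin m)), IsNormal (n := n) g (fun p => F (0, p)) p ν →
      meanCurvature (n := n) g (fun p => F (0, p)) p ν = 0)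
    {p₀ : S} (hp₀ : p₀ ∈ (𝓡∂ n).interior S) :
    ∃ B ∈ 𝓝 p₀, ∀ ζ : S → ℝ, ContMDiff (𝓡∂ n) 𝓘(ℝ, ℝ) ∞ ζ → (∀ p ∉ B, ζ p = 0) →
      ∃ U : ℝ × M → ℝ, ContMDiff (𝓘(ℝ, ℝ).prod (𝓡∂ m)) 𝓘(ℝ, ℝ) ∞ U ∧ (∀ x, U (0, x) = 0) ∧
        ∀ᶠ s in 𝓝 (0 : ℝ), ∀ (p : S) (ν : EuclideanSpace ℝ (Fin m)),
          IsNormal (n := n) g (fun p => F (s, p)) p ν →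
          flatGradient (fun x => U (s, x)) (F (s, p)) ν =
            ζ p * meanCurvature (n := n) g (fun p => F (s, p)) p ν := by
  set q₀ : M := F (0, p₀) with hq₀
  set e := extChartAt (𝓡∂ n) p₀ with he
  set e' := extChartAt (𝓡∂ m) q₀ with he'
  set f := chartFamily (n := n) (m := m) F p₀ q₀ with hf
  set O := chartFamilyDomain (n := n) (m := m) F p₀ q₀ with hO
  set G := chartMetric g q₀ with hG
  have hslice : ∀ s, ContMDiff (𝓡∂ n) (𝓡∂ m) ∞ (fun p => F (s, p)) := fun s =>
    hF.comp (contMDiff_const.prodMk contMDiff_id)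
  have hOint : ∀ z ∈ O, e.symm z.2 ∈ (𝓡∂ n).interior S := fun z hz =>
    mem_interior_of_mem_interior_target hz.1
  have hOsrc : ∀ z ∈ O, e.symm z.2 ∈ e.source := fun z hz => e.map_target (interior_subset hz.1)
  have hOe : ∀ z ∈ O, e (e.symm z.2) = z.2 := fun z hz => e.right_inv (interior_subset hz.1)
  have hfz : ∀ z ∈ O, ContDiffAt ℝ ∞ f z := fun z hz => contDiffAt_chartFamily hF hz
  have hfR : ∀ z, f z ∈ range (𝓡∂ m) := fun z => mem_range_self _
  have hGf : ∀ z ∈ O, ContDiffWithinAt ℝ ∞ G (range (𝓡∂ m)) (f z) := fun z hz =>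
    contDiffWithinAt_chartMetric g (e'.map_source hz.2)
  have hpos : ∀ z ∈ O, ∀ v ≠ 0, 0 < localFirstForm G (fun y => f (z.1, y)) z.2 v v := by
    intro z hz v hv
    have h := localFirstForm_chart_pos (φ := fun p => F (z.1, p)) (hOint z hz) (hslice z.1 _)
      (hOsrc z hz) hz.2 g (himm _ _) hv
    rw [← he, hOe z hz] at h
    exact h
  have hz₀ : ((0 : ℝ), e p₀) ∈ O := by
    refine ⟨mem_interior_target hp₀ (mem_extChartAt_source p₀), ?_⟩
    change F (0, e.symm (e p₀)) ∈ e'.source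
    rw [e.left_inv (mem_extChartAt_source p₀)]
    exact mem_extChartAt_source _
  have hinj0 : Function.Injective (fderiv ℝ (fun y => f (0, y)) (e p₀)) :=
    fderiv_chart_injective (φ := fun p => F (0, p)) hp₀ (hslice 0 _) (mem_extChartAt_source p₀)
      (mem_extChartAt_source _) (himm _ _)
  have hzero : ∀ z ∈ O, z.1 = 0 →
      meanCurvatureCovector G (range (𝓡∂ m)) (fun y => f (z.1, y)) z.2 = 0 := by
    intro z hz hz1
    have h := meanCurvatureCovector_chart_eq_zero (φ := fun p => F (z.1, p)) (hOint _ hz)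
      (hslice z.1 _) (hOsrc _ hz) hz.2 g (himm _ _) (by rw [hz1]; exact hmin _)
    rw [← he, hOe _ hz] at h
    exact h
  obtain ⟨A, V, hA, hz₀A, hAO, hV, hAV, hfactor⟩ := exists_factor_along_family
    (𝓡∂ m).uniqueDiffOn (isOpen_chartFamilyDomain hF.continuous p₀ q₀) hfz hfR hGf
    (fun x v w => chartMetric_symm g q₀ x v w) hpos hzero hz₀ hinj0
  have hfval : ∀ z, f z = e' (F (z.1, e.symm z.2)) := fun _ => rfl
  have hfcomp : ∀ s, (fun y => f (s, y)) = e' ∘ (fun p => F (s, p)) ∘ e.symm := fun _ => rfl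
  clear_value f
  -- These are the pairs at which the local solution `W` controls the hypersurface.
  set 𝒢 : Set (ℝ × S) := {z | z.2 ∈ e.source ∧ (z.1, e z.2) ∈ A} with h𝒢
  have h𝒢o : IsOpen 𝒢 := by
    have h1 : ContinuousOn (fun z : ℝ × S => (z.1, e z.2)) (Prod.snd ⁻¹' e.source) :=
      continuous_fst.continuousOn.prodMk ((continuousOn_extChartAt p₀).comp
        continuous_snd.continuousOn fun z hz => hz)
    exact h1.isOpen_inter_preimage ((isOpen_extChartAt_source p₀).preimage continuous_snd) hA
  have h𝒢0 : ((0 : ℝ), p₀) ∈ 𝒢 := ⟨mem_extChartAt_source p₀, hz₀A⟩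
  set VM : Set (ℝ × M) := {x | x.2 ∈ e'.source ∧ (x.1, e' x.2) ∈ V} with hVM
  have hVMo : IsOpen VM := by
    have h1 : ContinuousOn (fun z : ℝ × M => (z.1, e' z.2)) (Prod.snd ⁻¹' e'.source) :=
      continuous_fst.continuousOn.prodMk ((continuousOn_extChartAt q₀).comp
        continuous_snd.continuousOn fun z hz => hz)
    exact h1.isOpen_inter_preimage ((isOpen_extChartAt_source q₀).preimage continuous_snd) hV
  have h𝒢f : ∀ z ∈ 𝒢, f (z.1, e z.2) = e' (F z) := by
    intro z hz
    rw [hfval, e.left_inv hz.1]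
  have h𝒢VM : ∀ z ∈ 𝒢, (z.1, F z) ∈ VM := by
    intro z hz
    have h1 := (hAO hz.2).2
    change F (z.1, e.symm (e z.2)) ∈ e'.source at h1
    rw [e.left_inv hz.1] at h1
    refine ⟨h1, ?_⟩
    have h2 := hAV _ hz.2
    rw [h𝒢f z hz] at h2
    exact h2
  -- the cutoff function
  obtain ⟨N, hN, hN𝒢⟩ : ∃ N ∈ 𝓝 q₀, ∀ p, F (0, p) ∈ N → ((0 : ℝ), p) ∈ 𝒢 := by
    have h0 : Continuous (fun p : S => ((0 : ℝ), p)) := by fun_prop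
    have h1 : (fun p : S => ((0 : ℝ), p)) ⁻¹' 𝒢 ∈ 𝓝 p₀ := (h𝒢o.preimage h0).mem_nhds h𝒢0
    -- Because `F(0, ·)` is inducing, no other sheet of the hypersurface returns near `q₀`.
    rw [hind.nhds_eq_comap, mem_comap] at h1
    obtain ⟨N, hN, hN'⟩ := h1
    exact ⟨N, hN, fun p hp => hN' hp⟩
  obtain ⟨χ, -, hχ⟩ := (SmoothBumpFunction.nhds_basis_tsupport (I := 𝓘(ℝ, ℝ).prod (𝓡∂ m))
    ((0 : ℝ), q₀)).mem_iff.1 (inter_mem (hVMo.mem_nhds (h𝒢VM _ h𝒢0))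
      (prod_mem_nhds (univ_mem (f := 𝓝 (0 : ℝ))) hN))
  have hχs : ContMDiff (𝓘(ℝ, ℝ).prod (𝓡∂ m)) 𝓘(ℝ, ℝ) ∞ χ := χ.contMDiff
  have hFc : Continuous (fun z : ℝ × S => (z.1, F z)) := continuous_fst.prodMk hF.continuous
  -- By compactness of `S`, the separation of sheets persists for small `s`: the slice meets the
  -- support of the cutoff only at points of `𝒢`.
  have hgood : ∀ᶠ s in 𝓝 (0 : ℝ), ∀ p ∈ (univ : Set S), (s, F (s, p)) ∈ tsupport χ → (s, p) ∈ 𝒢 := by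
    refine isCompact_univ.eventually_forall_of_forall_eventually fun p _ => ?_
    by_cases hp : ((0 : ℝ), F (0, p)) ∈ tsupport χ
    · filter_upwards [h𝒢o.mem_nhds (hN𝒢 p (hχ hp).2.2)] with z hz _ using hz
    · filter_upwards [(((isClosed_tsupport χ).preimage hFc).isOpen_compl).mem_nhds
        (show ((0 : ℝ), p) ∈ _ from hp)] with z hz hz' using absurd hz' hz
  have hnear : ∀ᶠ z in 𝓝 ((0 : ℝ), p₀), z ∈ 𝒢 ∧ χ (z.1, F z) = 1 := by
    refine (h𝒢o.eventually_mem h𝒢0).and ?_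
    exact (hFc.tendsto ((0 : ℝ), p₀)).eventually χ.eventuallyEq_one
  rw [nhds_prod_eq, eventually_prod_iff] at hnear
  obtain ⟨pa, hpa, pb, hpb, hab⟩ := hnear
  -- On this neighbourhood the cutoff equals `1` along the hypersurface for small `s`, so it does
  -- not disturb the prescribed derivative; outside it `ζ` vanishes and both sides are zero.
  refine ⟨{p | pb p}, hpb, fun ζ hζ hζB => ?_⟩
  have hζe : ∀ z ∈ O, ContDiffAt ℝ ∞ (fun y => ζ (e.symm y)) z.2 := by
    intro z hz
    have h1 : ContMDiffWithinAt 𝓘(ℝ, EuclideanSpace ℝ (Fin n)) 𝓘(ℝ, ℝ) ∞ (fun y => ζ (e.symm y))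
        (range (𝓡∂ n)) z.2 :=
      (hζ _).comp_contMDiffWithinAt z.2
        (contMDiffWithinAt_extChartAt_symm_range p₀ (interior_subset hz.1))
    exact (contMDiffWithinAt_iff_contDiffWithinAt.1 h1).contDiffAt (mem_of_superset
      (mem_interior_iff_mem_nhds.1 hz.1) (extChartAt_target_subset_range p₀))
  obtain ⟨W, hWs, hW0, hWA⟩ := hfactor (fun y => ζ (e.symm y)) hζe
  refine ⟨fun x => χ x * W (x.1, e' x.2), ?_, ?_, ?_⟩
  · refine contMDiff_of_tsupport fun x hx => ?_
    have hx' : x ∈ VM := (hχ (tsupport_mul_subset_left hx)).1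
    refine (hχs x).mul ?_
    have h1 : ContMDiffAt (𝓘(ℝ, ℝ).prod (𝓡∂ m)) 𝓘(ℝ, ℝ × EuclideanSpace ℝ (Fin m)) ∞
        (fun x : ℝ × M => (x.1, e' x.2)) x :=
      contMDiffAt_fst.prodMk_space
        ((contMDiffAt_extChartAt' (by simpa [he'] using hx'.1)).comp x contMDiffAt_snd)
    exact (hWs _ hx'.2).contMDiffAt.comp x h1
  · intro x
    by_cases hx : ((0 : ℝ), x) ∈ tsupport χ
    · have hx' := (hχ hx).1
      change _ * W (0, e' x) = 0
      rw [hW0 _ hx'.2, mul_zero]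
    · change _ * W (0, e' x) = 0
      rw [image_eq_zero_of_notMem_tsupport hx, zero_mul]
  · filter_upwards [hgood, hpa] with s hs hsa p ν hν
    by_cases hsupp : (s, F (s, p)) ∈ tsupport χ
    · have h𝒢p := hs p (mem_univ p) hsupp
      have hzO := hAO h𝒢p.2
      have hfe : f (s, e p) = e' (F (s, p)) := h𝒢f (s, p) h𝒢p
      obtain ⟨hw0, hwd⟩ := hWA (s, e p) h𝒢p.2
      have hpi : p ∈ (𝓡∂ n).interior S := by
        have := hOint _ hzO
        rwa [e.left_inv h𝒢p.1] at this
      have hFs : F (s, p) ∈ e'.source := (h𝒢VM _ h𝒢p).1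
      simp only [hfe, e.left_inv h𝒢p.1] at hw0 hwd
      have hcurv := meanCurvatureCovector_chart (φ := fun p => F (s, p)) (q₀ := q₀) hpi (hslice s _)
        h𝒢p.1 hFs g hν
      have hgrad : flatGradient (fun x => χ (s, x) * W (s, e' x)) (F (s, p)) ν =
          χ (s, F (s, p)) * (ζ p * meanCurvature (n := n) g (fun p => F (s, p)) p ν) := by
        rw [← hcurv]
        have h := flatGradient_mul_chart hFs (ContMDiff.slice hχs s (F (s, p))) hwd hw0 ν
        rw [hfcomp] at h
        exact h
      rw [hgrad]
      by_cases hpB : pb p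
      · rw [(hab hsa hpB).2, one_mul]
      · rw [hζB p hpB]; simp
    · have h1 : ζ p = 0 := by
        refine hζB p fun hpB => hsupp (subset_tsupport _ ?_)
        rw [Function.mem_support, (hab hsa hpB).2]
        exact one_ne_zero
      have h2 : (fun x => χ (s, x) * W (s, e' x)) =ᶠ[𝓝 (F (s, p))] fun _ => 0 := by
        have h3 : Continuous (fun x : M => (s, x)) := by fun_prop
        filter_upwards [((isClosed_tsupport χ).preimage h3).isOpen_compl.mem_nhds hsupp] with x hx
        rw [image_eq_zero_of_notMem_tsupport hx, zero_mul]
      rw [h1, zero_mul]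
      change mfderiv (𝓡∂ m) 𝓘(ℝ, ℝ) (fun x => χ (s, x) * W (s, e' x)) (F (s, p)) ν = 0
      rw [h2.mfderiv_eq, mfderiv_const]
      rfl

end LocalFactor
end FreeBoundary

namespace FreeBoundary

/-! ### Curvature quantities depend on the germ of the map only. -/

section Locality

variable {n m : ℕ} [NeZero n] [NeZero m]
  {S : Type*} [TopologicalSpace S] [ChartedSpace (EuclideanHalfSpace n) S]
  {M : Type*} [TopologicalSpace M] [ChartedSpace (EuclideanHalfSpace m) M] [IsManifold (𝓡∂ m) ∞ M]

lemma meanCurvature_eq_relTrace (g : Metric m M) (φ : S → M) (p : S) (ν : EuclideanSpace ℝ (Fin m)) :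
    meanCurvature (n := n) g φ p ν =
      relTrace (fun v w => flatMetric g (φ p) (flatDifferential φ p v) (flatDifferential φ p w))
        (fun v w => flatMetric g (φ p) (coordHessian (n := n) (m := m) φ p v w) ν +
          christoffel g (φ p) (flatDifferential φ p v) (flatDifferential φ p w) ν) :=
  rfl

variable {φ φ' : S → M} {p : S} (h : φ =ᶠ[𝓝 p] φ')
include h

lemma flatDifferential_congr :
    flatDifferential (n := n) (m := m) φ p = flatDifferential (n := n) (m := m) φ' p :=
  h.mfderiv_eq

lemma isNormal_congr (g : Metric m M) (ν : EuclideanSpace ℝ (Fin m)) :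
    IsNormal (n := n) g φ p ν ↔ IsNormal (n := n) g φ' p ν := by
  rw [isNormal_iff, isNormal_iff, h.eq_of_nhds, flatDifferential_congr h]

lemma coordHessian_congr (v w : EuclideanSpace ℝ (Fin n)) :
    coordHessian (n := n) (m := m) φ p v w = coordHessian (n := n) (m := m) φ' p v w := by
  have h2 : Tendsto (extChartAt (𝓡∂ n) p).symm (𝓝 (extChartAt (𝓡∂ n) p p)) (𝓝 p) := by
    have := (continuousAt_extChartAt_symm (I := 𝓡∂ n) p).tendsto
    rwa [extChartAt_to_inv] at this
  have h3 : writtenInExtChartAt (𝓡∂ n) (𝓡∂ m) p φ =ᶠ[𝓝[range (𝓡∂ n)] (extChartAt (𝓡∂ n) p p)]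
      writtenInExtChartAt (𝓡∂ n) (𝓡∂ m) p φ' := by
    refine Eventually.filter_mono nhdsWithin_le_nhds ?_
    filter_upwards [h2.eventually h] with y hy
    simp only [writtenInExtChartAt, Function.comp_apply, hy, h.eq_of_nhds]
  simp only [coordHessian]
  rw [h3.fderivWithin.fderivWithin_eq_of_mem (mem_range_self _)]

lemma meanCurvature_congr (g : Metric m M) (ν : EuclideanSpace ℝ (Fin m)) :
    meanCurvature (n := n) g φ p ν = meanCurvature (n := n) g φ' p ν := by
  rw [meanCurvature_eq_relTrace, meanCurvature_eq_relTrace, h.eq_of_nhds, flatDifferential_congr h]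
  simp only [coordHessian_congr h]

end Locality

/-! ### Global conformal factor by a partition of unity. -/

section ConformalFactor

variable {m : ℕ} [NeZero m]
  {M : Type*} [TopologicalSpace M] [ChartedSpace (EuclideanHalfSpace m) M] [IsManifold (𝓡∂ m) ∞ M]

lemma flatGradient_sum {ι : Type*} {s : Finset ι} {u : ι → M → ℝ}
    (hu : ∀ i ∈ s, ContMDiff (𝓡∂ m) 𝓘(ℝ, ℝ) ∞ (u i)) (x : M) (ν : EuclideanSpace ℝ (Fin m)) :
    flatGradient (fun x => ∑ i ∈ s, u i x) x ν = ∑ i ∈ s, flatGradient (u i) x ν := by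
  have h1 := flatGradient_hasFDerivWithinAt (contMDiff_finsetSum hu) x
  have h2 := HasFDerivWithinAt.fun_sum fun i hi => flatGradient_hasFDerivWithinAt (hu i hi) x
  have h3 := ((𝓡∂ m).uniqueDiffOn _ (mem_range_self _)).eq h1 h2
  rw [h3, sum_apply]

variable {n : ℕ} [NeZero n]
  {S : Type*} [TopologicalSpace S] [ChartedSpace (EuclideanHalfSpace n) S] [IsManifold (𝓡∂ n) ∞ S]

/-- A family of conformal factors which makes a family of hypersurfaces minimal, if the initial
hypersurface is minimal and the family is constant near the boundary. -/
theorem exists_conformalFactor [T2Space M] [T2Space S] [CompactSpace S] (g : Metric m M)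
    {F : ℝ × S → M} (hF : ContMDiff (𝓘(ℝ, ℝ).prod (𝓡∂ n)) (𝓡∂ m) ∞ F)
    (hind : IsInducing fun p => F (0, p))
    (himm : ∀ s p, Function.Injective (mfderiv (𝓡∂ n) (𝓡∂ m) (fun p => F (s, p)) p))
    (hmin : ∀ (p : S) (ν : EuclideanSpace ℝ (Fin m)), IsNormal (n := n) g (fun p => F (0, p)) p ν →
      meanCurvature (n := n) g (fun p => F (0, p)) p ν = 0)
    {O : Set S} (hO : IsOpen O) (hOb : (𝓡∂ n).boundary S ⊆ O)
    (hFO : ∀ s, ∀ p ∈ O, F (s, p) = F (0, p)) :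
    ∃ (U : ℝ × M → ℝ) (hU : ContMDiff (𝓘(ℝ, ℝ).prod (𝓡∂ m)) 𝓘(ℝ, ℝ) ∞ U),
      (∀ x, U (0, x) = 0) ∧
      ∀ᶠ s in 𝓝 (0 : ℝ), ∀ (p : S) (ν : EuclideanSpace ℝ (Fin m)),
        IsNormal (n := n) g (fun p => F (s, p)) p ν →
        meanCurvature (n := n) (conformalMetric g (fun x => U (s, x)) (ContMDiff.slice hU s))
          (fun p => F (s, p)) p ν = 0 := by
  have hloc : ∀ p : (Oᶜ : Set S), _ := fun p =>
    exists_local_conformalFactor g hF hind himm hmin (p₀ := (p : S)) (by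
      by_contra hcon
      exact p.2 (hOb (mem_boundary_iff_not_mem_interior.2 hcon)))
  choose B hB hfac using hloc
  obtain ⟨t, ht⟩ := (hO.isClosed_compl.isCompact).elim_finite_subcover
    (fun p : (Oᶜ : Set S) => interior (B p)) (fun _ => isOpen_interior)
    (fun p hp => mem_iUnion.2 ⟨⟨p, hp⟩, mem_interior_iff_mem_nhds.2 (hB ⟨p, hp⟩)⟩)
  have ht' : Oᶜ ⊆ ⋃ i : t, interior (B i) := fun p hp => by
    obtain ⟨i, hi, hpi⟩ := mem_iUnion₂.1 (ht hp)
    exact mem_iUnion.2 ⟨⟨i, hi⟩, hpi⟩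
  obtain ⟨ρ, hρ⟩ := SmoothPartitionOfUnity.exists_isSubordinate (𝓡∂ n) hO.isClosed_compl
    (fun i : t => interior (B i)) (fun _ => isOpen_interior) ht'
  -- The weight `2 / n` inverts the factor `n / 2` of the conformal formula.
  have hfac' : ∀ i : t, _ := fun i => hfac i (fun p => 2 / (n : ℝ) * ρ i p)
    (contMDiff_const.mul (ρ i).contMDiff) (fun p hp => by
      have h1 : ρ i p = 0 := image_eq_zero_of_notMem_tsupport fun h =>
        hp (interior_subset (hρ i h))
      rw [h1, mul_zero])
  choose U hU hU0 hUs using hfac'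
  refine ⟨fun x => ∑ i, U i x, contMDiff_finsetSum fun i _ => hU i,
    fun x => by simp [hU0], ?_⟩
  filter_upwards [eventually_all.2 hUs] with s hs p ν hν
  rw [meanCurvature_conformal g _ (himm s p) hν,
    flatGradient_sum (fun i _ => ContMDiff.slice (hU i) s)]
  simp only [hs _ p ν hν]
  rw [← Finset.sum_mul, ← Finset.mul_sum]
  have hn : (n : ℝ) ≠ 0 := Nat.cast_ne_zero.2 (NeZero.ne n)
  -- The partition sums to one only off `O`. On `O` the hypersurface has not moved, so `H` vanishes,
  -- and with it the prescribed derivative, whatever the sum is.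
  by_cases hp : p ∈ O
  · have h1 : (fun p => F (s, p)) =ᶠ[𝓝 p] fun p => F (0, p) := by
      filter_upwards [hO.mem_nhds hp] with p hp using hFO s p hp
    have h2 : meanCurvature (n := n) g (fun p => F (s, p)) p ν = 0 := by
      rw [meanCurvature_congr h1]
      exact hmin p ν ((isNormal_congr h1 g ν).1 hν)
    rw [h2]
    simp
  · have h1 := ρ.sum_eq_one (show p ∈ Oᶜ from hp)
    rw [finsum_eq_sum_of_fintype] at h1
    rw [h1]
    field_simp
    ring

end ConformalFactor

/-! ### The perturbed family is properly embedded, minimal and of free boundary. -/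

section FreeBoundaryFamily

variable {n : ℕ} [NeZero n]
  {M : Type*} [TopologicalSpace M] [T2Space M] [ChartedSpace (EuclideanHalfSpace (n + 1)) M]
  [IsManifold (𝓡∂ (n + 1)) ∞ M]
  {S : Type*} [TopologicalSpace S] [CompactSpace S] [ChartedSpace (EuclideanHalfSpace n) S]
  [IsManifold (𝓡∂ n) ∞ S]
  {g : Metric (n + 1) M} {φ : S → M}

lemma IsFreeBoundaryMinimal.flat_orthogonal (hmin : IsFreeBoundaryMinimal (n := n) g φ) {p : S}
    (hp : p ∈ (𝓡∂ n).boundary S) {ν N : EuclideanSpace ℝ (Fin (n + 1))}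
    (hν : IsNormal (n := n) g φ p ν)
    (hN : ∀ w : EuclideanSpace ℝ (Fin (n + 1)), w 0 = 0 → flatMetric g (φ p) w N = 0) :
    flatMetric g (φ p) ν N = 0 :=
  hmin.orthogonal p hp ν N hν hN

/-- Pushing an almost properly embedded hypersurface inwards makes it properly embedded. -/
lemma IsInwardPush.isProperlyEmbedded (hφ : IsAlmostProperlyEmbedded (n := n) (m := n + 1) φ)
    {Ψ : ℝ × M → M} (hΨ : IsInwardPush (m := n + 1) (φ '' (𝓡∂ n).boundary S)
      (φ '' {p : S | φ p ∈ (𝓡∂ (n + 1)).boundary M ∧ p ∉ (𝓡∂ n).boundary S}) Ψ)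
    {s : ℝ} (hs : s ≠ 0) :
    IsProperlyEmbedded (n := n) (m := n + 1) (fun p => Ψ (s, φ p)) := by
  have hsm : ContMDiff (𝓡∂ n) (𝓡∂ (n + 1)) ∞ (fun p => Ψ (s, φ p)) :=
    (hΨ.smooth_slice s).comp hφ.smooth
  obtain ⟨U, -, hCU, hfix⟩ := hΨ.fixed
  refine ⟨⟨hsm, ?_, fun p => ?_, fun p hp => ?_⟩, ?_⟩
  · exact (hsm.continuous.isClosedEmbedding
      ((hΨ.injective s).comp hφ.embedding.injective)).isEmbedding
  · have h1 := mfderiv_comp p ((hΨ.smooth_slice s).mdifferentiableAt (by simp) (x := φ p))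
      (hφ.smooth.mdifferentiableAt (by simp) (x := p))
    change Function.Injective (mfderiv (𝓡∂ n) (𝓡∂ (n + 1)) ((fun x => Ψ (s, x)) ∘ φ) p)
    rw [h1]
    exact (hΨ.immersion s _).comp (hφ.immersion p)
  · simp only [hfix s _ (hCU (mem_image_of_mem φ hp))]
    exact hφ.boundary p hp
  · refine eq_empty_iff_forall_notMem.2 ?_
    rintro _ ⟨⟨⟨p, rfl⟩, hb⟩, hnb⟩
    -- A point found on `∂M` after the push has not moved. If it did not come from `∂S`, it was
    -- already a touching point, and those are pushed off.
    have h1 := hΨ.boundary s (φ p) hb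
    by_cases hp : p ∈ (𝓡∂ n).boundary S
    · exact hnb ⟨p, hp, rfl⟩
    · have h2 : φ p ∈ (𝓡∂ (n + 1)).boundary M := by simpa only [h1] using hb
      exact mem_boundary_iff_not_mem_interior.1 hb
        (hΨ.inward s hs _ (mem_image_of_mem φ ⟨h2, hp⟩))

/-- The smooth perturbation, as a one-parameter family. -/
theorem exists_family [T2Space S] (hφ : IsAlmostProperlyEmbedded (n := n) (m := n + 1) φ)
    (hmin : IsFreeBoundaryMinimal (n := n) g φ) :
    ∃ (F : ℝ × S → M) (U : ℝ × M → ℝ)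
      (hU : ContMDiff (𝓘(ℝ, ℝ).prod (𝓡∂ (n + 1))) 𝓘(ℝ, ℝ) ∞ U),
      ContMDiff (𝓘(ℝ, ℝ).prod (𝓡∂ n)) (𝓡∂ (n + 1)) ∞ F ∧ (∀ p, F (0, p) = φ p) ∧
      (∀ x, U (0, x) = 0) ∧ ∀ᶠ s in 𝓝[≠] (0 : ℝ),
        IsProperlyEmbedded (n := n) (m := n + 1) (fun p => F (s, p)) ∧
        IsFreeBoundaryMinimal (n := n)
          (conformalMetric g (fun x => U (s, x)) (ContMDiff.slice hU s)) (fun p => F (s, p)) := by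
  have hC : IsClosed (φ '' (𝓡∂ n).boundary S) :=
    ((((𝓡∂ n).isClosed_boundary (n := ∞) (by simp)).isCompact).image hφ.smooth.continuous).isClosed
  have hA := (isCompact_touching hφ hmin).image hφ.smooth.continuous
  have hdisj : Disjoint (φ '' {p : S | φ p ∈ (𝓡∂ (n + 1)).boundary M ∧ p ∉ (𝓡∂ n).boundary S})
      (φ '' (𝓡∂ n).boundary S) := by
    rw [disjoint_image_iff hφ.embedding.injective, Set.disjoint_left]
    exact fun p hp hp' => hp.2 hp'
  obtain ⟨Ψ, hΨ⟩ := exists_isInwardPush (m := n + 1) hC hA hdisj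
  obtain ⟨V, hV, hCV, hfix⟩ := hΨ.fixed
  have hF : ContMDiff (𝓘(ℝ, ℝ).prod (𝓡∂ n)) (𝓡∂ (n + 1)) ∞
      (fun z : ℝ × S => Ψ (z.1, φ z.2)) :=
    hΨ.smooth.comp (contMDiff_fst.prodMk (hφ.smooth.comp contMDiff_snd))
  have hF0 : (fun p => Ψ (0, φ p)) = φ := funext fun p => hΨ.zero _
  have himm : ∀ s p, Function.Injective
      (mfderiv (𝓡∂ n) (𝓡∂ (n + 1)) (fun p => Ψ (s, φ p)) p) := by
    intro s p
    have h1 := mfderiv_comp p ((hΨ.smooth_slice s).mdifferentiableAt (by simp) (x := φ p))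
      (hφ.smooth.mdifferentiableAt (by simp) (x := p))
    change Function.Injective (mfderiv (𝓡∂ n) (𝓡∂ (n + 1)) ((fun x => Ψ (s, x)) ∘ φ) p)
    rw [h1]
    exact (hΨ.immersion s _).comp (hφ.immersion p)
  have hOopen : IsOpen (φ ⁻¹' V) := hV.preimage hφ.smooth.continuous
  have hOb : (𝓡∂ n).boundary S ⊆ φ ⁻¹' V := fun p hp => hCV (mem_image_of_mem φ hp)
  obtain ⟨U, hU, hU0, hUs⟩ := exists_conformalFactor g hF
    (by simp only [hF0]; exact hφ.embedding.isInducing) himm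
    (fun p ν hν => (meanCurvature_congr (Eventually.of_forall fun p => hΨ.zero _) g ν).trans
      (hmin.minimal p ν ((isNormal_congr (Eventually.of_forall fun p => hΨ.zero _) g ν).1 hν))) hOopen hOb
    (fun s p hp => by simp only [hfix s _ hp, hΨ.zero])
  refine ⟨_, U, hU, hF, fun p => hΨ.zero _, hU0, ?_⟩
  filter_upwards [nhdsWithin_le_nhds hUs, self_mem_nhdsWithin] with s hs hs0
  refine ⟨IsInwardPush.isProperlyEmbedded hφ hΨ hs0, fun p ν hν => ?_, fun p hp ν N hν hN => ?_⟩
  · exact hs p ν ((isNormal_conformal_iff g (ContMDiff.slice hU s) _ p ν).1 hν)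
  · have h1 : (fun p => Ψ (s, φ p)) =ᶠ[𝓝 p] φ := by
      filter_upwards [hOopen.mem_nhds (hOb hp)] with p hp using hfix s _ hp
    have hν' := (isNormal_congr h1 g ν).1
      ((isNormal_conformal_iff g (ContMDiff.slice hU s) _ p ν).1 hν)
    have hx : Ψ (s, φ p) = φ p := h1.eq_of_nhds
    have hN' : ∀ w : EuclideanSpace ℝ (Fin (n + 1)), w 0 = 0 → flatMetric g (φ p) w N = 0 := by
      intro w hw
      have h2 : Real.exp (U (s, Ψ (s, φ p))) * flatMetric g (Ψ (s, φ p)) w N = 0 := hN w hw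
      rw [hx] at h2
      exact (mul_eq_zero.1 h2).resolve_left (Real.exp_pos _).ne'
    have h3 := hmin.flat_orthogonal hp hν' hN'
    change Real.exp (U (s, Ψ (s, φ p))) * flatMetric g (Ψ (s, φ p)) ν N = 0
    rw [hx, h3, mul_zero]

end FreeBoundaryFamily
end FreeBoundary

theorem mainTheorem12 (n : ℕ) [NeZero n]
    {M : Type*} [TopologicalSpace M] [T2Space M] [CompactSpace M]
    [ChartedSpace (EuclideanHalfSpace (n + 1)) M] [IsManifold (𝓡∂ (n + 1)) ∞ M]
    {S : Type*} [TopologicalSpace S] [T2Space S] [CompactSpace S]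
    [ChartedSpace (EuclideanHalfSpace n) S] [IsManifold (𝓡∂ n) ∞ S]
    (g : FreeBoundary.Metric (n + 1) M) (φ : S → M)
    (hφ : FreeBoundary.IsAlmostProperlyEmbedded (n := n) (m := n + 1) φ)
    (hmin : FreeBoundary.IsFreeBoundaryMinimal (n := n) g φ) :
    ∃ (gs : ℕ → FreeBoundary.Metric (n + 1) M) (φs : ℕ → S → M),
      FreeBoundary.MetricsConvergeSmoothly gs g ∧
      FreeBoundary.MapsConvergeSmoothly (n := n) (m := n + 1) φs φ ∧
      ∀ i, FreeBoundary.IsProperlyEmbedded (n := n) (m := n + 1) (φs i) ∧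
        FreeBoundary.IsFreeBoundaryMinimal (n := n) (gs i) (φs i) := by
  obtain ⟨F, U, hU, hF, hF0, hU0, hs⟩ := FreeBoundary.exists_family hφ hmin
  -- The parameters tend to `0` through nonzero values, since the push clears the touching set only
  -- for `s ≠ 0`. The shift by `N` below turns eventual validity into validity for every index.
  obtain ⟨σ', hσ'⟩ := exists_seq_tendsto (𝓝[≠] (0 : ℝ))
  obtain ⟨N, hN⟩ := eventually_atTop.1 (hσ'.eventually hs)
  set σ : ℕ → ℝ := fun i => σ' (i + N)
  have hσ : Tendsto σ atTop (𝓝 0) :=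
    (tendsto_add_atTop_iff_nat N).2 (tendsto_nhds_of_tendsto_nhdsWithin hσ')
  refine ⟨fun i => FreeBoundary.conformalMetric g (fun x => U (σ i, x))
    (FreeBoundary.ContMDiff.slice hU (σ i)), fun i p => F (σ i, p),
    FreeBoundary.metricsConvergeSmoothly_conformal g hU hU0 hσ, ?_,
    fun i => hN (i + N) (Nat.le_add_left N i)⟩
  have h := FreeBoundary.mapsConvergeSmoothly_of_contMDiff hF hσ
  simp only [hF0] at h
  exact h
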